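/- **Theorem (quasi Poisson reduction).** *Setting.* Work in one of the following categories: smooth manifolds and Lie groups over $\mathbb K=\mathbb R$; real analytic manifolds and Lie groups over $\mathbb K=\mathbb R$; complex analytic manifolds and Lie groups over $\mathbb K=\mathbb C$; or non-singular affine varieties and affine algebraic groups defined over a field $\mathbb K$ of characteristic zero, not necessarily algebraically closed. Let $G$ be a group in the category with Lie algebra $\mathfrak g$, let $M$ be a (left) $G$-manifold, and let $\mathcal A[M]$ be the algebra of admissible (smooth, analytic, regular) $\mathbb K$-valued functions on $M$. Write $X^L_q=\frac d{dt}|_{0}\,q\exp(tX)$, $X^R_q=\frac d{dt}|_{0}\exp(tX)q$ for $q\in G$, and $X_{M,q}=\frac d{dt}|_{0}\exp(-tX)q$ for $q\in M$ ($X\in\mathfrak g$). Let $\mathcal H=\sum \eta^{j,k}e_j\otimes e_k\in\mathfrak g\otimes\mathfrak g$ be an arbitrary, possibly degenerate, $\mathrm{Ad}$-invariant symmetric $2$-tensor and let $\phi_{\mathcal H}=\frac12(\mathrm{Id}\otimes[\cdot,\cdot]\otimes\mathrm{Id})(\mathcal H\otimes\mathcal H)\in\mathfrak g^{\otimes 3}$.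 Let $P$ be a $G$-invariant bivector field on $M$ whose Schouten square satisfies $[P,P]=c\,\phi_{\mathcal H,M}$, where $\phi_{\mathcal H,M}$ is the image of $\phi_{\mathcal H}$ under the infinitesimal action and $c\in\mathbb K$ is a constant (the normalization $c=1$ being included), and let $\Phi\colon M\to G$ be an admissible map, equivariant with respect to conjugation on $G$, which is a momentum mapping for $P$ relative to $\mathcal H$, that is, $(d\Phi\otimes\mathrm{Id})P=\tfrac12\sum\eta^{j,k}\,(e_j^L+e_j^R)|_{\Phi}\otimes e_{k,M}$. 1. $\{f,h\}=\langle P,df\wedge dh\rangle$ defines a Poisson bracket on the algebra $\mathcal A[M]^G$ of $G$-invariant admissible functions. 2. Let $\mathcal C$ be a conjugacy class of $G$ contained in the image of $\Phi$, and let $I_{\mathcal C}\subseteq\mathcal A[M]^G$ be the ideal of the invariant admissible functions that vanish on $\Phi^{-1}(\mathcal C)$. (In the algebraic case, points of $M$ and $G$ and the class $\mathcal C$ are taken over any extension field $\Omega$ of $\mathbb K$ that is algebraically closed or isomorphic to $\mathbb R$; $\Omega=\mathbb K$ is allowed if $\mathbb K$ is itself of this kind.) Then $I_{\mathcal C}$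 is a Poisson ideal in $\mathcal A[M]^G$, so that $\mathcal A[M]^G/I_{\mathcal C}$ inherits a Poisson bracket. Moreover: (a) Restriction to $\Phi^{-1}(\mathcal C)$ identifies $\mathcal A[M]^G/I_{\mathcal C}$ with an algebra of continuous functions on the orbit space $\Phi^{-1}(\mathcal C)/G$ (in particular when $G$ is compact), which thereby becomes a Poisson algebra. In the algebraic case, $\Omega$-valued functions on the orbit space of $\Omega$-points are meant, and continuity is with respect to any ring topology on $\Omega$ and the coarsest topology on the points for which the regular functions are continuous. (b) In the smooth and analytic cases, in particular in the complex analytic case, let $\pi\colon\Phi^{-1}(\mathcal C)\to Q$ be a quotient by $G$: a continuous surjection onto a topological space $Q$, constant on $G$-orbits, such that, when the sections of the structure sheaf of $Q$ over an open set $U$ are taken to be the continuous functions on $U$ whose pull back to $\pi^{-1}(U)$ is admissible (locally the restriction of an admissible function on an open subset of $M$), each $G$-invariant admissible function on $\pi^{-1}(U)$ is the pull back of a section over $U$. Then $\mathcal A[M]^G/I_{\mathcal C}$ is identified with an algebra of sections of the structure sheaf over $Q$ (analytic functions on the analytic quotient $Q$, in the complex case), which thereby becomes a Poisson algebra. The orbit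 space is such a quotient. (c) The quotient $\Phi^{-1}(\mathcal C)/\!/G$ by the equivalence relation generated by the requirement that points whose orbit closures in $\Phi^{-1}(\mathcal C)$ meet be equivalent, with the quotient topology, is a quotient in the sense of (b); hence it carries the Poisson algebra in (b). (d) In the algebraic case, suppose that $\mathbb K$ is algebraically closed and that $G$ is reductive. Then restriction identifies $\mathcal A[M]^G/I_{\mathcal C}$ with the algebra $\mathbb K[\Phi^{-1}(\mathcal C)]^G$ of the $G$-invariant regular functions on $\Phi^{-1}(\mathcal C)$ (restrictions of regular functions on $M$), this algebra is finitely generated, and the Poisson bracket turns the affine categorical quotient $\Phi^{-1}(\mathcal C)/\!/G$ with this coordinate ring into an affine Poisson variety. -/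

import Mathlib

open scoped Manifold ContDiff TensorProduct

noncomputable section

namespace QuasiPoisson

/-! ### Multilinear algebra over a commutative ring -/

section Multilinear

variable {R V : Type*} [CommRing R] [AddCommGroup V] [Module R V]

/-- `x ∧ y`, as the antisymmetric tensor `x ⊗ y - y ⊗ x`. -/
def wedge₂ (x y : V) : V ⊗[R] V := x ⊗ₜ[R] y - y ⊗ₜ[R] x

/-- `x ∧ y ∧ z`, as the totally antisymmetric tensor which is the signed sum over the six
permutations of the factors. -/
def wedge₃ (x y z : V) : V ⊗[R] (V ⊗[R] V) :=
  x ⊗ₜ[R] (y ⊗ₜ[R] z) + y ⊗ₜ[R] (z ⊗ₜ[R] x) + z ⊗ₜ[R] (x ⊗ₜ[R] y)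
    - x ⊗ₜ[R] (z ⊗ₜ[R] y) - y ⊗ₜ[R] (x ⊗ₜ[R] z) - z ⊗ₜ[R] (y ⊗ₜ[R] x)

/-- The Gerstenhaber (Schouten) bracket of two decomposable bivectors,
`[x₁ ∧ x₂, y₁ ∧ y₂] = [x₁,y₁] ∧ x₂ ∧ y₂ - [x₁,y₂] ∧ x₂ ∧ y₁ - [x₂,y₁] ∧ x₁ ∧ y₂ + [x₂,y₂] ∧ x₁ ∧ y₁`,
where `bᵢⱼ` stands for the Lie bracket `[xᵢ, yⱼ]`. -/
def schoutenTerm (x₁ x₂ y₁ y₂ b₁₁ b₁₂ b₂₁ b₂₂ : V) : V ⊗[R] (V ⊗[R] V) :=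
  wedge₃ b₁₁ x₂ y₂ - wedge₃ b₁₂ x₂ y₁ - wedge₃ b₂₁ x₁ y₂ + wedge₃ b₂₂ x₁ y₁

end Multilinear

/-- The Cartan element `φ_H = ½ (Id ⊗ [·,·] ⊗ Id)(H ⊗ H) ∈ L ⊗ L ⊗ L` of a `2`-tensor
`H ∈ L ⊗ L`, with respect to the bracket `br` on `L`. -/
def cartanElement {K L : Type*} [Field K] [AddCommGroup L] [Module K L]
    (br : L →ₗ[K] L →ₗ[K] L) (H : L ⊗[K] L) : L ⊗[K] (L ⊗[K] L) :=
  (2⁻¹ : K) •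
    (LinearMap.lTensor L
      ((LinearMap.rTensor L (TensorProduct.lift br)) ∘ₗ
        (TensorProduct.assoc K L L L).symm.toLinearMap))
      (TensorProduct.assoc K L L (L ⊗[K] L) (H ⊗ₜ[K] H))

/-- A Poisson bracket on a commutative algebra: a bilinear, alternating bracket which is a
derivation in each variable and satisfies the Jacobi identity. -/
structure PoissonBracket (K R : Type*) [CommRing K] [CommRing R] [Algebra K R] where
  /-- the bracket -/
  br : R →ₗ[K] R →ₗ[K] R
  br_self : ∀ a, br a a = 0
  br_mul : ∀ a b c, br a (b * c) = br a b * c + b * br a c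
  jacobi : ∀ a b c, br (br a b) c + br (br b c) a + br (br c a) b = 0

/-! ### Smooth, real analytic and complex analytic manifolds -/

section Manifold

variable {𝕜 : Type*} [RCLike 𝕜]
  {EG : Type*} [NormedAddCommGroup EG] [NormedSpace 𝕜 EG]
  {EM : Type*} [NormedAddCommGroup EM] [NormedSpace 𝕜 EM]
  {G : Type*} [TopologicalSpace G] [ChartedSpace EG G] [Group G]
  {M : Type*} [TopologicalSpace M] [ChartedSpace EM M] [MulAction G M]

variable (𝕜 EM M) in
/-- A (not necessarily continuous) section of the tensor square of the tangent bundle. -/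
abbrev TensorField₂ : Type _ :=
  ∀ x : M, TangentSpace 𝓘(𝕜, EM) x ⊗[𝕜] TangentSpace 𝓘(𝕜, EM) x

variable (𝕜 EM M) in
/-- A (not necessarily continuous) section of the tensor cube of the tangent bundle. -/
abbrev TensorField₃ : Type _ :=
  ∀ x : M, TangentSpace 𝓘(𝕜, EM) x ⊗[𝕜]
    (TangentSpace 𝓘(𝕜, EM) x ⊗[𝕜] TangentSpace 𝓘(𝕜, EM) x)

/-- `V` is a `C^n` vector field on the open set `U`. -/
def IsVectorFieldOn [IsManifold 𝓘(𝕜, EM) 1 M] (n : WithTop ℕ∞) (V : ∀ x : M, TangentSpace 𝓘(𝕜, EM) x) (U : Set M) : Prop :=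
  ContMDiffOn 𝓘(𝕜, EM) 𝓘(𝕜, EM).tangent n
    (fun y => (⟨y, V y⟩ : TangentBundle 𝓘(𝕜, EM) M)) U

/-- `P` is a `C^n` bivector field (a `C^n` section of the exterior square of the tangent bundle):
near each point it is a finite sum of wedge products of `C^n` vector fields. -/
def IsBivectorField [IsManifold 𝓘(𝕜, EM) 1 M] (n : WithTop ℕ∞) (P : TensorField₂ 𝕜 EM M) : Prop :=
  ∀ x : M, ∃ U : Set M, IsOpen U ∧ x ∈ U ∧
    ∃ (m : ℕ) (X Y : Fin m → ∀ y : M, TangentSpace 𝓘(𝕜, EM) y),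
      (∀ i, IsVectorFieldOn n (X i) U) ∧ (∀ i, IsVectorFieldOn n (Y i) U) ∧
      ∀ y ∈ U, P y = ∑ i, wedge₂ (X i y) (Y i y)

/-- `T` is the Schouten square `[P, P]` of the `C^n` bivector field `P`: near each point,
`P = ∑ᵢ Xᵢ ∧ Yᵢ` with `C^n` vector fields `Xᵢ`, `Yᵢ` such that
`T = ∑ᵢⱼ [Xᵢ ∧ Yᵢ, Xⱼ ∧ Yⱼ]`. -/
def IsSchoutenSquare [IsManifold 𝓘(𝕜, EM) 1 M] (n : WithTop ℕ∞)
    (P : TensorField₂ 𝕜 EM M) (T : TensorField₃ 𝕜 EM M) :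
    Prop :=
  ∀ x : M, ∃ U : Set M, IsOpen U ∧ x ∈ U ∧
    ∃ (m : ℕ) (X Y : Fin m → ∀ y : M, TangentSpace 𝓘(𝕜, EM) y),
      (∀ i, IsVectorFieldOn n (X i) U) ∧ (∀ i, IsVectorFieldOn n (Y i) U) ∧
      ∀ y ∈ U, P y = ∑ i, wedge₂ (X i y) (Y i y) ∧
        T y = ∑ i, ∑ j, schoutenTerm (X i y) (Y i y) (X j y) (Y j y)
          (VectorField.mlieBracket 𝓘(𝕜, EM) (X i) (X j) y)
          (VectorField.mlieBracket 𝓘(𝕜, EM) (X i) (Y j) y)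
          (VectorField.mlieBracket 𝓘(𝕜, EM) (Y i) (X j) y)
          (VectorField.mlieBracket 𝓘(𝕜, EM) (Y i) (Y j) y)

/-- `⟨P, df ∧ dh⟩ = P(df, dh)` at the point `x`. -/
def pairing (P : TensorField₂ 𝕜 EM M) (f h : M → 𝕜) (x : M) : 𝕜 :=
  TensorProduct.lid 𝕜 𝕜 (TensorProduct.map
    (mvfderiv 𝓘(𝕜, EM) f x : TangentSpace 𝓘(𝕜, EM) x →ₗ[𝕜] 𝕜)
    (mvfderiv 𝓘(𝕜, EM) h x : TangentSpace 𝓘(𝕜, EM) x →ₗ[𝕜] 𝕜) (P x))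

variable (𝕜) in
/-- The smoothness classes under discussion suffice for the Lie bracket. -/
theorem minSmoothness_le {n : WithTop ℕ∞} (hn : n = ∞ ∨ n = ω) : minSmoothness 𝕜 3 ≤ n := by
  rw [minSmoothness_of_isRCLikeNormedField]
  rcases hn with rfl | rfl
  · exact ENat.LEInfty.out
  · exact le_top

/-- The smoothness classes under discussion are at least of class `C¹`. -/
theorem one_le_smoothness {n : WithTop ℕ∞} (hn : n = ∞ ∨ n = ω) : 1 ≤ n := by
  rcases hn with rfl | rfl
  · exact ENat.LEInfty.out
  · exact le_top

variable (𝕜 EG G) in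
/-- The Lie bracket of the Lie algebra of `G`, as a bilinear map. -/
def groupBracket [CompleteSpace EG] [LieGroup 𝓘(𝕜, EG) (minSmoothness 𝕜 3) G] :
    GroupLieAlgebra 𝓘(𝕜, EG) G →ₗ[𝕜] GroupLieAlgebra 𝓘(𝕜, EG) G →ₗ[𝕜]
      GroupLieAlgebra 𝓘(𝕜, EG) G :=
  LinearMap.mk₂ 𝕜 (fun X Y => ⁅X, Y⁆)
    (fun X Y Z => add_lie X Y Z) (fun c X Y => smul_lie c X Y)
    (fun X Y Z => lie_add X Y Z) (fun c X Y => lie_smul c X Y)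

variable (𝕜 EG) in
/-- The adjoint action of `g` on the Lie algebra: the derivative of `x ↦ g x g⁻¹` at `1`. -/
def Ad (g : G) : GroupLieAlgebra 𝓘(𝕜, EG) G →ₗ[𝕜] GroupLieAlgebra 𝓘(𝕜, EG) G :=
  show TangentSpace 𝓘(𝕜, EG) (1 : G) →ₗ[𝕜] TangentSpace 𝓘(𝕜, EG) (g * 1 * g⁻¹) from
    (mfderiv 𝓘(𝕜, EG) 𝓘(𝕜, EG) (fun x : G => g * x * g⁻¹) 1).toLinearMap

variable (𝕜 EG) in
/-- `X ↦ X^L_q = q X`, the derivative of `x ↦ q x` at `1`. -/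
def leftTr (q : G) : GroupLieAlgebra 𝓘(𝕜, EG) G →ₗ[𝕜] TangentSpace 𝓘(𝕜, EG) q :=
  show TangentSpace 𝓘(𝕜, EG) (1 : G) →ₗ[𝕜] TangentSpace 𝓘(𝕜, EG) (q * 1) from
    (mfderiv 𝓘(𝕜, EG) 𝓘(𝕜, EG) (fun x : G => q * x) 1).toLinearMap

variable (𝕜 EG) in
/-- `X ↦ X^R_q = X q`, the derivative of `x ↦ x q` at `1`. -/
def rightTr (q : G) : GroupLieAlgebra 𝓘(𝕜, EG) G →ₗ[𝕜] TangentSpace 𝓘(𝕜, EG) q :=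
  show TangentSpace 𝓘(𝕜, EG) (1 : G) →ₗ[𝕜] TangentSpace 𝓘(𝕜, EG) (1 * q) from
    (mfderiv 𝓘(𝕜, EG) 𝓘(𝕜, EG) (fun x : G => x * q) 1).toLinearMap

variable (𝕜 EG EM G) in
/-- The fundamental vector fields `X_M(q) = d/dt exp(-tX) q` at `t = 0`: minus the derivative of
`g ↦ g q` at `1`. -/
def fund (q : M) : GroupLieAlgebra 𝓘(𝕜, EG) G →ₗ[𝕜] TangentSpace 𝓘(𝕜, EM) q :=
  show TangentSpace 𝓘(𝕜, EG) (1 : G) →ₗ[𝕜] TangentSpace 𝓘(𝕜, EM) ((1 : G) • q) from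
    -(mfderiv 𝓘(𝕜, EG) 𝓘(𝕜, EM) (fun g : G => g • q) 1).toLinearMap

variable (𝕜 EG EM M) in
/-- The image of `φ ∈ 𝔤 ⊗ 𝔤 ⊗ 𝔤` under the infinitesimal action of `𝔤` on `M`. -/
def fundTrivector (φ : GroupLieAlgebra 𝓘(𝕜, EG) G ⊗[𝕜]
      (GroupLieAlgebra 𝓘(𝕜, EG) G ⊗[𝕜] GroupLieAlgebra 𝓘(𝕜, EG) G)) :
    TensorField₃ 𝕜 EM M := fun q =>
  TensorProduct.map (fund 𝕜 EG EM G q)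
    (TensorProduct.map (fund 𝕜 EG EM G q) (fund 𝕜 EG EM G q)) φ

/-- `(P, Φ)` is a Hamiltonian `G`-quasi Poisson structure of class `C^n` on the `G`-manifold `M`
relative to the `Ad`-invariant symmetric `2`-tensor `H` over the Lie algebra of `G`, where the
quasi Jacobi identity is normalized as `[P, P] = c φ_{H,M}`. -/
structure IsHamiltonian (n : WithTop ℕ∞) (hn : n = ∞ ∨ n = ω)
    [FiniteDimensional 𝕜 EG] [LieGroup 𝓘(𝕜, EG) n G] [IsManifold 𝓘(𝕜, EM) n M] (c : 𝕜)
    (H : GroupLieAlgebra 𝓘(𝕜, EG) G ⊗[𝕜] GroupLieAlgebra 𝓘(𝕜, EG) G)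
    (P : TensorField₂ 𝕜 EM M) (Φ : M → G) : Prop where
  /-- `H` is symmetric -/
  symm : TensorProduct.comm 𝕜 _ _ H = H
  /-- `H` is `Ad`-invariant -/
  ad_invariant : ∀ g : G, TensorProduct.map (Ad 𝕜 EG g) (Ad 𝕜 EG g) H = H
  /-- `P` is a bivector field -/
  bivector :
    haveI : IsManifold 𝓘(𝕜, EM) 1 M := .of_le (one_le_smoothness hn)
    IsBivectorField n P
  /-- `P` is `G`-invariant -/
  invariant : ∀ (g : G) (x : M),
    TensorProduct.map
      (mfderiv 𝓘(𝕜, EM) 𝓘(𝕜, EM) (fun y : M => g • y) x).toLinearMap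
      (mfderiv 𝓘(𝕜, EM) 𝓘(𝕜, EM) (fun y : M => g • y) x).toLinearMap (P x) = P (g • x)
  /-- the quasi Jacobi identity -/
  schouten :
    haveI : IsManifold 𝓘(𝕜, EM) 1 M := .of_le (one_le_smoothness hn)
    haveI : LieGroup 𝓘(𝕜, EG) (minSmoothness 𝕜 3) G := .of_le (minSmoothness_le 𝕜 hn)
    haveI : CompleteSpace EG := FiniteDimensional.complete 𝕜 EG
    IsSchoutenSquare n P
      (fun x => c • fundTrivector 𝕜 EG EM M (cartanElement (groupBracket 𝕜 EG G) H) x)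
  /-- `Φ` is admissible -/
  contMDiff : ContMDiff 𝓘(𝕜, EM) 𝓘(𝕜, EG) n Φ
  /-- `Φ` is `G`-equivariant with respect to conjugation -/
  equivariant : ∀ (g : G) (x : M), Φ (g • x) = g * Φ x * g⁻¹
  /-- the momentum property `(dΦ ⊗ Id) P = ((L + R)/2 ⊗ fund) H` -/
  momentum : ∀ x : M,
    TensorProduct.map (mfderiv 𝓘(𝕜, EM) 𝓘(𝕜, EG) Φ x).toLinearMap LinearMap.id (P x) =
      TensorProduct.map ((2⁻¹ : 𝕜) • (leftTr 𝕜 EG (Φ x) + rightTr 𝕜 EG (Φ x)))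
        (fund 𝕜 EG EM G x) H

variable (𝕜 EM G M) in
/-- The algebra of `G`-invariant admissible functions. -/
def invariants (n : WithTop ℕ∞) : Subalgebra 𝕜 C^n⟮𝓘(𝕜, EM), M; 𝕜⟯ where
  carrier := {f | ∀ (g : G) (x : M), f (g • x) = f x}
  mul_mem' := by
    intro a b ha hb g x
    simp [ha g x, hb g x]
  add_mem' := by
    intro a b ha hb g x
    simp [ha g x, hb g x]
  algebraMap_mem' := by
    intro r g x
    rfl

variable (𝕜 EM) in
/-- The ideal of the invariant admissible functions that vanish on `Φ⁻¹(C)`. -/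
def vanishingIdeal (n : WithTop ℕ∞) (Φ : M → G) (C : ConjClasses G) :
    Ideal (invariants 𝕜 EM G M n) where
  carrier := {F | ∀ x : M, Φ x ∈ C.carrier → (F : C^n⟮𝓘(𝕜, EM), M; 𝕜⟯) x = 0}
  add_mem' := by
    intro a b ha hb x hx
    simp [ha x hx, hb x hx]
  zero_mem' := by
    intro x _
    rfl
  smul_mem' := by
    intro a b hb x hx
    simp [hb x hx]

/-- The level set `Φ⁻¹(C)`, with the subspace topology. -/
abbrev level (Φ : M → G) (C : ConjClasses G) : Type _ := {x : M // Φ x ∈ C.carrier}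

/-- Two points of `Φ⁻¹(C)` lie in the same `G`-orbit. -/
def SameOrbit (Φ : M → G) (C : ConjClasses G) (p q : level Φ C) : Prop :=
  ∃ g : G, g • p.1 = q.1

/-- The closures in `Φ⁻¹(C)` of the `G`-orbits of two points have a point in common. -/
def OrbitClosuresMeet (Φ : M → G) (C : ConjClasses G) (p q : level Φ C) : Prop :=
  (closure {r | SameOrbit Φ C p r} ∩ closure {r | SameOrbit Φ C q r}).Nonempty

/-- The orbit space `Φ⁻¹(C)/G`, with the quotient topology. -/
abbrev OrbitSpace (Φ : M → G) (C : ConjClasses G) : Type _ := Quot (SameOrbit Φ C)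

/-- The quotient `Φ⁻¹(C)//G` of `Φ⁻¹(C)` by the equivalence relation generated by the requirement
that points whose orbit closures meet be equivalent, with the quotient topology. -/
abbrev ClosureQuotient (Φ : M → G) (C : ConjClasses G) : Type _ := Quot (OrbitClosuresMeet Φ C)

variable (𝕜 EM) in
/-- The function `φ` on `Φ⁻¹(C)` is admissible on the subset `W` of `Φ⁻¹(C)`:
near each point of `W` it is the restriction of a `C^n` function on an open subset of `M`. -/
def IsAdmissibleOn (n : WithTop ℕ∞) {Φ : M → G} {C : ConjClasses G}
    (φ : level Φ C → 𝕜) (W : Set (level Φ C)) : Prop :=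
  ∀ p ∈ W, ∃ (V : Set M) (F : M → 𝕜), IsOpen V ∧ p.1 ∈ V ∧
    ContMDiffOn 𝓘(𝕜, EM) 𝓘(𝕜) n F V ∧ ∀ q : level Φ C, q.1 ∈ V → φ q = F q.1

variable (𝕜 EM) in
/-- `π : Φ⁻¹(C) → Q` is a quotient of `Φ⁻¹(C)` by `G` in the category under discussion
(for `𝕜 = ℂ`, an analytic quotient): `π` is continuous, surjective and constant on orbits, and with
respect to the structure sheaf on `Q` whose sections over an open set `U` are the continuous
functions on `U` with admissible pull back, each `G`-invariant admissible function on `π⁻¹(U)` is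
the pull back of a section over `U`. -/
structure IsQuotient (n : WithTop ℕ∞) {Φ : M → G} {C : ConjClasses G}
    {Q : Type*} [TopologicalSpace Q] (π : level Φ C → Q) : Prop where
  continuous : Continuous π
  surjective : Function.Surjective π
  invariant : ∀ p q, SameOrbit Φ C p q → π p = π q
  descent : ∀ U : Set Q, IsOpen U → ∀ φ : level Φ C → 𝕜,
    IsAdmissibleOn 𝕜 EM n φ (π ⁻¹' U) →
    (∀ p q, π p ∈ U → SameOrbit Φ C p q → φ p = φ q) →
    ∃ h : Q → 𝕜, ContinuousOn h U ∧ ∀ p, π p ∈ U → h (π p) = φ p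

end Manifold

/-! ### Affine algebraic manifolds -/

section Algebraic

/-- A (left) action of the affine algebraic group with coordinate Hopf algebra `B` on the affine
variety with coordinate ring `A`, given by its comorphism `f ↦ ((g, x) ↦ f (g x))`. -/
structure AlgAction (K B A : Type*) [Field K] [CommRing B] [HopfAlgebra K B]
    [CommRing A] [Algebra K A] where
  /-- the comorphism of the action map -/
  coact : A →ₐ[K] B ⊗[K] A
  counit_coact : ∀ f : A,
    TensorProduct.lid K A (LinearMap.rTensor A (Coalgebra.counit (R := K) (A := B)) (coact f)) = f
  coassoc : ∀ f : A,
    TensorProduct.assoc K B B A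
        (LinearMap.rTensor A (Coalgebra.comul (R := K) (A := B)) (coact f)) =
      LinearMap.lTensor B coact.toLinearMap (coact f)

variable {K : Type*} [Field K]
  {B : Type*} [CommRing B] [HopfAlgebra K B]
  {A : Type*} [CommRing A] [Algebra K A]

variable (K B) in
/-- The Lie algebra `𝔤` of left invariant derivations of the coordinate ring of the group. -/
def lieAlg : LieSubalgebra K (Derivation K B B) where
  carrier := {X | ∀ b : B, Coalgebra.comul (R := K) (X b) =
    LinearMap.lTensor B (X : B →ₗ[K] B) (Coalgebra.comul (R := K) b)}
  add_mem' := by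
    intro X Y hX hY b
    have h : ((X + Y : Derivation K B B) : B →ₗ[K] B) = (X : B →ₗ[K] B) + (Y : B →ₗ[K] B) := rfl
    rw [h, LinearMap.lTensor_add, LinearMap.add_apply, ← hX b, ← hY b, ← map_add]
    rfl
  zero_mem' := by
    intro b
    have h : ((0 : Derivation K B B) : B →ₗ[K] B) = 0 := rfl
    rw [h, LinearMap.lTensor_zero]
    simp
  smul_mem' := by
    intro c X hX b
    have h : ((c • X : Derivation K B B) : B →ₗ[K] B) = c • (X : B →ₗ[K] B) := rfl
    rw [h, LinearMap.lTensor_smul, LinearMap.smul_apply, ← hX b, ← map_smul]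
    rfl
  lie_mem' := by
    intro X Y hX hY b
    have h : ((⁅X, Y⁆ : Derivation K B B) : B →ₗ[K] B) =
        (X : B →ₗ[K] B) ∘ₗ (Y : B →ₗ[K] B) - (Y : B →ₗ[K] B) ∘ₗ (X : B →ₗ[K] B) := rfl
    have hb : (⁅X, Y⁆ : Derivation K B B) b = X (Y b) - Y (X b) := rfl
    rw [h, hb, LinearMap.lTensor_sub, LinearMap.lTensor_comp, LinearMap.lTensor_comp, map_sub,
      hX (Y b), hY (X b), hX b, hY b]
    rfl

/-- `b ↦ X_e(b)`, the tangent vector at the neutral element that `X` determines. -/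
def atOne (X : Derivation K B B) : B →ₗ[K] K :=
  Coalgebra.counit (R := K) (A := B) ∘ₗ (X : B →ₗ[K] B)

/-- Given an action with comorphism `a : A → B ⊗ A` and a derivation `X` of `B`, the derivation
`(X_e ⊗ Id) ∘ a` of `A`, that is, the vector field `q ↦ d/dt exp(tX) q` at `t = 0`. -/
def contractLeft (a : A →ₐ[K] B ⊗[K] A)
    (ha : ∀ f : A,
      TensorProduct.lid K A (LinearMap.rTensor A (Coalgebra.counit (R := K) (A := B)) (a f)) = f)
    (X : Derivation K B B) : Derivation K A A :=
  Derivation.mk'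
    ((TensorProduct.lid K A).toLinearMap ∘ₗ LinearMap.rTensor A (atOne X) ∘ₗ a.toLinearMap) (by
      have key : ∀ u v : B ⊗[K] A,
          TensorProduct.lid K A (LinearMap.rTensor A (atOne X) (u * v)) =
            TensorProduct.lid K A (LinearMap.rTensor A
              (Coalgebra.counit (R := K) (A := B)) u) *
              TensorProduct.lid K A (LinearMap.rTensor A (atOne X) v) +
            TensorProduct.lid K A (LinearMap.rTensor A
              (Coalgebra.counit (R := K) (A := B)) v) *
              TensorProduct.lid K A (LinearMap.rTensor A (atOne X) u) := by
        intro u v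
        induction u using TensorProduct.induction_on with
        | zero => simp
        | add u₁ u₂ h₁ h₂ =>
          simp only [add_mul, mul_add, map_add, h₁, h₂]
          ring
        | tmul b f =>
          induction v using TensorProduct.induction_on with
          | zero => simp
          | add v₁ v₂ h₁ h₂ =>
            simp only [add_mul, mul_add, map_add, h₁, h₂]
            ring
          | tmul b' f' =>
            simp [atOne, Algebra.smul_def, Derivation.leibniz]
            ring
      intro f h
      simp only [LinearMap.coe_comp, LinearEquiv.coe_coe, Function.comp_apply,
        AlgHom.toLinearMap_apply, map_mul, key, ha, smul_eq_mul])

variable (K B) in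
/-- `X ↦ X^R`, the right invariant vector field on the group that agrees with `X` at the neutral
element: `X^R_q = d/dt exp(tX) q` at `t = 0`. -/
def rightInv : Derivation K B B →ₗ[K] Derivation K B B where
  toFun X := contractLeft (Bialgebra.comulAlgHom K B) (fun f => by simp) X
  map_add' := by
    intro X Y
    ext f
    have h : atOne (X + Y) = atOne X + atOne Y := LinearMap.comp_add _ _ _
    simp [contractLeft, h, LinearMap.rTensor_add]
  map_smul' := by
    intro c X
    ext f
    have h : atOne (c • X) = c • atOne X := LinearMap.comp_smul _ _ _
    simp [contractLeft, h, LinearMap.rTensor_smul]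

/-- The fundamental vector field `X_M(q) = d/dt exp(-tX) q` at `t = 0`, as a linear map on `𝔤`. -/
def AlgAction.fund (α : AlgAction K B A) : lieAlg K B →ₗ[K] Derivation K A A where
  toFun X := -contractLeft α.coact α.counit_coact X
  map_add' := by
    intro X Y
    ext f
    have h : atOne (X.1 + Y.1) = atOne X.1 + atOne Y.1 := LinearMap.comp_add _ _ _
    simp [contractLeft, h, LinearMap.rTensor_add, add_comm]
    rfl
  map_smul' := by
    intro c X
    ext f
    have h : atOne (c • X.1) = c • atOne X.1 := LinearMap.comp_smul _ _ _
    simp [contractLeft, h, LinearMap.rTensor_smul]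
    rfl

variable (K B) in
/-- The Lie bracket of `𝔤`, as a bilinear map. -/
def lieAlgBracket : lieAlg K B →ₗ[K] lieAlg K B →ₗ[K] lieAlg K B :=
  LinearMap.mk₂ K (fun X Y => ⁅X, Y⁆)
    (fun X Y Z => add_lie X Y Z) (fun c X Y => smul_lie c X Y)
    (fun X Y Z => lie_add X Y Z) (fun c X Y => lie_smul c X Y)

variable (K B) in
/-- The comorphism `b ↦ ((g, x) ↦ b (g x g⁻¹))` of the conjugation action of the group on itself,
computed in the group of points of the group with values in `B ⊗ B`. -/
def conjCoact : B →ₐ[K] B ⊗[K] B :=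
  (WithConv.toConv (Algebra.TensorProduct.includeLeft : B →ₐ[K] B ⊗[K] B) *
    WithConv.toConv (Algebra.TensorProduct.includeRight : B →ₐ[K] B ⊗[K] B) *
    (WithConv.toConv (Algebra.TensorProduct.includeLeft : B →ₐ[K] B ⊗[K] B))⁻¹).ofConv

/-- The function `g ↦ (Ad_g X)_e(b)` on the group. -/
def adFun (X : Derivation K B B) (b : B) : B :=
  TensorProduct.rid K B (LinearMap.lTensor B (atOne X) (conjCoact K B b))

/-- `H ∈ 𝔤 ⊗ 𝔤` is `Ad`-invariant: with `H = ∑ Xᵢ ⊗ Yᵢ`, for all functions `b`, `b'` on the group,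
the function `g ↦ ∑ (Ad_g Xᵢ)_e(b) (Ad_g Yᵢ)_e(b')` is constant, with value
`∑ (Xᵢ)_e(b) (Yᵢ)_e(b')`. -/
def AdInvariant (H : lieAlg K B ⊗[K] lieAlg K B) : Prop :=
  ∃ (m : ℕ) (X Y : Fin m → lieAlg K B), H = ∑ i, X i ⊗ₜ[K] Y i ∧
    ∀ b b' : B, ∑ i, adFun (X i).1 b * adFun (Y i).1 b' =
      algebraMap K B (∑ i, atOne (X i).1 b * atOne (Y i).1 b')

/-- The bidifferential operator `(f, h) ↦ P(df, dh) = ⟨P, df ∧ dh⟩` of a `2`-tensor `P`. -/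
def algPairing (P : Derivation K A A ⊗[A] Derivation K A A) : A →ₗ[K] A →ₗ[K] A :=
  TensorProduct.lift
    (LinearMap.mk₂ A
      (fun X Y : Derivation K A A =>
        (LinearMap.mul K A).compl₁₂ (X : A →ₗ[K] A) (Y : A →ₗ[K] A))
      (by intro X X' Y; ext f h; simp)
      (by intro c X Y; ext f h; simp [mul_assoc])
      (by intro X Y Y'; ext f h; simp [mul_add])
      (by intro c X Y; ext f h; simp [mul_left_comm])) P

/-- `T` is the Schouten square `[P, P]` of the bivector `P`: one has `P = ∑ᵢ Xᵢ ∧ Yᵢ` with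
vector fields `Xᵢ`, `Yᵢ` such that `T = ∑ᵢⱼ [Xᵢ ∧ Yᵢ, Xⱼ ∧ Yⱼ]`. -/
def IsAlgSchoutenSquare (P : Derivation K A A ⊗[A] Derivation K A A)
    (T : Derivation K A A ⊗[A] (Derivation K A A ⊗[A] Derivation K A A)) : Prop :=
  ∃ (m : ℕ) (X Y : Fin m → Derivation K A A), P = ∑ i, wedge₂ (X i) (Y i) ∧
    T = ∑ i, ∑ j, schoutenTerm (X i) (Y i) (X j) (Y j)
      ⁅X i, X j⁆ ⁅X i, Y j⁆ ⁅Y i, X j⁆ ⁅Y i, Y j⁆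

/-- The image of `φ ∈ 𝔤 ⊗ 𝔤 ⊗ 𝔤` under the infinitesimal action of `𝔤`. -/
def AlgAction.fundTrivector (α : AlgAction K B A)
    (φ : lieAlg K B ⊗[K] (lieAlg K B ⊗[K] lieAlg K B)) :
    Derivation K A A ⊗[A] (Derivation K A A ⊗[A] Derivation K A A) :=
  TensorProduct.mapOfCompatibleSMul A K K (Derivation K A A)
      (Derivation K A A ⊗[A] Derivation K A A)
    (TensorProduct.map α.fund
      (TensorProduct.mapOfCompatibleSMul A K K (Derivation K A A) (Derivation K A A) ∘ₗ
        TensorProduct.map α.fund α.fund) φ)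

variable (K B A) in
/-- Left translation `L_Φ`, from `𝔤` to the sections of the pull back along `Φ` of the tangent
bundle of the group, that is, to the `K`-derivations `B → A` along `Φ`. Here and below the
comorphism of `Φ` is the structure map of the `B`-algebra `A`. -/
def leftTrAlg [Algebra B A] [IsScalarTower K B A] : Derivation K B B →ₗ[K] Derivation K B A :=
  ((Algebra.linearMap B A).compDer : Derivation K B B →ₗ[B] Derivation K B A).restrictScalars K

/-- `Φ` maps the coordinate functions of the group to functions on the variety equivariantly with
respect to conjugation: `b (Φ (g x)) = b (g Φ(x) g⁻¹)`. -/
def AlgEquivariant [Algebra B A] [IsScalarTower K B A] (α : AlgAction K B A) : Prop :=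
  ∀ b : B, α.coact (algebraMap B A b) =
    LinearMap.lTensor B (IsScalarTower.toAlgHom K B A).toLinearMap (conjCoact K B b)

/-- `(P, Φ)` is a Hamiltonian `G`-quasi Poisson structure on the affine algebraic `G`-manifold `M`
with coordinate ring `A`, for the algebraic group `G` with coordinate ring `B`, relative to the
`Ad`-invariant symmetric `2`-tensor `H` over the Lie algebra of `G`, where the quasi Jacobi identity
is normalized as `[P, P] = c φ_{H,M}`. The comorphism of `Φ : M → G` is the structure map of the
`B`-algebra `A`. -/
structure IsAlgHamiltonian [Algebra B A] [IsScalarTower K B A] (α : AlgAction K B A) (c : K)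
    (H : lieAlg K B ⊗[K] lieAlg K B) (P : Derivation K A A ⊗[A] Derivation K A A) : Prop where
  /-- `H` is symmetric -/
  symm : TensorProduct.comm K _ _ H = H
  /-- `H` is `Ad`-invariant -/
  ad_invariant : AdInvariant H
  /-- `P` is antisymmetric -/
  antisymm : TensorProduct.comm A _ _ P = -P
  /-- `P` is `G`-invariant: `P(df, dh)(g x) = P(d(f ∘ g), d(h ∘ g))(x)` -/
  invariant : ∀ f h : A, α.coact (algPairing P f h) =
    TensorProduct.map₂ (LinearMap.mul K B) (algPairing P) (α.coact f) (α.coact h)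
  /-- the quasi Jacobi identity -/
  schouten : IsAlgSchoutenSquare P (c • α.fundTrivector (cartanElement (lieAlgBracket K B) H))
  /-- `Φ` is `G`-equivariant with respect to conjugation -/
  equivariant : AlgEquivariant α
  /-- the momentum property `(dΦ ⊗ Id) P = ((L + R)/2 ⊗ fund) H` -/
  momentum : LinearMap.rTensor (Derivation K A A) (Derivation.compAlgebraMapL K B A A) P =
    TensorProduct.mapOfCompatibleSMul A K K (Derivation K B A) (Derivation K A A)
      (TensorProduct.map
        ((2⁻¹ : K) • (leftTrAlg K B A ∘ₗ (lieAlg K B).toSubmodule.subtype +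
          leftTrAlg K B A ∘ₗ rightInv K B ∘ₗ (lieAlg K B).toSubmodule.subtype))
        α.fund H)

/-- The algebra `A^G` of `G`-invariant functions. -/
def AlgAction.invariants (α : AlgAction K B A) : Subalgebra K A :=
  AlgHom.equalizer α.coact Algebra.TensorProduct.includeRight

variable (K B A) in
/-- `Φ` on points with values in `Ω`; the points of the group form the convolution group of algebra
homomorphisms `B → Ω`. -/
def phiPoint [Algebra B A] [IsScalarTower K B A] {Ω : Type*} [Field Ω] [Algebra K Ω]
    (p : A →ₐ[K] Ω) : WithConv (B →ₐ[K] Ω) :=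
  WithConv.toConv (p.comp (IsScalarTower.toAlgHom K B A))

/-- The action `(g, p) ↦ g p` on points with values in `Ω`. -/
def AlgAction.act (α : AlgAction K B A) {Ω : Type*} [Field Ω] [Algebra K Ω]
    (g : WithConv (B →ₐ[K] Ω)) (p : A →ₐ[K] Ω) : A →ₐ[K] Ω :=
  (Algebra.TensorProduct.productMap g.ofConv p).comp α.coact

variable (A) in
/-- The set `Φ⁻¹(C)` of points with values in `Ω`, for a conjugacy class `C` of the group of points
of `G` with values in `Ω`. -/
def AlgLevel [Algebra B A] [IsScalarTower K B A] {Ω : Type*} [Field Ω] [Algebra K Ω]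
    (C : ConjClasses (WithConv (B →ₐ[K] Ω))) : Type _ :=
  {p : A →ₐ[K] Ω // phiPoint K B A p ∈ C.carrier}

/-- When `Ω` carries a topology, `Φ⁻¹(C)` carries the coarsest topology for which the regular
functions are continuous. -/
instance [Algebra B A] [IsScalarTower K B A] {Ω : Type*} [Field Ω] [Algebra K Ω]
    [TopologicalSpace Ω] (C : ConjClasses (WithConv (B →ₐ[K] Ω))) :
    TopologicalSpace (AlgLevel A C) :=
  TopologicalSpace.induced (fun p (f : A) => p.1 f) inferInstance

/-- Two points of `Φ⁻¹(C)` lie in the same `G`-orbit. -/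
def AlgAction.SameOrbit [Algebra B A] [IsScalarTower K B A] (α : AlgAction K B A)
    {Ω : Type*} [Field Ω] [Algebra K Ω] (C : ConjClasses (WithConv (B →ₐ[K] Ω)))
    (p q : AlgLevel A C) : Prop :=
  ∃ g : WithConv (B →ₐ[K] Ω), α.act g p.1 = q.1

/-- The orbit space `Φ⁻¹(C)/G` of points with values in `Ω`. -/
abbrev AlgAction.OrbitSpace [Algebra B A] [IsScalarTower K B A] (α : AlgAction K B A)
    {Ω : Type*} [Field Ω] [Algebra K Ω] (C : ConjClasses (WithConv (B →ₐ[K] Ω))) : Type _ :=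
  Quot (α.SameOrbit C)

/-- The ideal of the `G`-invariant functions that vanish on `Φ⁻¹(C)`. -/
def AlgAction.vanishingIdeal [Algebra B A] [IsScalarTower K B A] (α : AlgAction K B A)
    {Ω : Type*} [Field Ω] [Algebra K Ω] (C : ConjClasses (WithConv (B →ₐ[K] Ω))) :
    Ideal α.invariants where
  carrier := {F | ∀ p : AlgLevel A C, p.1 (F : A) = 0}
  add_mem' := by
    intro a b ha hb p
    simp [ha p, hb p]
  zero_mem' := by
    intro p
    simp
  smul_mem' := by
    intro a b hb p
    simp [hb p]

/-- For an algebraically closed field `K`, the coordinate ring of the affine categorical quotient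
`Φ⁻¹(C)//G`: the algebra of the `G`-invariant regular functions on `Φ⁻¹(C)`. Here the regular
functions on `Φ⁻¹(C)` are the restrictions of the regular functions on the ambient variety, that is,
they constitute the coordinate ring of `Φ⁻¹(C)` (of its Zariski closure if it is not closed). -/
def AlgAction.quotientRing [Algebra B A] [IsScalarTower K B A] (α : AlgAction K B A)
    (C : ConjClasses (WithConv (B →ₐ[K] K))) : Subalgebra K (AlgLevel A C → K) where
  carrier := {φ | (∃ f : A, ∀ p : AlgLevel A C, φ p = p.1 f) ∧
    ∀ p q : AlgLevel A C, α.SameOrbit C p q → φ p = φ q}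
  mul_mem' := by
    rintro a b ⟨⟨f, hf⟩, ha⟩ ⟨⟨h, hh⟩, hb⟩
    exact ⟨⟨f * h, fun p => by simp [hf p, hh p]⟩, fun p q hpq => by
      simp [ha p q hpq, hb p q hpq]⟩
  add_mem' := by
    rintro a b ⟨⟨f, hf⟩, ha⟩ ⟨⟨h, hh⟩, hb⟩
    exact ⟨⟨f + h, fun p => by simp [hf p, hh p]⟩, fun p q hpq => by
      simp [ha p q hpq, hb p q hpq]⟩
  algebraMap_mem' := by
    intro r
    exact ⟨⟨algebraMap K A r, fun p => by simp⟩, fun p q _ => rfl⟩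

variable (K B) in
/-- The algebraic group with coordinate ring `B` is (linearly) reductive: each finite dimensional
rational representation is completely reducible. For affine algebraic groups over an algebraically
closed field of characteristic zero this is what reductive means. A rational representation on `Kⁿ`
is a coaction `ρ` of `B`, and a subspace `W` is invariant when `ρ(W)` lies in `B ⊗ W`. -/
def IsLinearlyReductive : Prop :=
  ∀ (n : ℕ) (ρ : (Fin n → K) →ₗ[K] B ⊗[K] (Fin n → K)),
    (∀ v, TensorProduct.lid K (Fin n → K)
      (LinearMap.rTensor (Fin n → K) (Coalgebra.counit (R := K) (A := B)) (ρ v)) = v) →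
    (∀ v, TensorProduct.assoc K B B (Fin n → K)
        (LinearMap.rTensor (Fin n → K) (Coalgebra.comul (R := K) (A := B)) (ρ v)) =
      LinearMap.lTensor B ρ (ρ v)) →
    ∀ W : Submodule K (Fin n → K),
      (∀ w ∈ W, ρ w ∈ LinearMap.range (LinearMap.lTensor B W.subtype)) →
      ∃ W' : Submodule K (Fin n → K), IsCompl W W' ∧
        ∀ w ∈ W', ρ w ∈ LinearMap.range (LinearMap.lTensor B W'.subtype)

end Algebraic

end QuasiPoisson

end

open QuasiPoisson

/-!
# Quasi Poisson reduction

For a presentation `P = ∑ᵢ Xᵢ ∧ Yᵢ`, the contraction of the Schouten square `[P, P]` with `df`, `dg`,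
`dh` is `-2` times the Jacobiator of the bracket `{f, h} = P(df, dh)`, since the terms of second order
cancel (`contract₃_schoutenSquare`, an identity for derivations of a commutative algebra; on manifolds
it is applied to functions on a neighbourhood, where the Lie bracket of vector fields is the commutator
of derivations, `mvfderiv_mlieBracket`). Here `[P, P]` is the image of a trivector over the Lie algebra
under the infinitesimal action, and the differential of an invariant function annihilates the
fundamental vector fields. So the Jacobi identity holds for invariant functions.

For the Poisson ideal, contract the momentum property with the differential of an invariant function
`f`: the Hamiltonian vector field `V = P(df, ·)` satisfies `dΦ(V) = 0`, that is, it is tangent to the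
fibres of `Φ`. It remains to see that `V` differentiates functions vanishing on a fibre of `Φ` into
functions vanishing on this fibre, although the fibre may be singular.

* On manifolds, the integral curve of `V` through a point of the fibre stays in the fibre
  (`mvfderiv_apply_eq_zero_of_fibre`).
* For algebraic varieties, after base change along an `Ω`-valued point of the group the claim concerns
  the fibre, an affine scheme of finite type over `Ω`, and a vector field on it
  (`derivation_vanishes`).
  For algebraically closed `Ω`, a function vanishing at all points is nilpotent by the
  Nullstellensatz, and derivations preserve the nilradical in characteristic zero. For `Ω = ℝ` the
  points need not be dense in the scheme; there the integral curve of a lift of the vector field to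
  affine space stays in the scheme, because the generators of its ideal satisfy a linear
  differential equation along the curve.

The quotients of the level set of a conjugacy class are treated by general topology: an invariant
continuous function takes the same value on two orbits whose closures meet (`isQuotient_quotMk`,
`isQuotient_closureQuotient`).

For a linearly reductive group, complete reducibility of the finite dimensional pieces of the regular
representation yields an invariant integral (`exists_integral`), hence a Reynolds operator. Averaging
shows that invariant functions on the level set extend to invariant functions on the whole variety,
and the invariants are finitely generated by Hilbert's argument
(`AlgAction.finiteType_invariants`), whence the description of the categorical quotient
(`AlgAction.exists_quotientRing`).
-/

namespace QuasiPoisson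

/-! ### Poisson brackets on quotients and isomorphic algebras -/

section PoissonBracket

variable {K R S : Type*} [CommRing K] [CommRing R] [Algebra K R] [CommRing S] [Algebra K S]

theorem PoissonBracket.br_swap (β : PoissonBracket K R) (a b : R) : β.br a b = -β.br b a := by
  have h := β.br_self (a + b)
  simp only [map_add, LinearMap.add_apply, β.br_self, zero_add, add_zero] at h
  exact eq_neg_of_add_eq_zero_right h

theorem PoissonBracket.exists_quotient (β : PoissonBracket K R) (I : Ideal R)
    (hI : ∀ f, ∀ F ∈ I, β.br f F ∈ I) :
    ∃ βI : PoissonBracket K (R ⧸ I), ∀ f h : R,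
      βI.br (Ideal.Quotient.mk I f) (Ideal.Quotient.mk I h) = Ideal.Quotient.mk I (β.br f h) := by
  have hI' : ∀ F ∈ I, ∀ f, β.br F f ∈ I := fun F hF f => by
    rw [β.br_swap]; exact I.neg_mem (hI f F hF)
  have hwd : ∀ a a' b b' : R, Ideal.Quotient.mk I a = Ideal.Quotient.mk I a' →
      Ideal.Quotient.mk I b = Ideal.Quotient.mk I b' →
      Ideal.Quotient.mk I (β.br a b) = Ideal.Quotient.mk I (β.br a' b') := by
    intro a a' b b' ha hb
    rw [Ideal.Quotient.eq] at ha hb ⊢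
    have : β.br a b - β.br a' b' = β.br (a - a') b + β.br a' (b - b') := by
      simp [map_sub, LinearMap.sub_apply]
    rw [this]
    exact I.add_mem (hI' _ ha _) (hI _ _ hb)
  let s : R ⧸ I → R := Function.surjInv Ideal.Quotient.mk_surjective
  have hs : ∀ a, Ideal.Quotient.mk I (s a) = a := Function.surjInv_eq _
  let br : R ⧸ I →ₗ[K] R ⧸ I →ₗ[K] R ⧸ I := LinearMap.mk₂ K
    (fun a b => Ideal.Quotient.mk I (β.br (s a) (s b)))
    (fun a a' b => by
      rw [← map_add, ← LinearMap.add_apply, ← map_add]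
      exact hwd _ _ _ _ (by simp [hs]) rfl)
    (fun c a b => by
      have : c • Ideal.Quotient.mk I (β.br (s a) (s b)) =
        Ideal.Quotient.mk I (β.br (c • s a) (s b)) := by
          rw [map_smul, LinearMap.smul_apply]; rfl
      rw [this]
      refine hwd _ _ _ _ ?_ rfl
      rw [hs]
      conv_lhs => rw [← hs a]
      rfl)
    (fun a b b' => by
      rw [← map_add, ← map_add]
      exact hwd _ _ _ _ rfl (by simp [hs]))
    (fun c a b => by
      have : c • Ideal.Quotient.mk I (β.br (s a) (s b)) =
        Ideal.Quotient.mk I (β.br (s a) (c • s b)) := by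
          rw [map_smul]; rfl
      rw [this]
      refine hwd _ _ _ _ rfl ?_
      rw [hs]
      conv_lhs => rw [← hs b]
      rfl)
  have hbr : ∀ f h : R, br (Ideal.Quotient.mk I f) (Ideal.Quotient.mk I h) =
      Ideal.Quotient.mk I (β.br f h) := fun f h => hwd _ _ _ _ (hs _) (hs _)
  refine ⟨⟨br, ?_, ?_, ?_⟩, hbr⟩
  · intro a
    obtain ⟨a, rfl⟩ := Ideal.Quotient.mk_surjective a
    rw [hbr, β.br_self, map_zero]
  · intro a b c
    obtain ⟨a, rfl⟩ := Ideal.Quotient.mk_surjective a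
    obtain ⟨b, rfl⟩ := Ideal.Quotient.mk_surjective b
    obtain ⟨c, rfl⟩ := Ideal.Quotient.mk_surjective c
    rw [← map_mul, hbr, hbr, hbr, β.br_mul, map_add, map_mul, map_mul]
  · intro a b c
    obtain ⟨a, rfl⟩ := Ideal.Quotient.mk_surjective a
    obtain ⟨b, rfl⟩ := Ideal.Quotient.mk_surjective b
    obtain ⟨c, rfl⟩ := Ideal.Quotient.mk_surjective c
    simp only [hbr]
    rw [← map_add, ← map_add, β.jacobi, map_zero]

/-- The Poisson bracket obtained by transport along an isomorphism of algebras. -/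
def PoissonBracket.map (β : PoissonBracket K R) (e : R ≃ₐ[K] S) : PoissonBracket K S where
  br := (β.br.compl₁₂ e.symm.toLinearMap e.symm.toLinearMap).compr₂ e.toLinearMap
  br_self a := by simp [β.br_self]
  br_mul a b c := by simp [β.br_mul]
  jacobi a b c := by
    simpa using congrArg e (β.jacobi (e.symm a) (e.symm b) (e.symm c))

theorem PoissonBracket.map_br (β : PoissonBracket K R) (e : R ≃ₐ[K] S) (a b : R) :
    (β.map e).br (e a) (e b) = e (β.br a b) := by
  simp [PoissonBracket.map]

theorem PoissonBracket.exists_range (β : PoissonBracket K R) {j : R →ₐ[K] S}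
    (hj : Function.Injective j) :
    ∃ βj : PoissonBracket K j.range, ∀ a b,
      βj.br (j.rangeRestrict a) (j.rangeRestrict b) = j.rangeRestrict (β.br a b) :=
  ⟨β.map (AlgEquiv.ofInjective j hj), fun a b => β.map_br (AlgEquiv.ofInjective j hj) a b⟩

end PoissonBracket

/-! ### The Schouten square and the Jacobi identity -/

section Contraction

variable {R V : Type*} [CommRing R] [AddCommGroup V] [Module R V]

/-- The contraction of a `2`-tensor with a pair of linear forms. -/
def contract₂ (a b : V →ₗ[R] R) : V ⊗[R] V →ₗ[R] R :=
  (TensorProduct.lid R R).toLinearMap ∘ₗ TensorProduct.map a b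

/-- The contraction of a `3`-tensor with a triple of linear forms. -/
def contract₃ (a b c : V →ₗ[R] R) : V ⊗[R] (V ⊗[R] V) →ₗ[R] R :=
  (TensorProduct.lid R R).toLinearMap ∘ₗ TensorProduct.map a (contract₂ b c)

@[simp]
theorem contract₂_tmul (a b : V →ₗ[R] R) (x y : V) : contract₂ a b (x ⊗ₜ y) = a x * b y := by
  simp [contract₂]

@[simp]
theorem contract₃_tmul (a b c : V →ₗ[R] R) (x y z : V) :
    contract₃ a b c (x ⊗ₜ (y ⊗ₜ z)) = a x * (b y * c z) := by
  simp [contract₃]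

theorem contract₂_wedge₂ (a b : V →ₗ[R] R) (x y : V) :
    contract₂ a b (wedge₂ x y) = a x * b y - a y * b x := by
  simp [wedge₂]

theorem contract₃_wedge₃ (a b c : V →ₗ[R] R) (x y z : V) :
    contract₃ a b c (wedge₃ x y z) =
      a x * (b y * c z) + a y * (b z * c x) + a z * (b x * c y)
        - a x * (b z * c y) - a y * (b x * c z) - a z * (b y * c x) := by
  simp [wedge₃]

theorem contract₂_map {W : Type*} [AddCommGroup W] [Module R W] (a b : W →ₗ[R] R)
    (S T : V →ₗ[R] W) (t : V ⊗[R] V) :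
    contract₂ a b (TensorProduct.map S T t) = contract₂ (a ∘ₗ S) (b ∘ₗ T) t := by
  induction t using TensorProduct.induction_on with
  | zero => simp
  | add s t hs ht => simp only [map_add, hs, ht]
  | tmul v w => simp

/-- A tensor in the image of `S ⊗ T` is annihilated by `id ⊗ a` if `a` is zero on the image
of `T`. -/
theorem rid_map_map_eq_zero {W L : Type*} [AddCommGroup W] [Module R W] [AddCommGroup L]
    [Module R L] (a : V →ₗ[R] R) {S : L →ₗ[R] W} {T : L →ₗ[R] V} (hT : ∀ x, a (T x) = 0)
    (t : L ⊗[R] L) :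
    TensorProduct.rid R W (TensorProduct.map LinearMap.id a (TensorProduct.map S T t)) = 0 := by
  induction t using TensorProduct.induction_on with
  | zero => simp
  | add s t hs ht => simp only [map_add, hs, ht, add_zero]
  | tmul v w => simp [hT]

theorem rid_map_map_wedge₂ {W : Type*} [AddCommGroup W] [Module R W] (a : V →ₗ[R] R)
    (S : V →ₗ[R] W) (x y : V) :
    TensorProduct.rid R W (TensorProduct.map LinearMap.id a
      (TensorProduct.map S LinearMap.id (wedge₂ x y))) = -S (a x • y - a y • x) := by
  simp [wedge₂]

end Contraction

section Jacobi

variable {K R : Type*} [CommRing K] [CommRing R] [Algebra K R]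

/-- The value `X ↦ X a` of derivations at an element `a`, as a linear form. -/
def evalAt (a : R) : Derivation K R R →ₗ[R] R where
  toFun X := X a
  map_add' _ _ := rfl
  map_smul' _ _ := rfl

@[simp]
theorem evalAt_apply (a : R) (X : Derivation K R R) : evalAt a X = X a := rfl

/-- The bracket of a decomposable bivector. -/
def wedgeTerm (X Y : Derivation K R R) (a b : R) : R := X a * Y b - Y a * X b

/-- The polarized form, on decomposable bivectors, of the identity which expresses the Schouten
square of `P` by the Jacobiator of its bracket: the terms of second order cancel. -/
theorem contract₃_schoutenTerm (X₁ X₂ Y₁ Y₂ : Derivation K R R) (a b c : R) :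
    contract₃ (evalAt a) (evalAt b) (evalAt c)
        (schoutenTerm (R := R) X₁ X₂ Y₁ Y₂ ⁅X₁, Y₁⁆ ⁅X₁, Y₂⁆ ⁅X₂, Y₁⁆ ⁅X₂, Y₂⁆) =
      -(wedgeTerm X₁ X₂ (wedgeTerm Y₁ Y₂ a b) c + wedgeTerm X₁ X₂ (wedgeTerm Y₁ Y₂ b c) a +
          wedgeTerm X₁ X₂ (wedgeTerm Y₁ Y₂ c a) b +
        (wedgeTerm Y₁ Y₂ (wedgeTerm X₁ X₂ a b) c + wedgeTerm Y₁ Y₂ (wedgeTerm X₁ X₂ b c) a +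
          wedgeTerm Y₁ Y₂ (wedgeTerm X₁ X₂ c a) b)) := by
  simp only [schoutenTerm, map_add, map_sub, contract₃_wedge₃, evalAt_apply,
    Derivation.commutator_apply, wedgeTerm, Derivation.leibniz, smul_eq_mul]
  ring

/-- The bracket `(a, b) ↦ ∑ᵢ (Xᵢ ∧ Yᵢ)(da, db)` of a bivector. -/
def wedgeBracket {ι : Type*} [Fintype ι] (X Y : ι → Derivation K R R) (a b : R) : R :=
  ∑ i, wedgeTerm (X i) (Y i) a b

theorem wedgeBracket_wedgeBracket {ι : Type*} [Fintype ι] (X Y : ι → Derivation K R R)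
    (a b c : R) :
    wedgeBracket X Y (wedgeBracket X Y a b) c =
      ∑ i, ∑ j, wedgeTerm (X i) (Y i) (wedgeTerm (X j) (Y j) a b) c := by
  simp only [wedgeBracket]
  refine Finset.sum_congr rfl fun i _ => ?_
  simp only [wedgeTerm, map_sum, Finset.sum_mul, ← Finset.sum_sub_distrib]

/-- The Schouten square of a bivector is, up to the factor `-2`, the Jacobiator of its bracket. -/
theorem contract₃_schoutenSquare {ι : Type*} [Fintype ι] (X Y : ι → Derivation K R R)
    (a b c : R) :
    contract₃ (evalAt a) (evalAt b) (evalAt c)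
        (∑ i, ∑ j, schoutenTerm (R := R) (X i) (Y i) (X j) (Y j)
          ⁅X i, X j⁆ ⁅X i, Y j⁆ ⁅Y i, X j⁆ ⁅Y i, Y j⁆) =
      -2 * (wedgeBracket X Y (wedgeBracket X Y a b) c +
        wedgeBracket X Y (wedgeBracket X Y b c) a + wedgeBracket X Y (wedgeBracket X Y c a) b) := by
  simp only [map_sum, contract₃_schoutenTerm, wedgeBracket_wedgeBracket, Finset.sum_add_distrib,
    Finset.sum_neg_distrib]
  rw [Finset.sum_comm (f := fun i j => wedgeTerm (X j) (Y j) (wedgeTerm (X i) (Y i) a b) c),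
    Finset.sum_comm (f := fun i j => wedgeTerm (X j) (Y j) (wedgeTerm (X i) (Y i) b c) a),
    Finset.sum_comm (f := fun i j => wedgeTerm (X j) (Y j) (wedgeTerm (X i) (Y i) c a) b)]
  ring

end Jacobi

/-! ### Derivations and points of affine schemes -/

section NilpotentCase

variable {k R : Type*} [CommRing k] [CommRing R] [Algebra k R] [Algebra ℚ R]

/-- Differentiating `F ^ (m + 1) * D F ^ l = 0` and multiplying by `D F` trades a factor `F` for two
factors `D F`, up to the invertible factor `m + 1`. -/
theorem isNilpotent_derivation_of_pow_mul_pow (D : Derivation k R R) (F : R) (m : ℕ) :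
    ∀ l : ℕ, F ^ m * D F ^ l = 0 → IsNilpotent (D F) := by
  induction m with
  | zero => exact fun l h => ⟨l, by simpa using h⟩
  | succ m ih =>
    intro l h
    refine ih (l + 2) ?_
    have h1 := congrArg D h
    have h2 : ((m + 1 : ℕ) : R) * (F ^ m * D F ^ (l + 2)) = 0 := by
      have : ((m + 1 : ℕ) : R) * (F ^ m * D F ^ (l + 2)) =
          D F * D (F ^ (m + 1) * D F ^ l) - D (D F ^ l) * D F * F ^ (m + 1) := by
        simp only [Derivation.leibniz, Derivation.leibniz_pow, smul_eq_mul, nsmul_eq_mul,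
          Nat.add_sub_cancel]
        ring
      rw [this, h1, map_zero, mul_zero, zero_sub, Derivation.leibniz_pow]
      rcases l with _ | l
      · simp
      · simp only [Nat.add_sub_cancel, smul_eq_mul, nsmul_eq_mul]
        linear_combination (-((l + 1 : ℕ) : R) * D (D F)) * h
    have h3 : IsUnit ((m + 1 : ℕ) : R) := by
      have : IsUnit (algebraMap ℚ R ((m + 1 : ℕ) : ℚ)) :=
        (isUnit_iff_ne_zero.2 (Nat.cast_ne_zero.2 m.succ_ne_zero)).map _
      rwa [map_natCast] at this
    exact (h3.mul_right_eq_zero).1 h2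

/-- In characteristic zero, derivations preserve the nilradical. -/
theorem isNilpotent_derivation (D : Derivation k R R) {F : R} (hF : IsNilpotent F) :
    IsNilpotent (D F) := by
  obtain ⟨m, hm⟩ := hF
  exact isNilpotent_derivation_of_pow_mul_pow D F m 0 (by simp [hm])

end NilpotentCase

/-- The Nullstellensatz: a function that vanishes at all points with values in the algebraically
closed base field is nilpotent. -/
theorem isNilpotent_of_forall_algHom {k R : Type*} [Field k] [IsAlgClosed k] [CommRing R]
    [Algebra k R] [Algebra.FiniteType k R] {F : R} (hF : ∀ p : R →ₐ[k] k, p F = 0) :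
    IsNilpotent F := by
  have : IsJacobsonRing R := isJacobsonRing_of_finiteType (A := k)
  rw [← mem_nilradical, nilradical, Ideal.radical_eq_jacobson, Ideal.jacobson, Ideal.mem_sInf]
  rintro m ⟨-, hm⟩
  let _ : Field (R ⧸ m) := Ideal.Quotient.field m
  have := finite_of_finite_type_of_isJacobsonRing k (R ⧸ m)
  let e : k ≃ₐ[k] R ⧸ m := AlgEquiv.ofBijective (Algebra.ofId k (R ⧸ m))
    (IsAlgClosed.algebraMap_bijective_of_isIntegral)
  have h := hF (e.symm.toAlgHom.comp (Ideal.Quotient.mkₐ k m))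
  rw [← Ideal.Quotient.eq_zero_iff_mem]
  exact (map_eq_zero_iff e.symm e.symm.injective).1 h

/-- Along an integral curve of a polynomial vector field, polynomials are differentiated by means of
the corresponding derivation. -/
theorem hasDerivAt_mvPolynomial_eval {n : ℕ}
    (D : Derivation ℝ (MvPolynomial (Fin n) ℝ) (MvPolynomial (Fin n) ℝ)) {γ : ℝ → Fin n → ℝ} {t : ℝ}
    (hγ : HasDerivAt γ (fun i => MvPolynomial.eval (γ t) (D (MvPolynomial.X i))) t)
    (q : MvPolynomial (Fin n) ℝ) :
    HasDerivAt (fun s => MvPolynomial.eval (γ s) q) (MvPolynomial.eval (γ t) (D q)) t := by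
  induction q using MvPolynomial.induction_on with
  | C a =>
    have : D (MvPolynomial.C a) = 0 := D.map_algebraMap a
    simpa [this] using hasDerivAt_const t a
  | add p q hp hq => simp only [map_add]; exact hp.add hq
  | mul_X p i hp =>
    have := hp.mul (hasDerivAt_pi.1 hγ i)
    simp only [map_mul, MvPolynomial.eval_X, Derivation.leibniz, smul_eq_mul, map_add]
    refine this.congr_deriv ?_
    ring

theorem contDiff_eval {n : ℕ} (q : MvPolynomial (Fin n) ℝ) :
    ContDiff ℝ 1 (fun x : Fin n → ℝ => MvPolynomial.eval x q) := by
  induction q using MvPolynomial.induction_on with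
  | C a => simpa using contDiff_const
  | add p q hp hq => simpa using hp.add hq
  | mul_X p i hp => simpa using hp.mul (contDiff_apply ℝ ℝ i)

/-- If a function on a real affine scheme of finite type vanishes at all real points, so does its
derivative with respect to any vector field: the integral curves of the vector field consist of real
points. -/
theorem derivation_vanishes_real {R : Type*} [CommRing R] [Algebra ℝ R]
    [Algebra.FiniteType ℝ R] (D : Derivation ℝ R R) {F : R} (hF : ∀ p : R →ₐ[ℝ] ℝ, p F = 0)
    (p : R →ₐ[ℝ] ℝ) : p (D F) = 0 := by
  obtain ⟨n, π, hπ⟩ := Algebra.FiniteType.iff_quotient_mvPolynomial''.1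
    (inferInstance : Algebra.FiniteType ℝ R)
  choose L hL using fun i => hπ (D (π (MvPolynomial.X i)))
  let D' : Derivation ℝ (MvPolynomial (Fin n) ℝ) (MvPolynomial (Fin n) ℝ) :=
    MvPolynomial.mkDerivation ℝ L
  have hD' : ∀ q, π (D' q) = D (π q) := by
    intro q
    induction q using MvPolynomial.induction_on with
    | C a =>
      have h1 : D' (MvPolynomial.C a) = 0 := D'.map_algebraMap a
      have h2 : π (MvPolynomial.C a) = algebraMap ℝ R a := π.commutes a
      rw [h1, h2, map_zero, D.map_algebraMap]
    | add p q hp hq => simp [hp, hq]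
    | mul_X p i hp =>
      simp only [map_mul, Derivation.leibniz, smul_eq_mul, map_add, hp]
      rw [MvPolynomial.mkDerivation_X, hL]
  let x : Fin n → ℝ := fun i => p (π (MvPolynomial.X i))
  have hx : ∀ q, MvPolynomial.eval x q = p (π q) := by
    intro q
    have : (MvPolynomial.aeval x : MvPolynomial (Fin n) ℝ →ₐ[ℝ] ℝ) = p.comp π := by
      ext i; simp [x]
    rw [← MvPolynomial.coe_aeval_eq_eval]
    exact congrArg (fun φ => φ q) this
  obtain ⟨γ, hγ0, ε, hε, hγ⟩ :=
    (ContDiffAt.exists_forall_mem_closedBall_exists_eq_forall_mem_Ioo_hasDerivAt₀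
      (f := fun y : Fin n → ℝ => fun i => MvPolynomial.eval y (D' (MvPolynomial.X i))) (x₀ := x)
      (contDiff_pi.2 fun i => contDiff_eval _).contDiffAt 0)
  simp only [zero_sub, zero_add] at hγ
  have hder : ∀ q, ∀ t ∈ Set.Ioo (-ε) ε, HasDerivAt (fun s => MvPolynomial.eval (γ s) q)
      (MvPolynomial.eval (γ t) (D' q)) t := fun q t ht => hasDerivAt_mvPolynomial_eval D' (hγ t ht) q
  -- the ideal of the scheme vanishes along the curve, by Grönwall's inequality
  have hker : ∀ q, π q = 0 → ∀ t ∈ Set.Icc 0 (ε / 2), MvPolynomial.eval (γ t) q = 0 := by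
    obtain ⟨S, hS⟩ := (isNoetherian_def.1 (inferInstance : IsNoetherianRing (MvPolynomial (Fin n) ℝ)))
      (RingHom.ker π)
    have hSπ : ∀ g : S, π g = 0 := fun g => by
      have : (g : MvPolynomial (Fin n) ℝ) ∈ RingHom.ker π := hS ▸ Submodule.subset_span g.2
      exact this
    have hrep : ∀ q, π q = 0 → ∃ a : S → MvPolynomial (Fin n) ℝ, q = ∑ g, a g * g := by
      intro q hq
      have hq' : q ∈ Submodule.span (MvPolynomial (Fin n) ℝ) (S : Set (MvPolynomial (Fin n) ℝ)) := by
        rw [hS]; exact hq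
      obtain ⟨a, -, ha⟩ := Submodule.mem_span_finset.1 hq'
      exact ⟨fun g => a g, by rw [← ha, ← Finset.sum_coe_sort S]; rfl⟩
    choose a ha using fun g : S => hrep (D' g) (by rw [hD', hSπ, map_zero])
    let u : ℝ → S → ℝ := fun t g => MvPolynomial.eval (γ t) g
    have hsub : Set.Icc 0 (ε / 2) ⊆ Set.Ioo (-ε) ε := fun t ht =>
      ⟨by linarith [ht.1], by linarith [ht.2]⟩
    have hγc : ContinuousOn γ (Set.Icc 0 (ε / 2)) := fun t ht =>
      (hγ t (hsub ht)).continuousAt.continuousWithinAt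
    have hac : ContinuousOn (fun t => ∑ g, ∑ h, ‖MvPolynomial.eval (γ t) (a g h)‖)
        (Set.Icc 0 (ε / 2)) :=
      continuousOn_finsetSum _ fun g _ => continuousOn_finsetSum _ fun h _ =>
        ((contDiff_eval (a g h)).continuous.comp_continuousOn hγc).norm
    obtain ⟨C, hC⟩ := isCompact_Icc.exists_bound_of_continuousOn hac
    have hu : ∀ t ∈ Set.Ioo (-ε) ε, HasDerivAt u
        (fun g => MvPolynomial.eval (γ t) (D' (g : MvPolynomial (Fin n) ℝ))) t := fun t ht =>
      hasDerivAt_pi.2 fun g => hder g t ht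
    have hu0 : ∀ t ∈ Set.Icc 0 (ε / 2), u t = 0 := by
      refine eq_zero_of_abs_deriv_le_mul_abs_self_of_eq_zero_right (E := S → ℝ) (f := u) (K := C)
        (f' := fun t (g : S) => MvPolynomial.eval (γ t) (D' (g : MvPolynomial (Fin n) ℝ)))
        (fun t ht => (hu t (hsub ht)).continuousAt.continuousWithinAt)
        (fun t ht => (hu t (hsub (Set.Ico_subset_Icc_self ht))).hasDerivWithinAt) ?_ ?_
      · funext g
        simp [u, hγ0, hx, hSπ]
      · intro t ht
        have hCt := hC t (Set.Ico_subset_Icc_self ht)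
        rw [Real.norm_of_nonneg (by positivity)] at hCt
        have hC0 : 0 ≤ C := le_trans (by positivity) hCt
        refine (pi_norm_le_iff_of_nonneg (by positivity)).2 fun g => ?_
        rw [ha g, map_sum]
        calc ‖∑ h : S, MvPolynomial.eval (γ t) (a g h * h)‖
            ≤ ∑ h : S, ‖MvPolynomial.eval (γ t) (a g h)‖ * ‖u t‖ := by
              refine (norm_sum_le _ _).trans (Finset.sum_le_sum fun h _ => ?_)
              rw [map_mul, norm_mul]
              exact mul_le_mul_of_nonneg_left (norm_le_pi_norm (u t) h) (norm_nonneg _)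
          _ = (∑ h : S, ‖MvPolynomial.eval (γ t) (a g h)‖) * ‖u t‖ := by rw [Finset.sum_mul]
          _ ≤ C * ‖u t‖ := by
              refine mul_le_mul_of_nonneg_right (le_trans ?_ hCt) (norm_nonneg _)
              exact Finset.single_le_sum
                (f := fun g => ∑ h : S, ‖MvPolynomial.eval (γ t) (a g h)‖)
                (fun i _ => by positivity) (Finset.mem_univ g)
    intro q hq t ht
    obtain ⟨b, rfl⟩ := hrep q hq
    rw [map_sum]
    refine Finset.sum_eq_zero fun g _ => ?_
    have := congrFun (hu0 t ht) g
    rw [map_mul, show MvPolynomial.eval (γ t) (g : MvPolynomial (Fin n) ℝ) = 0 from this, mul_zero]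
  obtain ⟨q, rfl⟩ := hπ F
  have hq : ∀ t ∈ Set.Icc 0 (ε / 2), MvPolynomial.eval (γ t) q = 0 := by
    intro t ht
    let pt : R →ₐ[ℝ] ℝ := AlgHom.liftOfSurjective π hπ (MvPolynomial.aeval (γ t))
      (fun q hq => by simpa [MvPolynomial.aeval_eq_eval] using hker q hq t ht)
    have h1 : pt (π q) = MvPolynomial.eval (γ t) q := by
      simp [pt, MvPolynomial.aeval_eq_eval]
    rw [← h1]
    exact hF pt
  have hd := (hder q 0 ⟨by linarith, hε⟩).hasDerivWithinAt (s := Set.Icc 0 (ε / 2))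
  have hd0 : HasDerivWithinAt (fun s => MvPolynomial.eval (γ s) q) 0 (Set.Icc 0 (ε / 2)) 0 :=
    (hasDerivWithinAt_const (0 : ℝ) (Set.Icc 0 (ε / 2)) (0 : ℝ)).congr (fun t ht => hq t ht)
      (hq 0 ⟨le_rfl, by linarith⟩)
  have := (uniqueDiffOn_Icc (by linarith : (0 : ℝ) < ε / 2) 0 ⟨le_rfl, by linarith⟩).eq_deriv _ hd hd0
  rw [hγ0, hx, hD'] at this
  exact this

/-- The fields over which points are considered: if a function on an affine scheme of finite type
vanishes at all points with values in the base field, so does its derivative with respect to any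
vector field. -/
theorem derivation_vanishes {k R : Type*} [Field k] [CharZero k] [CommRing R] [Algebra k R]
    [Algebra.FiniteType k R] (hk : IsAlgClosed k ∨ Nonempty (k ≃+* ℝ)) (D : Derivation k R R) {F : R}
    (hF : ∀ p : R →ₐ[k] k, p F = 0) (p : R →ₐ[k] k) : p (D F) = 0 := by
  rcases hk with hk | ⟨⟨e⟩⟩
  · let _ : Algebra ℚ R := ((algebraMap k R).comp (algebraMap ℚ k)).toAlgebra
    have h := isNilpotent_derivation D (isNilpotent_of_forall_algHom hF)
    exact (h.map p).eq_zero
  · let _ : Algebra ℝ k := e.symm.toRingHom.toAlgebra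
    let _ : Algebra ℝ R := ((algebraMap k R).comp e.symm.toRingHom).toAlgebra
    have : IsScalarTower ℝ k R := IsScalarTower.of_algebraMap_eq fun _ => rfl
    have : Algebra.FiniteType ℝ k :=
      Algebra.FiniteType.of_surjective (Algebra.ofId ℝ k) e.symm.surjective
    have : Algebra.FiniteType ℝ R := Algebra.FiniteType.trans (S := k) inferInstance inferInstance
    let ek : k ≃ₐ[ℝ] ℝ := AlgEquiv.ofRingEquiv (f := e) fun x => e.apply_symm_apply x
    have key := derivation_vanishes_real (D.restrictScalars ℝ) (F := F) ?_
      (ek.toAlgHom.comp (p.restrictScalars ℝ))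
    · exact (map_eq_zero_iff ek ek.injective).1 key
    · intro q
      let q' : R →ₐ[k] k :=
        { (e.symm.toRingHom.comp q.toRingHom : R →+* k) with
          commutes' := fun x => by
            have h1 : algebraMap k R x = algebraMap ℝ R (e x) := by
              change _ = algebraMap k R (e.symm (e x))
              rw [e.symm_apply_apply]
            change e.symm (q (algebraMap k R x)) = x
            rw [h1, q.commutes]
            exact e.symm_apply_apply x }
      have h := hF q'
      exact (map_eq_zero_iff e.symm e.symm.injective).1 h

/-- The derivation of `S ⊗ A` over `S` obtained from a derivation of `A` by extension of scalars. -/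
def baseChangeDerivation {k A : Type*} (S : Type*) [CommRing k] [CommRing A] [Algebra k A]
    [CommRing S] [Algebra k S] (D : Derivation k A A) : Derivation S (S ⊗[k] A) (S ⊗[k] A) :=
  Derivation.mk' ((D : A →ₗ[k] A).baseChange S) (by
    intro u v
    induction u using TensorProduct.induction_on with
    | zero => simp
    | add u₁ u₂ h₁ h₂ => simp only [add_mul, map_add, h₁, h₂, add_smul, smul_add]; abel
    | tmul s a =>
      induction v using TensorProduct.induction_on with
      | zero => simp
      | add v₁ v₂ h₁ h₂ => simp only [mul_add, map_add, h₁, h₂, add_smul, smul_add]; abel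
      | tmul t b =>
        simp [TensorProduct.tmul_add, mul_comm t s])

/-- A vector field that is tangent to the fibres of `Φ` differentiates the functions that vanish on
a fibre into functions that vanish on this fibre. The comorphism of `Φ` is the structure map of the
`B`-algebra `A`. -/
theorem derivation_vanishes_fibre {K B A Ω : Type*} [Field K] [CommRing B] [Algebra K B]
    [CommRing A] [Algebra K A] [Algebra.FiniteType K A] [Algebra B A] [IsScalarTower K B A]
    [Field Ω] [CharZero Ω] [Algebra K Ω] (hΩ : IsAlgClosed Ω ∨ Nonempty (Ω ≃+* ℝ))
    (D : Derivation K A A) (hD : ∀ b : B, D (algebraMap B A b) = 0) (p : A →ₐ[K] Ω) {F : A}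
    (hF : ∀ q : A →ₐ[K] Ω, (∀ b : B, q (algebraMap B A b) = p (algebraMap B A b)) → q F = 0) :
    p (D F) = 0 := by
  let _ : Algebra B Ω := (p.toRingHom.comp (algebraMap B A)).toAlgebra
  have : IsScalarTower K B Ω := IsScalarTower.of_algebraMap_eq fun x => by
    change _ = p (algebraMap B A (algebraMap K B x))
    rw [← IsScalarTower.algebraMap_apply, p.commutes]
  have : Algebra.FiniteType B A := Algebra.FiniteType.of_restrictScalars_finiteType K B A
  let D' : Derivation B A A := Derivation.mk'
    { toFun := D
      map_add' := map_add D
      map_smul' := fun b a => by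
        simp [Algebra.smul_def, hD] } (fun a b => D.leibniz a b)
  let pB : A →ₐ[B] Ω := { p with commutes' := fun b => rfl }
  let P : Ω ⊗[B] A →ₐ[Ω] Ω := Algebra.TensorProduct.lift (AlgHom.id Ω Ω) pB fun _ _ => .all _ _
  have h := derivation_vanishes hΩ (baseChangeDerivation Ω D') (F := 1 ⊗ₜ F) ?_ P
  · have h1 : baseChangeDerivation Ω D' (1 ⊗ₜ F) = 1 ⊗ₜ D F := by
      simp [baseChangeDerivation]; rfl
    rw [h1] at h
    have h2 : pB (D F) = 0 := by simpa [P] using h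
    exact h2
  · intro q
    let q' : A →ₐ[B] Ω := (q.restrictScalars B).comp Algebra.TensorProduct.includeRight
    exact hF (q'.restrictScalars K) fun b => q'.commutes b

/-! ### Reduction of affine algebraic quasi Poisson varieties -/

section AlgebraicReduction

variable {K : Type*} [Field K]
  {B : Type*} [CommRing B] [HopfAlgebra K B]
  {A : Type*} [CommRing A] [Algebra K A]

theorem algPairing_eq (P : Derivation K A A ⊗[A] Derivation K A A) (f h : A) :
    algPairing P f h = contract₂ (evalAt f) (evalAt h) P := by
  induction P using TensorProduct.induction_on with
  | zero => simp [algPairing]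
  | add P Q hP hQ =>
    rw [map_add, ← hP, ← hQ]
    simp [algPairing]
  | tmul X Y => simp [algPairing]

theorem algPairing_mul (P : Derivation K A A ⊗[A] Derivation K A A) (f h k : A) :
    algPairing P f (h * k) = algPairing P f h * k + h * algPairing P f k := by
  simp only [algPairing_eq]
  induction P using TensorProduct.induction_on with
  | zero => simp
  | add P Q hP hQ => simp only [map_add, hP, hQ]; ring
  | tmul X Y => simp; ring

/-- The Hamiltonian vector field `h ↦ P(df, dh)` of a function `f`. -/
def hamiltonianField (P : Derivation K A A ⊗[A] Derivation K A A) (f : A) : Derivation K A A :=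
  Derivation.mk' (algPairing P f) fun h k => by
    rw [algPairing_mul, smul_eq_mul, smul_eq_mul]; ring

theorem algPairing_swap {P : Derivation K A A ⊗[A] Derivation K A A}
    (hP : TensorProduct.comm A _ _ P = -P) (f h : A) : algPairing P f h = -algPairing P h f := by
  have : contract₂ (evalAt f) (evalAt h) (TensorProduct.comm A _ _ P) =
      contract₂ (evalAt h) (evalAt f) P := by
    clear hP
    induction P using TensorProduct.induction_on with
    | zero => simp
    | add P Q hP hQ => simp only [map_add, hP, hQ]
    | tmul X Y => simp; ring
  rw [hP, map_neg] at this
  rw [algPairing_eq, algPairing_eq, ← this, neg_neg]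

theorem AlgAction.fund_invariant (α : AlgAction K B A) (X : lieAlg K B) {f : A}
    (hf : f ∈ α.invariants) : α.fund X f = 0 := by
  have hf' : α.coact f = 1 ⊗ₜ f := hf
  change -(contractLeft α.coact α.counit_coact X.1 f) = 0
  simp [contractLeft, hf', atOne]

theorem AlgAction.contract₃_fundTrivector (α : AlgAction K B A)
    (φ : lieAlg K B ⊗[K] (lieAlg K B ⊗[K] lieAlg K B)) {f : A} (hf : f ∈ α.invariants) (h k : A) :
    contract₃ (evalAt f) (evalAt h) (evalAt k) (α.fundTrivector φ) = 0 := by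
  rw [AlgAction.fundTrivector]
  induction φ using TensorProduct.induction_on with
  | zero => simp
  | add φ ψ hφ hψ => simp only [map_add, hφ, hψ, add_zero]
  | tmul X t => simp [contract₃, α.fund_invariant X hf]

variable {α : AlgAction K B A} {c : K} {H : lieAlg K B ⊗[K] lieAlg K B}
  {P : Derivation K A A ⊗[A] Derivation K A A} [Algebra B A] [IsScalarTower K B A]

theorem IsAlgHamiltonian.jacobi [CharZero K] (hP : IsAlgHamiltonian α c H P) {f : A}
    (hf : f ∈ α.invariants) (h k : A) :
    algPairing P (algPairing P f h) k + algPairing P (algPairing P h k) f +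
      algPairing P (algPairing P k f) h = 0 := by
  obtain ⟨m, X, Y, hXY, hT⟩ := hP.schouten
  have hw : ∀ a b, algPairing P a b = wedgeBracket X Y a b := fun a b => by
    rw [algPairing_eq, hXY, map_sum]
    exact Finset.sum_congr rfl fun i _ => contract₂_wedge₂ _ _ _ _
  have h1 := contract₃_schoutenSquare X Y f h k
  have h0 : contract₃ (evalAt f) (evalAt h) (evalAt k)
      (c • α.fundTrivector (cartanElement (lieAlgBracket K B) H)) = 0 := by
    rw [LinearMap.map_smul_of_tower, α.contract₃_fundTrivector _ hf, smul_zero]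
  rw [← hT, h0] at h1
  simp only [hw]
  have h2 : algebraMap K A (-2) * (wedgeBracket X Y (wedgeBracket X Y f h) k +
      wedgeBracket X Y (wedgeBracket X Y h k) f + wedgeBracket X Y (wedgeBracket X Y k f) h) = 0 := by
    rw [h1, map_neg, map_ofNat]
  rwa [← Algebra.smul_def, smul_eq_zero_iff_right (by norm_num)] at h2

theorem IsAlgHamiltonian.algPairing_mem (hP : IsAlgHamiltonian α c H P) {f h : A}
    (hf : f ∈ α.invariants) (hh : h ∈ α.invariants) : algPairing P f h ∈ α.invariants := by
  have hf' : α.coact f = 1 ⊗ₜ f := hf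
  have hh' : α.coact h = 1 ⊗ₜ h := hh
  change α.coact _ = 1 ⊗ₜ _
  rw [hP.invariant, hf', hh']
  simp

/-- The Poisson bracket on the invariant functions. -/
def IsAlgHamiltonian.bracket [CharZero K] (hP : IsAlgHamiltonian α c H P) :
    PoissonBracket K α.invariants where
  br := LinearMap.mk₂ K (fun f h => ⟨algPairing P f h, hP.algPairing_mem f.2 h.2⟩)
    (fun f f' h => Subtype.ext (by simp)) (fun c f h => Subtype.ext (by simp))
    (fun f h h' => Subtype.ext (by simp)) (fun c f h => Subtype.ext (by simp))
  br_self f := Subtype.ext (by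
    have h := algPairing_swap hP.antisymm (f : A) f
    have h2 : algebraMap K A 2 * algPairing P (f : A) f = 0 := by
      rw [map_ofNat]; linear_combination h
    rwa [← Algebra.smul_def, smul_eq_zero_iff_right (by norm_num)] at h2)
  br_mul f h k := Subtype.ext (algPairing_mul P f h k)
  jacobi f h k := Subtype.ext (hP.jacobi f.2 h k)

/-- By the momentum property, the Hamiltonian vector fields of invariant functions are tangent to
the fibres of the momentum mapping. -/
theorem IsAlgHamiltonian.algPairing_algebraMap (hP : IsAlgHamiltonian α c H P) (b : B) {f : A}
    (hf : f ∈ α.invariants) : algPairing P f (algebraMap B A b) = 0 := by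
  rw [algPairing_swap hP.antisymm, neg_eq_zero]
  let evB : Derivation K B A →ₗ[A] A :=
    { toFun := fun X => X b, map_add' := fun _ _ => rfl, map_smul' := fun _ _ => rfl }
  let κ : Derivation K B A ⊗[A] Derivation K A A →ₗ[A] A :=
    (TensorProduct.lid A A).toLinearMap ∘ₗ TensorProduct.map evB (evalAt f)
  have h1 : κ (LinearMap.rTensor (Derivation K A A) (Derivation.compAlgebraMapL K B A A) P) =
      algPairing P (algebraMap B A b) f := by
    rw [algPairing_eq]
    generalize P = P
    induction P using TensorProduct.induction_on with
    | zero => simp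
    | add P Q hP hQ => simp only [map_add, hP, hQ]
    | tmul X Y => simp [κ, evB]
  have h2 : ∀ (τ : lieAlg K B →ₗ[K] Derivation K B A),
      κ (TensorProduct.mapOfCompatibleSMul A K K (Derivation K B A) (Derivation K A A)
        (TensorProduct.map τ α.fund H)) = 0 := by
    intro τ
    generalize H = H
    induction H using TensorProduct.induction_on with
    | zero => simp
    | add P Q hP hQ => simp only [map_add, hP, hQ, add_zero]
    | tmul X Y => simp [κ, α.fund_invariant Y hf]
  rw [← h1, hP.momentum, h2]

variable {Ω : Type*} [Field Ω] [Algebra K Ω]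

theorem IsAlgHamiltonian.vanishingIdeal_poisson [CharZero K] [Algebra.FiniteType K A]
    (hP : IsAlgHamiltonian α c H P) (hΩ : IsAlgClosed Ω ∨ Nonempty (Ω ≃+* ℝ))
    (C : ConjClasses (WithConv (B →ₐ[K] Ω))) (f : α.invariants) {F : α.invariants}
    (hF : F ∈ α.vanishingIdeal C) : hP.bracket.br f F ∈ α.vanishingIdeal C := by
  intro p
  have : CharZero Ω := charZero_of_injective_algebraMap (algebraMap K Ω).injective
  refine derivation_vanishes_fibre (B := B) hΩ (hamiltonianField P (f : A))
    (fun b => hP.algPairing_algebraMap b f.2) p.1 (F := F) fun q hq => ?_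
  refine hF ⟨q, ?_⟩
  have : phiPoint K B A q = phiPoint K B A p.1 := by
    apply WithConv.ofConv_injective
    ext b
    exact hq b
  rw [this]
  exact p.2

theorem AlgAction.eq_of_sameOrbit (α : AlgAction K B A)
    {C : ConjClasses (WithConv (B →ₐ[K] Ω))} {p q : AlgLevel A C} (h : α.SameOrbit C p q) {f : A}
    (hf : f ∈ α.invariants) : p.1 f = q.1 f := by
  obtain ⟨g, hg⟩ := h
  have hf' : α.coact f = 1 ⊗ₜ f := hf
  rw [← hg]
  simp [AlgAction.act, hf']

/-- Restriction to the level set, as a homomorphism from the invariant functions to the continuous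
functions on the orbit space. -/
def AlgAction.restrictOrbitSpace (α : AlgAction K B A) [TopologicalSpace Ω] [IsTopologicalRing Ω]
    (C : ConjClasses (WithConv (B →ₐ[K] Ω))) : α.invariants →ₐ[K] C(α.OrbitSpace C, Ω) where
  toFun f := ⟨Quot.lift (fun p : AlgLevel A C => p.1 (f : A))
      fun p q h => α.eq_of_sameOrbit h f.2,
    continuous_quot_lift _ ((continuous_apply (f : A)).comp continuous_induced_dom)⟩
  map_one' := by ext x; induction x using Quot.ind; simp
  map_mul' f h := by ext x; induction x using Quot.ind; simp
  map_zero' := by ext x; induction x using Quot.ind; simp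
  map_add' f h := by ext x; induction x using Quot.ind; simp
  commutes' r := by
    ext x
    induction x using Quot.ind
    simp [Algebra.algebraMap_eq_smul_one]

theorem AlgAction.exists_orbitSpace (α : AlgAction K B A) [TopologicalSpace Ω]
    [IsTopologicalRing Ω] (C : ConjClasses (WithConv (B →ₐ[K] Ω))) :
    ∃ j : (α.invariants ⧸ α.vanishingIdeal C) →ₐ[K] C(α.OrbitSpace C, Ω),
      Function.Injective j ∧ ∀ (f : α.invariants) (p : AlgLevel A C),
        j (Ideal.Quotient.mk _ f) (Quot.mk _ p) = p.1 (f : A) := by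
  have hker : ∀ f ∈ α.vanishingIdeal C, α.restrictOrbitSpace C f = 0 := fun f hf => by
    ext x
    induction x using Quot.ind with
    | mk p => exact hf p
  refine ⟨Ideal.Quotient.liftₐ _ (α.restrictOrbitSpace C) hker, ?_, fun f p => rfl⟩
  rw [injective_iff_map_eq_zero]
  intro a ha
  obtain ⟨f, rfl⟩ := Ideal.Quotient.mk_surjective a
  rw [Ideal.Quotient.eq_zero_iff_mem]
  intro p
  exact congrArg (fun φ : C(α.OrbitSpace C, Ω) => φ (Quot.mk _ p)) ha

end AlgebraicReduction

/-! ### Rational representations -/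

section Coaction

variable {K : Type*} [Field K] {B : Type*} [CommRing B] [HopfAlgebra K B]
  {N : Type*} [AddCommGroup N] [Module K N] {N' : Type*} [AddCommGroup N'] [Module K N']

variable (N) in
/-- The contraction `φ ⊗ Id : B ⊗ N → N` with a linear form `φ` on `B`. -/
def contrLeft (φ : B →ₗ[K] K) : B ⊗[K] N →ₗ[K] N :=
  (TensorProduct.lid K N).toLinearMap ∘ₗ LinearMap.rTensor N φ

/-- The contraction `Id ⊗ μ : B ⊗ N → B` with a linear form `μ` on `N`. -/
def contrRight (μ : N →ₗ[K] K) : B ⊗[K] N →ₗ[K] B :=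
  (TensorProduct.rid K B).toLinearMap ∘ₗ LinearMap.lTensor B μ

@[simp]
theorem contrLeft_tmul (φ : B →ₗ[K] K) (b : B) (n : N) : contrLeft N φ (b ⊗ₜ n) = φ b • n := by
  simp [contrLeft]

@[simp]
theorem contrRight_tmul (μ : N →ₗ[K] K) (b : B) (n : N) : contrRight μ (b ⊗ₜ n) = μ n • b := by
  simp [contrRight]

theorem contrLeft_lTensor (φ : B →ₗ[K] K) (l : N →ₗ[K] N') (t : B ⊗[K] N) :
    contrLeft N' φ (LinearMap.lTensor B l t) = l (contrLeft N φ t) := by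
  induction t using TensorProduct.induction_on with
  | zero => simp
  | add s t hs ht => simp only [map_add, hs, ht]
  | tmul b n => simp

theorem map_contrLeft (φ : B →ₗ[K] K) (μ : N →ₗ[K] K) (t : B ⊗[K] N) :
    μ (contrLeft N φ t) = φ (contrRight μ t) := by
  induction t using TensorProduct.induction_on with
  | zero => simp
  | add s t hs ht => simp only [map_add, hs, ht]
  | tmul b n => simp [mul_comm]

/-- Contractions detect the tensors with second factor in a given subspace. -/
theorem mem_range_lTensor_subtype {W : Submodule K N} {t : B ⊗[K] N} :
    t ∈ LinearMap.range (LinearMap.lTensor B W.subtype) ↔ ∀ φ : B →ₗ[K] K, contrLeft N φ t ∈ W := by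
  constructor
  · rintro ⟨s, rfl⟩ φ
    rw [contrLeft_lTensor]
    exact (contrLeft W φ s).2
  · intro h
    let ℬ := Module.Basis.ofVectorSpace K B
    classical
    rw [← (TensorProduct.equivFinsuppOfBasisLeft ℬ).symm_apply_apply t,
      TensorProduct.equivFinsuppOfBasisLeft_symm_apply]
    refine Submodule.sum_mem _ fun i _ => ?_
    rw [TensorProduct.equivFinsuppOfBasisLeft_apply]
    exact ⟨ℬ i ⊗ₜ ⟨_, h (ℬ.coord i)⟩, by simp [contrLeft]⟩

theorem tensor_ext_contrLeft {s t : B ⊗[K] N}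
    (h : ∀ φ : B →ₗ[K] K, contrLeft N φ s = contrLeft N φ t) : s = t := by
  classical
  apply (TensorProduct.equivFinsuppOfBasisLeft (Module.Basis.ofVectorSpace K B)).injective
  ext i
  rw [TensorProduct.equivFinsuppOfBasisLeft_apply, TensorProduct.equivFinsuppOfBasisLeft_apply]
  exact h _

/-- A rational representation of the group with coordinate ring `B`, as a coaction `n ↦ (g ↦ g n)`;
the convention is that of `IsLinearlyReductive`. -/
structure IsCoaction (ρ : N →ₗ[K] B ⊗[K] N) : Prop where
  counit : ∀ n, TensorProduct.lid K N
    (LinearMap.rTensor N (Coalgebra.counit (R := K) (A := B)) (ρ n)) = n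
  coassoc : ∀ n, TensorProduct.assoc K B B N
      (LinearMap.rTensor N (Coalgebra.comul (R := K) (A := B)) (ρ n)) = LinearMap.lTensor B ρ (ρ n)

/-- The operator `φ ⊗ Id` after `ρ` by which a linear form `φ` on `B` acts on the representation
`ρ`. -/
def opr (ρ : N →ₗ[K] B ⊗[K] N) (φ : B →ₗ[K] K) : N →ₗ[K] N := contrLeft N φ ∘ₗ ρ

/-- The convolution product of two linear forms on `B`. -/
def convForm (φ ψ : B →ₗ[K] K) : B →ₗ[K] K :=
  φ ∘ₗ contrRight ψ ∘ₗ Coalgebra.comul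

theorem IsCoaction.opr_counit {ρ : N →ₗ[K] B ⊗[K] N} (hρ : IsCoaction ρ) (n : N) :
    opr ρ Coalgebra.counit n = n := hρ.counit n

theorem IsCoaction.opr_opr {ρ : N →ₗ[K] B ⊗[K] N} (hρ : IsCoaction ρ) (φ ψ : B →ₗ[K] K) (n : N) :
    opr ρ ψ (opr ρ φ n) = opr ρ (convForm φ ψ) n := by
  have h1 : ∀ t : B ⊗[K] N, opr ρ ψ (contrLeft N φ t) =
      contrLeft N φ (LinearMap.lTensor B (contrLeft N ψ) (LinearMap.lTensor B ρ t)) := by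
    intro t
    rw [contrLeft_lTensor, contrLeft_lTensor]; rfl
  have h2 : ∀ u : (B ⊗[K] B) ⊗[K] N,
      contrLeft N φ (LinearMap.lTensor B (contrLeft N ψ) (TensorProduct.assoc K B B N u)) =
        TensorProduct.lid K N (LinearMap.rTensor N (φ ∘ₗ contrRight ψ) u) := by
    intro u
    induction u using TensorProduct.induction_on with
    | zero => simp
    | add s t hs ht => simp only [map_add, hs, ht]
    | tmul b n =>
      induction b using TensorProduct.induction_on with
      | zero => simp
      | add s t hs ht => simp only [TensorProduct.add_tmul, map_add, hs, ht]
      | tmul b b' => simp [smul_smul, mul_comm]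
  change opr ρ ψ (contrLeft N φ (ρ n)) = contrLeft N (convForm φ ψ) (ρ n)
  rw [h1, ← hρ.coassoc, h2, ← LinearMap.comp_apply, ← LinearMap.rTensor_comp]
  rfl

/-- An invariant subspace of a rational representation. -/
def IsSubrep (ρ : N →ₗ[K] B ⊗[K] N) (W : Submodule K N) : Prop :=
  ∀ w ∈ W, ∀ φ : B →ₗ[K] K, opr ρ φ w ∈ W

theorem IsSubrep.mem_range {ρ : N →ₗ[K] B ⊗[K] N} {W : Submodule K N} (hW : IsSubrep ρ W) {w : N}
    (hw : w ∈ W) : ρ w ∈ LinearMap.range (LinearMap.lTensor B W.subtype) :=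
  mem_range_lTensor_subtype.2 (hW w hw)

theorem IsSubrep.sup {ρ : N →ₗ[K] B ⊗[K] N} {V W : Submodule K N} (hV : IsSubrep ρ V)
    (hW : IsSubrep ρ W) : IsSubrep ρ (V ⊔ W) := by
  intro w hw φ
  obtain ⟨v, hv, w, hw', rfl⟩ := Submodule.mem_sup.1 hw
  rw [map_add]
  exact Submodule.add_mem_sup (hV v hv φ) (hW w hw' φ)

/-- Rational representations are locally finite. -/
theorem IsCoaction.exists_finiteDimensional {ρ : N →ₗ[K] B ⊗[K] N} (hρ : IsCoaction ρ) (n : N) :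
    ∃ V : Submodule K N, FiniteDimensional K V ∧ IsSubrep ρ V ∧ n ∈ V := by
  -- the translates of `n` by the linear forms on `B`
  let T : (B →ₗ[K] K) →ₗ[K] N :=
    { toFun := fun φ => opr ρ φ n
      map_add' := fun φ ψ => by simp [opr, contrLeft, LinearMap.rTensor_add]
      map_smul' := fun c φ => by simp [opr, contrLeft, LinearMap.rTensor_smul] }
  refine ⟨LinearMap.range T, ?_, ?_, ⟨Coalgebra.counit, hρ.opr_counit n⟩⟩
  · obtain ⟨S, hS⟩ := TensorProduct.exists_finset (ρ n)
    have : FiniteDimensional K (Submodule.span K ((Prod.snd '' (S : Set (B × N))))) :=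
      FiniteDimensional.span_of_finite K (S.finite_toSet.image _)
    refine Submodule.finiteDimensional_of_le
      (S₂ := Submodule.span K ((Prod.snd '' (S : Set (B × N))))) ?_
    rintro _ ⟨φ, rfl⟩
    change contrLeft N φ (ρ n) ∈ _
    rw [hS, map_sum]
    refine Submodule.sum_mem _ fun i hi => ?_
    rw [contrLeft_tmul]
    exact Submodule.smul_mem _ _ (Submodule.subset_span ⟨i, hi, rfl⟩)
  · rintro _ ⟨φ, rfl⟩ ψ
    exact ⟨convForm φ ψ, (hρ.opr_opr φ ψ n).symm⟩

theorem lTensor_lTensor_assoc (l : N →ₗ[K] N') (u : (B ⊗[K] B) ⊗[K] N) :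
    LinearMap.lTensor B (LinearMap.lTensor B l) (TensorProduct.assoc K B B N u) =
      TensorProduct.assoc K B B N' (LinearMap.lTensor (B ⊗[K] B) l u) := by
  induction u using TensorProduct.induction_on with
  | zero => simp
  | add s t hs ht => simp only [map_add, hs, ht]
  | tmul b n =>
    induction b using TensorProduct.induction_on with
    | zero => simp
    | add s t hs ht => simp only [TensorProduct.add_tmul, map_add, hs, ht]
    | tmul b b' => simp

theorem IsCoaction.of_injective {ρ : N →ₗ[K] B ⊗[K] N} (hρ : IsCoaction ρ) {ι : N' →ₗ[K] N}
    (hι : Function.Injective ι) {ρ' : N' →ₗ[K] B ⊗[K] N'}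
    (hρ' : ∀ v, LinearMap.lTensor B ι (ρ' v) = ρ (ι v)) : IsCoaction ρ' where
  counit v := hι (by
    change ι (contrLeft _ Coalgebra.counit (ρ' v)) = ι v
    rw [← contrLeft_lTensor, hρ']
    exact hρ.counit _)
  coassoc v := by
    apply Module.Flat.lTensor_preserves_injective_linearMap (M := B) _
      (Module.Flat.lTensor_preserves_injective_linearMap (M := B) ι hι)
    have h2 : LinearMap.lTensor B ι ∘ₗ ρ' = ρ ∘ₗ ι := LinearMap.ext hρ'
    rw [lTensor_lTensor_assoc, ← LinearMap.comp_apply (LinearMap.lTensor (B ⊗[K] B) ι),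
      LinearMap.lTensor_comp_rTensor, ← LinearMap.rTensor_comp_lTensor, LinearMap.comp_apply, hρ',
      hρ.coassoc, ← LinearMap.comp_apply (LinearMap.lTensor B (LinearMap.lTensor B ι)),
      ← LinearMap.lTensor_comp, h2, LinearMap.lTensor_comp, LinearMap.comp_apply, hρ']

/-- A finite dimensional invariant subspace, in coordinates. -/
theorem IsCoaction.exists_coordinates {ρ : N →ₗ[K] B ⊗[K] N} (hρ : IsCoaction ρ)
    {V : Submodule K N} [FiniteDimensional K V] (hV : IsSubrep ρ V) :
    ∃ (n : ℕ) (ι : (Fin n → K) →ₗ[K] N) (ρ' : (Fin n → K) →ₗ[K] B ⊗[K] (Fin n → K)),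
      Function.Injective ι ∧ LinearMap.range ι = V ∧ IsCoaction ρ' ∧
      ∀ v, LinearMap.lTensor B ι (ρ' v) = ρ (ι v) := by
  let e : (Fin (Module.finrank K V) → K) ≃ₗ[K] V := (Module.finBasis K V).equivFun.symm
  let ι : (Fin (Module.finrank K V) → K) →ₗ[K] N := V.subtype ∘ₗ e.toLinearMap
  have hι : Function.Injective ι := V.injective_subtype.comp e.injective
  have hιr : LinearMap.range ι = V := by
    rw [LinearMap.range_comp, LinearEquiv.range, Submodule.map_top, Submodule.range_subtype]
  have hj : Function.Injective (LinearMap.lTensor B ι) :=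
    Module.Flat.lTensor_preserves_injective_linearMap ι hι
  have hmem : ∀ v, ρ (ι v) ∈ LinearMap.range (LinearMap.lTensor B ι) := by
    intro v
    have h := hV.mem_range (e v).2
    obtain ⟨s, hs⟩ := h
    refine ⟨LinearMap.lTensor B e.symm.toLinearMap s, ?_⟩
    rw [← LinearMap.comp_apply, ← LinearMap.lTensor_comp]
    have : ι ∘ₗ e.symm.toLinearMap = V.subtype := by ext; simp [ι]
    rw [this, hs]; rfl
  let ρ' : (Fin (Module.finrank K V) → K) →ₗ[K] B ⊗[K] (Fin (Module.finrank K V) → K) :=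
    (LinearEquiv.ofInjective _ hj).symm.toLinearMap ∘ₗ (ρ ∘ₗ ι).codRestrict _ hmem
  have hρ' : ∀ v, LinearMap.lTensor B ι (ρ' v) = ρ (ι v) := fun v =>
    congrArg Subtype.val ((LinearEquiv.ofInjective _ hj).apply_symm_apply ⟨ρ (ι v), hmem v⟩)
  exact ⟨_, ι, ρ', hι, hιr, hρ.of_injective hι hρ', hρ'⟩

/-- Complete reducibility of the finite dimensional invariant subspaces. -/
theorem IsCoaction.exists_complement (hB : IsLinearlyReductive K B) {ρ : N →ₗ[K] B ⊗[K] N}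
    (hρ : IsCoaction ρ) {V W : Submodule K N} [FiniteDimensional K V] (hV : IsSubrep ρ V)
    (hW : IsSubrep ρ W) (hWV : W ≤ V) :
    ∃ W' : Submodule K N, IsSubrep ρ W' ∧ W ⊓ W' = ⊥ ∧ W ⊔ W' = V := by
  obtain ⟨n, ι, ρ', hι, hιr, hρ', hιρ⟩ := hρ.exists_coordinates hV
  have hop : ∀ φ v, ι (opr ρ' φ v) = opr ρ φ (ι v) := fun φ v => by
    change ι (contrLeft _ φ (ρ' v)) = contrLeft _ φ (ρ (ι v))
    rw [← contrLeft_lTensor, hιρ]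
  obtain ⟨U, hU, hUs⟩ := hB n ρ' hρ'.counit hρ'.coassoc (W.comap ι) fun w hw =>
    mem_range_lTensor_subtype.2 fun φ => by
      change ι (opr ρ' φ w) ∈ W
      rw [hop]
      exact hW _ hw φ
  have hWm : (W.comap ι).map ι = W := by
    rw [Submodule.map_comap_eq, hιr, inf_eq_right.2 hWV]
  refine ⟨U.map ι, ?_, ?_, ?_⟩
  · rintro _ ⟨u, hu, rfl⟩ φ
    rw [← hop]
    exact ⟨_, mem_range_lTensor_subtype.1 (hUs u hu) φ, rfl⟩
  · rw [← hWm, ← Submodule.map_inf _ hι, hU.inf_eq_bot, Submodule.map_bot]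
  · rw [← hWm, ← Submodule.map_sup, hU.sup_eq_top, Submodule.map_top, hιr]

end Coaction

/-! ### The invariant integral of a linearly reductive group -/

section Integral

variable {K : Type*} [Field K] {B : Type*} [CommRing B] [HopfAlgebra K B]

theorem isCoaction_comul : IsCoaction (Coalgebra.comul (R := K) (A := B)) where
  counit n := by simp
  coassoc n := Coalgebra.coassoc_apply n

theorem opr_comul_one (φ : B →ₗ[K] K) : opr Coalgebra.comul φ (1 : B) = φ 1 • (1 : B) := by
  simp [opr, Algebra.TensorProduct.one_def]

/-- A linear form on `B` is an invariant form on the subspace `V` when `∫ f(g h) dh = ∫ f(h) dh` as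
functions of `g`, for `f ∈ V`. -/
def IsInvariantOn (μ : B →ₗ[K] K) (V : Submodule K B) : Prop :=
  ∀ v ∈ V, contrRight μ (Coalgebra.comul (R := K) v) = μ v • (1 : B)

theorem IsInvariantOn.map_opr {μ : B →ₗ[K] K} {V : Submodule K B} (hμ : IsInvariantOn μ V)
    {v : B} (hv : v ∈ V) (φ : B →ₗ[K] K) : μ (opr Coalgebra.comul φ v) = μ v * φ 1 := by
  change μ (contrLeft B φ _) = _
  rw [map_contrLeft, hμ v hv, map_smul, smul_eq_mul]

variable (hB : IsLinearlyReductive K B)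
include hB

/-- A complement of the constants in `V` is the kernel of an invariant form. -/
theorem exists_isInvariantOn {V : Submodule K B} [FiniteDimensional K V]
    (hV : IsSubrep (Coalgebra.comul (R := K)) V) (h1 : (1 : B) ∈ V) :
    ∃ μ : B →ₗ[K] K, IsInvariantOn μ V ∧ μ 1 = 1 := by
  have : Nontrivial B := nontrivial_of_ne (1 : B) 0 fun h => by
    have := congrArg (Coalgebra.counit (R := K)) h
    simp at this
  obtain ⟨W, hW, hinf, hsup⟩ := isCoaction_comul.exists_complement hB hV (W := K ∙ (1 : B))
    (fun w hw φ => by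
      obtain ⟨c, rfl⟩ := Submodule.mem_span_singleton.1 hw
      rw [map_smul, opr_comul_one]
      exact Submodule.smul_mem _ _ (Submodule.smul_mem _ _ (Submodule.mem_span_singleton_self _)))
    ((Submodule.span_singleton_le_iff_mem _ _).2 h1)
  have h1W : (1 : B) ∉ W := fun h => one_ne_zero (α := B) ((Submodule.mem_bot K).1
    (hinf ▸ ⟨Submodule.mem_span_singleton_self _, h⟩))
  obtain ⟨μ, hμ1, hμW⟩ := Submodule.exists_le_ker_of_notMem h1W
  have hμ0 : ∀ w ∈ W, μ w = 0 := fun w hw => hμW hw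
  refine ⟨(μ 1)⁻¹ • μ, ?_, by simp [hμ1]⟩
  intro v hv
  rw [← hsup] at hv
  obtain ⟨u, hu, w, hw, rfl⟩ := Submodule.mem_sup.1 hv
  obtain ⟨c, rfl⟩ := Submodule.mem_span_singleton.1 hu
  have hw0 : ∀ ν : B →ₗ[K] K, (∀ w ∈ W, ν w = 0) →
      contrRight ν (Coalgebra.comul (R := K) w) = 0 := by
    intro ν hν
    obtain ⟨s, hs⟩ := hW.mem_range hw
    have hz : ν ∘ₗ W.subtype = 0 := LinearMap.ext fun w => hν w w.2
    rw [← hs, contrRight, LinearMap.comp_apply, ← LinearMap.comp_apply (LinearMap.lTensor B ν),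
      ← LinearMap.lTensor_comp, hz]
    simp
  have hν : ∀ w ∈ W, ((μ 1)⁻¹ • μ) w = 0 := fun w hw => by simp [hμ0 w hw]
  rw [map_add, map_add, hw0 _ hν, map_add, hν w hw]
  simp [Algebra.TensorProduct.one_def, hμ1]

/-- The invariant form on an invariant subspace is determined by its value at `1`: a complement of
its kernel consists of invariant functions, that is, of constants. -/
theorem IsInvariantOn.eq_zero {V : Submodule K B} [FiniteDimensional K V]
    (hV : IsSubrep (Coalgebra.comul (R := K)) V) {μ : B →ₗ[K] K} (hμ : IsInvariantOn μ V)
    (hμ1 : μ 1 = 0) {v : B} (hv : v ∈ V) : μ v = 0 := by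
  obtain ⟨L, hL, hinf, hsup⟩ := isCoaction_comul.exists_complement hB hV (W := V ⊓ LinearMap.ker μ)
    (fun w hw φ => ⟨hV w hw.1 φ, by
      have h0 : μ w = 0 := hw.2
      rw [SetLike.mem_coe, LinearMap.mem_ker, hμ.map_opr hw.1, h0, zero_mul]⟩) inf_le_left
  have hLV : L ≤ V := hsup ▸ le_sup_right
  have hL0 : ∀ l ∈ L, l = 0 := by
    intro l hl
    have hl1 : ∀ φ : B →ₗ[K] K, opr Coalgebra.comul φ l = φ 1 • l := by
      intro φ
      have hm : opr Coalgebra.comul φ l - φ 1 • l ∈ L :=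
        L.sub_mem (hL l hl φ) (L.smul_mem _ hl)
      have hk : opr Coalgebra.comul φ l - φ 1 • l ∈ (V ⊓ LinearMap.ker μ) ⊓ L := by
        refine ⟨⟨hLV hm, ?_⟩, hm⟩
        rw [SetLike.mem_coe, LinearMap.mem_ker, map_sub, hμ.map_opr (hLV hl), map_smul, smul_eq_mul,
          mul_comm, sub_self]
      rw [hinf] at hk
      exact sub_eq_zero.1 hk
    have hl2 : l = Coalgebra.counit (R := K) l • (1 : B) := by
      rw [← sub_eq_zero, ← Module.forall_dual_apply_eq_zero_iff K]
      intro φ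
      have h := congrArg (Coalgebra.counit (R := K)) (hl1 φ)
      have h' : contrRight Coalgebra.counit (Coalgebra.comul (R := K) l) = l := by
        simp [contrRight]
      change Coalgebra.counit (R := K) (contrLeft B φ (Coalgebra.comul (R := K) l)) = _ at h
      rw [map_contrLeft, h', map_smul, smul_eq_mul] at h
      rw [map_sub, map_smul, h, smul_eq_mul, mul_comm, sub_self]
    have hk : l ∈ (V ⊓ LinearMap.ker μ) ⊓ L := by
      refine ⟨⟨hLV hl, ?_⟩, hl⟩
      rw [SetLike.mem_coe, LinearMap.mem_ker, hl2, map_smul, hμ1, smul_zero]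
    rw [hinf] at hk
    exact hk
  rw [← hsup] at hv
  obtain ⟨u, hu, l, hl, rfl⟩ := Submodule.mem_sup.1 hv
  rw [hL0 l hl, add_zero]
  exact hu.2

/-- A linearly reductive group carries an invariant integral. -/
theorem exists_integral : ∃ μ : B →ₗ[K] K, IsInvariantOn μ ⊤ ∧ μ 1 = 1 := by
  have hfin : ∀ b : B, ∃ V : Submodule K B, FiniteDimensional K V ∧
      IsSubrep (Coalgebra.comul (R := K)) V ∧ b ∈ V ∧ (1 : B) ∈ V := by
    intro b
    obtain ⟨V, hVf, hV, hb⟩ := isCoaction_comul.exists_finiteDimensional (K := K) b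
    obtain ⟨W, hWf, hW, h1⟩ := isCoaction_comul.exists_finiteDimensional (K := K) (1 : B)
    exact ⟨V ⊔ W, inferInstance, hV.sup hW, Submodule.mem_sup_left hb, Submodule.mem_sup_right h1⟩
  choose V hVf hV hbV h1V using hfin
  choose μ hμ hμ1 using fun b => exists_isInvariantOn hB (hV b) (h1V b)
  -- the invariant forms on the various invariant subspaces agree
  have key : ∀ (W : Submodule K B) [FiniteDimensional K W], IsSubrep (Coalgebra.comul (R := K)) W →
      ∀ ν : B →ₗ[K] K, IsInvariantOn ν W → ν 1 = 1 → (1 : B) ∈ W → ∀ b ∈ W, ν b = μ b b := by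
    intro W _ hW ν hν hν1 h1W b hb
    obtain ⟨τ, hτ, hτ1⟩ := exists_isInvariantOn hB (hW.sup (hV b)) (Submodule.mem_sup_left h1W)
    have hsub : ∀ (U : Submodule K B) [FiniteDimensional K U],
        IsSubrep (Coalgebra.comul (R := K)) U → U ≤ W ⊔ V b → ∀ σ : B →ₗ[K] K, IsInvariantOn σ U →
        σ 1 = 1 → b ∈ U → σ b = τ b := by
      intro U _ hU hle σ hσ hσ1 hbU
      have : IsInvariantOn (σ - τ) U := fun v hv => by
        have h1 := hσ v hv
        have h2 := hτ v (hle hv)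
        simp only [contrRight, LinearMap.lTensor_sub, LinearMap.comp_apply, LinearMap.sub_apply,
          map_sub, sub_smul] at h1 h2 ⊢
        rw [h1, h2]
      have := this.eq_zero hB hU (by simp [hσ1, hτ1]) hbU
      exact sub_eq_zero.1 this
    rw [hsub W hW le_sup_left ν hν hν1 hb, hsub (V b) (hV b) le_sup_right _ (hμ b) (hμ1 b) (hbV b)]
  let I : B →ₗ[K] K :=
    { toFun := fun b => μ b b
      map_add' := fun b c => by
        obtain ⟨τ, hτ, hτ1⟩ := exists_isInvariantOn hB ((hV b).sup (hV c))
          (Submodule.mem_sup_left (h1V b))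
        have h := key _ ((hV b).sup (hV c)) τ hτ hτ1 (Submodule.mem_sup_left (h1V b))
        have hb := Submodule.mem_sup_left (T := V c) (hbV b)
        have hc := Submodule.mem_sup_right (S := V b) (hbV c)
        rw [← h _ hb, ← h _ hc, ← h _ (Submodule.add_mem _ hb hc), map_add]
      map_smul' := fun a b => by
        have h := key _ (hV b) (μ b) (hμ b) (hμ1 b) (h1V b)
        rw [← h _ (Submodule.smul_mem _ a (hbV b)), map_smul]; rfl }
  refine ⟨I, fun b _ => ?_, hμ1 1⟩
  have hI : I ∘ₗ (V b).subtype = μ b ∘ₗ (V b).subtype := LinearMap.ext fun v =>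
    (key _ (hV b) (μ b) (hμ b) (hμ1 b) (h1V b) v v.2).symm
  have h : contrRight I (Coalgebra.comul (R := K) b) =
      contrRight (μ b) (Coalgebra.comul (R := K) b) := by
    obtain ⟨s, hs⟩ := (hV b).mem_range (hbV b)
    rw [← hs, contrRight, contrRight, LinearMap.comp_apply, LinearMap.comp_apply,
      ← LinearMap.comp_apply (LinearMap.lTensor B I),
      ← LinearMap.comp_apply (LinearMap.lTensor B (μ b)), ← LinearMap.lTensor_comp,
      ← LinearMap.lTensor_comp, hI]
  rw [h]
  exact hμ b b (hbV b)

end Integral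

section Antipode

variable {K : Type*} [Field K] {B : Type*} [CommRing B] [HopfAlgebra K B]

/-- The antipode reverses the comultiplication: `(g h)⁻¹ = h⁻¹ g⁻¹`. -/
theorem comul_antipode (b : B) : Coalgebra.comul (R := K) (HopfAlgebra.antipode K b) =
    Algebra.TensorProduct.lift
      ((Algebra.TensorProduct.includeRight : B →ₐ[K] B ⊗[K] B).comp (HopfAlgebra.antipodeAlgHom K B))
      ((Algebra.TensorProduct.includeLeft : B →ₐ[K] B ⊗[K] B).comp (HopfAlgebra.antipodeAlgHom K B))
      (fun _ _ => .all _ _) (Coalgebra.comul (R := K) b) := by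
  let l : WithConv (B →ₐ[K] B ⊗[K] B) := WithConv.toConv Algebra.TensorProduct.includeLeft
  let r : WithConv (B →ₐ[K] B ⊗[K] B) := WithConv.toConv Algebra.TensorProduct.includeRight
  have h1 : WithConv.toConv (Bialgebra.comulAlgHom K B) = l * r := by
    apply WithConv.ofConv_injective
    ext b
    change _ = (l * r) b
    rw [AlgHom.convMul_apply]
    have : Algebra.TensorProduct.lift l.ofConv r.ofConv (fun _ _ => .all _ _) =
        AlgHom.id K (B ⊗[K] B) := by ext <;> simp [l, r]
    rw [this]; rfl
  have h2 : (WithConv.toConv (Bialgebra.comulAlgHom K B))⁻¹ = r⁻¹ * l⁻¹ := by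
    rw [h1]
    exact mul_inv_rev l r
  have h3 := congrArg (fun φ : WithConv (B →ₐ[K] B ⊗[K] B) => φ b) h2
  simp only [AlgHom.convMul_apply] at h3
  exact h3

/-- Composing the invariant integral with the inversion of the group turns left invariance into
right invariance. -/
theorem IsInvariantOn.comp_antipode {μ : B →ₗ[K] K} (hμ : IsInvariantOn μ ⊤) (b : B) :
    contrLeft B (μ ∘ₗ HopfAlgebra.antipode K) (Coalgebra.comul (R := K) b) =
      μ (HopfAlgebra.antipode K b) • (1 : B) := by
  let φ : B →ₗ[K] K := μ ∘ₗ HopfAlgebra.antipode K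
  let E : B →ₗ[K] B := contrLeft B φ ∘ₗ Coalgebra.comul
  -- left invariance of `μ` at the inverse of a function
  have h1 : ∀ x, HopfAlgebra.antipode K (E x) = φ x • (1 : B) := by
    intro x
    have h := hμ (HopfAlgebra.antipode K x) trivial
    rw [comul_antipode] at h
    change _ = μ (HopfAlgebra.antipode K x) • (1 : B)
    rw [← h]
    change HopfAlgebra.antipode K (contrLeft B φ (Coalgebra.comul x)) = _
    generalize Coalgebra.comul (R := K) x = t
    induction t using TensorProduct.induction_on with
    | zero => simp
    | add s t hs ht => simp only [map_add, hs, ht]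
    | tmul b c => simp [φ]
  have h2 : Coalgebra.comul (R := K) (E b) = LinearMap.rTensor B E (Coalgebra.comul (R := K) b) := by
    have h3 : ∀ u : (B ⊗[K] B) ⊗[K] B, contrLeft (B ⊗[K] B) φ (TensorProduct.assoc K B B B u) =
        LinearMap.rTensor B (contrLeft B φ) u := by
      intro u
      induction u using TensorProduct.induction_on with
      | zero => simp
      | add s t hs ht => simp only [map_add, hs, ht]
      | tmul b n =>
        induction b using TensorProduct.induction_on with
        | zero => simp
        | add s t hs ht => simp only [TensorProduct.add_tmul, map_add, hs, ht]
        | tmul b b' => simp [TensorProduct.smul_tmul']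
    change Coalgebra.comul (contrLeft B φ (Coalgebra.comul b)) = _
    rw [← contrLeft_lTensor, ← Coalgebra.coassoc_apply, h3, LinearMap.rTensor_comp,
      LinearMap.comp_apply]
  have h4 : Coalgebra.counit (R := K) (E b) = φ b := by
    change Coalgebra.counit (R := K) (contrLeft B φ (Coalgebra.comul b)) = _
    rw [map_contrLeft]
    simp [contrRight]
  have h5 := HopfAlgebra.mul_antipode_rTensor_comul_apply (R := K) (E b)
  rw [h2, ← LinearMap.comp_apply (LinearMap.rTensor B _), ← LinearMap.rTensor_comp, h4,
    show HopfAlgebra.antipode K ∘ₗ E = φ.smulRight 1 from LinearMap.ext h1,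
    Algebra.algebraMap_eq_smul_one] at h5
  refine Eq.trans ?_ h5
  change contrLeft B φ _ = _
  generalize Coalgebra.comul (R := K) b = t
  induction t using TensorProduct.induction_on with
  | zero => simp
  | add s t hs ht => simp only [map_add, hs, ht]
  | tmul b c => simp

/-- The invariant integral, in the form in which it projects representations onto their invariants:
`∫ f(h g) dh = ∫ f(h) dh`. -/
theorem exists_right_integral (hB : IsLinearlyReductive K B) :
    ∃ φ : B →ₗ[K] K, φ 1 = 1 ∧
      ∀ b, contrLeft B φ (Coalgebra.comul (R := K) b) = φ b • (1 : B) := by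
  obtain ⟨μ, hμ, hμ1⟩ := exists_integral hB
  exact ⟨μ ∘ₗ HopfAlgebra.antipode K, by simp [hμ1], hμ.comp_antipode⟩

end Antipode

/-! ### The Reynolds operator and Hilbert's finiteness theorem -/

section Reynolds

variable {K : Type*} [Field K] {B : Type*} [CommRing B] [HopfAlgebra K B]
  {A : Type*} [CommRing A] [Algebra K A]

theorem AlgAction.isCoaction (α : AlgAction K B A) : IsCoaction α.coact.toLinearMap :=
  ⟨α.counit_coact, α.coassoc⟩

/-- The Reynolds operator, which averages a function over the group by means of an integral `φ`. -/
def AlgAction.reynolds (α : AlgAction K B A) (φ : B →ₗ[K] K) : A →ₗ[K] A :=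
  opr α.coact.toLinearMap φ

theorem AlgAction.mem_invariants (α : AlgAction K B A) {f : A} :
    f ∈ α.invariants ↔ α.coact f = 1 ⊗ₜ f := Iff.rfl

theorem AlgAction.reynolds_mem (α : AlgAction K B A) {φ : B →ₗ[K] K}
    (hφ : ∀ b, contrLeft B φ (Coalgebra.comul (R := K) b) = φ b • (1 : B)) (f : A) :
    α.reynolds φ f ∈ α.invariants := by
  rw [α.mem_invariants]
  refine tensor_ext_contrLeft fun ψ => ?_
  rw [contrLeft_tmul]
  change opr α.coact.toLinearMap ψ (opr α.coact.toLinearMap φ f) = _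
  rw [α.isCoaction.opr_opr]
  have : convForm φ ψ = ψ 1 • φ := by
    ext b
    change φ (contrRight ψ (Coalgebra.comul b)) = _
    rw [← map_contrLeft, hφ, map_smul, LinearMap.smul_apply, smul_eq_mul, smul_eq_mul, mul_comm]
  rw [this]
  simp [AlgAction.reynolds, opr, contrLeft, LinearMap.rTensor_smul]

theorem AlgAction.reynolds_mul (α : AlgAction K B A) (φ : B →ₗ[K] K) {g : A}
    (hg : g ∈ α.invariants) (f : A) : α.reynolds φ (f * g) = α.reynolds φ f * g := by
  change contrLeft A φ (α.coact (f * g)) = contrLeft A φ (α.coact f) * g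
  rw [map_mul, α.mem_invariants.1 hg]
  generalize α.coact f = t
  induction t using TensorProduct.induction_on with
  | zero => simp
  | add s t hs ht => simp only [add_mul, map_add, hs, ht]
  | tmul b a => simp

theorem AlgAction.reynolds_eq_self (α : AlgAction K B A) {φ : B →ₗ[K] K} (hφ1 : φ 1 = 1) {f : A}
    (hf : f ∈ α.invariants) : α.reynolds φ f = f := by
  change contrLeft A φ (α.coact f) = f
  rw [α.mem_invariants.1 hf, contrLeft_tmul, hφ1, one_smul]

theorem mul_mem_range_lTensor {U V W : Submodule K A} (h : ∀ p ∈ U, ∀ q ∈ V, p * q ∈ W)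
    {s t : B ⊗[K] A} (hs : s ∈ LinearMap.range (LinearMap.lTensor B U.subtype))
    (ht : t ∈ LinearMap.range (LinearMap.lTensor B V.subtype)) :
    s * t ∈ LinearMap.range (LinearMap.lTensor B W.subtype) := by
  obtain ⟨s, rfl⟩ := hs
  obtain ⟨t, rfl⟩ := ht
  induction s using TensorProduct.induction_on with
  | zero => simp
  | add s s' hs hs' =>
    rw [map_add, add_mul]
    exact Submodule.add_mem _ hs hs'
  | tmul b p =>
    induction t using TensorProduct.induction_on with
    | zero => simp
    | add s s' hs hs' =>
      rw [map_add, mul_add]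
      exact Submodule.add_mem _ hs hs'
    | tmul c q =>
      exact ⟨(b * c) ⊗ₜ ⟨p * q, h p p.2 q q.2⟩, by simp⟩

/-- An action on affine space that is linear on the coordinates preserves degrees. -/
theorem AlgAction.isSubrep_homogeneousSubmodule {n : ℕ}
    (σ : AlgAction K B (MvPolynomial (Fin n) K))
    (hσ : ∀ i, σ.coact (MvPolynomial.X i) ∈
      LinearMap.range (LinearMap.lTensor B (MvPolynomial.homogeneousSubmodule (Fin n) K 1).subtype))
    (d : ℕ) : IsSubrep σ.coact.toLinearMap (MvPolynomial.homogeneousSubmodule (Fin n) K d) := by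
  have hmul : ∀ i j : ℕ, ∀ p ∈ MvPolynomial.homogeneousSubmodule (Fin n) K i,
      ∀ q ∈ MvPolynomial.homogeneousSubmodule (Fin n) K j,
      p * q ∈ MvPolynomial.homogeneousSubmodule (Fin n) K (i + j) := fun i j p hp q hq => by
    rw [MvPolynomial.mem_homogeneousSubmodule] at *
    exact hp.mul hq
  have hone : (1 : B ⊗[K] MvPolynomial (Fin n) K) ∈ LinearMap.range
      (LinearMap.lTensor B (MvPolynomial.homogeneousSubmodule (Fin n) K 0).subtype) :=
    ⟨1 ⊗ₜ ⟨1, MvPolynomial.isHomogeneous_one _ _⟩, by simp [Algebra.TensorProduct.one_def]⟩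
  have hmon : ∀ s : Fin n →₀ ℕ, σ.coact (MvPolynomial.monomial s 1) ∈ LinearMap.range
      (LinearMap.lTensor B (MvPolynomial.homogeneousSubmodule (Fin n) K s.degree).subtype) := by
    intro s
    induction s using Finsupp.induction_linear with
    | zero =>
      rw [show (MvPolynomial.monomial (0 : Fin n →₀ ℕ) (1 : K)) = 1 from rfl, map_one, map_zero]
      exact hone
    | add s t hs ht =>
      have : (MvPolynomial.monomial (s + t) (1 : K)) =
          MvPolynomial.monomial s 1 * MvPolynomial.monomial t 1 := by
        rw [MvPolynomial.monomial_mul, one_mul]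
      rw [this, map_mul, map_add]
      exact mul_mem_range_lTensor (hmul _ _) hs ht
    | single i k =>
      rw [Finsupp.degree_single]
      have : MvPolynomial.monomial (Finsupp.single i k) (1 : K) = MvPolynomial.X i ^ k := by
        rw [MvPolynomial.X_pow_eq_monomial]
      rw [this, map_pow]
      clear this
      induction k with
      | zero => rw [pow_zero]; exact hone
      | succ k ih =>
        rw [pow_succ]
        exact mul_mem_range_lTensor (hmul _ _) ih (hσ i)
  intro p hp
  rw [MvPolynomial.mem_homogeneousSubmodule] at hp
  refine mem_range_lTensor_subtype.1 ?_
  rw [AlgHom.toLinearMap_apply, p.as_sum, map_sum]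
  refine Submodule.sum_mem _ fun s hs => ?_
  have hd : s.degree = d := by
    by_contra hne
    exact MvPolynomial.mem_support_iff.1 hs (hp.coeff_eq_zero hne)
  have : MvPolynomial.monomial s (p.coeff s) = p.coeff s • MvPolynomial.monomial s (1 : K) := by
    rw [MvPolynomial.smul_monomial, smul_eq_mul, mul_one]
  rw [this, map_smul, ← hd]
  exact Submodule.smul_mem _ _ (hmon s)

/-- Hilbert's finiteness theorem for linear actions. -/
theorem AlgAction.finiteType_invariants_mvPolynomial {n : ℕ}
    (σ : AlgAction K B (MvPolynomial (Fin n) K))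
    (hσ : ∀ i, σ.coact (MvPolynomial.X i) ∈
      LinearMap.range (LinearMap.lTensor B (MvPolynomial.homogeneousSubmodule (Fin n) K 1).subtype))
    {φ : B →ₗ[K] K} (hφ1 : φ 1 = 1)
    (hφ : ∀ b, contrLeft B φ (Coalgebra.comul (R := K) b) = φ b • (1 : B)) :
    Algebra.FiniteType K σ.invariants := by
  classical
  let T : Set (MvPolynomial (Fin n) K) :=
    {f | f ∈ σ.invariants ∧ ∃ d, 0 < d ∧ f.IsHomogeneous d}
  -- generators of the ideal spanned by the invariants of positive degree generate the invariants
  obtain ⟨t, htT, htspan⟩ := (Submodule.fg_span_iff_fg_span_finset_subset T).1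
    (IsNoetherian.noetherian (Ideal.span T))
  have hR : ∀ d, ∀ p : MvPolynomial (Fin n) K, p.IsHomogeneous d →
      (σ.reynolds φ p).IsHomogeneous d := fun d p hp =>
    σ.isSubrep_homogeneousSubmodule hσ d p hp φ
  have key : ∀ d, ∀ f ∈ σ.invariants, f.IsHomogeneous d →
      f ∈ Algebra.adjoin K (t : Set (MvPolynomial (Fin n) K)) := by
    intro d
    induction d using Nat.strong_induction_on with
    | _ d ih =>
      intro f hf hfd
      rcases Nat.eq_zero_or_pos d with rfl | hd
      · rw [← MvPolynomial.totalDegree_zero_iff_isHomogeneous,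
          MvPolynomial.totalDegree_eq_zero_iff_eq_C] at hfd
        rw [hfd]
        exact Subalgebra.algebraMap_mem _ _
      · have hfT : f ∈ Submodule.span (MvPolynomial (Fin n) K)
            (t : Set (MvPolynomial (Fin n) K)) := by
          rw [← htspan]
          exact Ideal.subset_span ⟨hf, d, hd, hfd⟩
        obtain ⟨a, -, ha⟩ := Submodule.mem_span_finset.1 hfT
        have hf1 : f = MvPolynomial.homogeneousComponent d f :=
          (MvPolynomial.homogeneousComponent_eq_self hfd).symm
        rw [← σ.reynolds_eq_self hφ1 hf, hf1, ← ha, map_sum, map_sum]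
        refine Subalgebra.sum_mem _ fun g hg => ?_
        obtain ⟨hgi, e, he, hge⟩ := htT hg
        rw [← MvPolynomial.sum_homogeneousComponent (a g), smul_eq_mul, Finset.sum_mul, map_sum,
          map_sum]
        refine Subalgebra.sum_mem _ fun k _ => ?_
        have hk : (MvPolynomial.homogeneousComponent k (a g) * g).IsHomogeneous (k + e) :=
          (MvPolynomial.homogeneousComponent_isHomogeneous k (a g)).mul hge
        rw [MvPolynomial.homogeneousComponent_of_mem hk]
        split_ifs with hkd
        · rw [σ.reynolds_mul φ hgi]
          exact Subalgebra.mul_mem _ (ih k (by omega) _ (σ.reynolds_mem hφ _)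
            (hR k _ (MvPolynomial.homogeneousComponent_isHomogeneous k (a g))))
            (Algebra.subset_adjoin hg)
        · rw [map_zero]
          exact Subalgebra.zero_mem _
  have hadj : Algebra.adjoin K (t : Set (MvPolynomial (Fin n) K)) = σ.invariants := by
    refine le_antisymm (Algebra.adjoin_le fun g hg => (htT hg).1) fun f hf => ?_
    rw [← σ.reynolds_eq_self hφ1 hf, ← MvPolynomial.sum_homogeneousComponent f, map_sum]
    exact Subalgebra.sum_mem _ fun d _ => key d _ (σ.reynolds_mem hφ _)
      (hR d _ (MvPolynomial.homogeneousComponent_isHomogeneous d f))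
  exact Subalgebra.fg_iff_finiteType _ |>.1 ⟨t, hadj⟩

noncomputable section

/-- The coordinates of a finite dimensional rational representation extend it to an action on affine
space. -/
def linearAction {n : ℕ} {ρ : (Fin n → K) →ₗ[K] B ⊗[K] (Fin n → K)} (hρ : IsCoaction ρ) :
    AlgAction K B (MvPolynomial (Fin n) K) :=
  let l : (Fin n → K) →ₗ[K] MvPolynomial (Fin n) K :=
    Fintype.linearCombination K MvPolynomial.X
  have hl : ∀ i, l (Pi.single i 1) = MvPolynomial.X i := fun i => by
    simp [l, Fintype.linearCombination_apply_single]
  let σ : MvPolynomial (Fin n) K →ₐ[K] B ⊗[K] MvPolynomial (Fin n) K :=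
    MvPolynomial.aeval fun i => LinearMap.lTensor B l (ρ (Pi.single i 1))
  have hσ : σ.toLinearMap ∘ₗ l = LinearMap.lTensor B l ∘ₗ ρ := by
    refine LinearMap.pi_ext' fun i => LinearMap.ext_ring ?_
    simp only [LinearMap.comp_apply, LinearMap.single_apply, hl]
    simp [σ]
  { coact := σ
    counit_coact := by
      let Ψ : MvPolynomial (Fin n) K →ₐ[K] MvPolynomial (Fin n) K :=
        ((Algebra.TensorProduct.lid K _).toAlgHom.comp (Algebra.TensorProduct.map
          (Bialgebra.counitAlgHom K B) (AlgHom.id K _))).comp σ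
      have hΨ : Ψ = AlgHom.id K _ := by
        ext1 i
        rw [← hl i]
        change contrLeft _ Coalgebra.counit ((σ.toLinearMap ∘ₗ l) (Pi.single i 1)) = _
        rw [hσ, LinearMap.comp_apply, contrLeft_lTensor]
        exact congrArg l (hρ.counit _)
      exact fun f => congrArg (fun Θ => Θ f) hΨ
    coassoc := by
      let Ψ₁ : MvPolynomial (Fin n) K →ₐ[K] B ⊗[K] (B ⊗[K] MvPolynomial (Fin n) K) :=
        ((Algebra.TensorProduct.assoc K K K B B _).toAlgHom.comp (Algebra.TensorProduct.map
          (Bialgebra.comulAlgHom K B) (AlgHom.id K _))).comp σ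
      let Ψ₂ : MvPolynomial (Fin n) K →ₐ[K] B ⊗[K] (B ⊗[K] MvPolynomial (Fin n) K) :=
        (Algebra.TensorProduct.map (AlgHom.id K B) σ).comp σ
      have hΨ : Ψ₁ = Ψ₂ := by
        ext1 i
        rw [← hl i]
        change TensorProduct.assoc K B B _ (LinearMap.rTensor _ Coalgebra.comul
          ((σ.toLinearMap ∘ₗ l) (Pi.single i 1))) = LinearMap.lTensor B σ.toLinearMap
            ((σ.toLinearMap ∘ₗ l) (Pi.single i 1))
        rw [hσ, LinearMap.comp_apply, ← LinearMap.comp_apply (LinearMap.rTensor _ _),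
          LinearMap.rTensor_comp_lTensor, ← LinearMap.lTensor_comp_rTensor, LinearMap.comp_apply,
          ← lTensor_lTensor_assoc, hρ.coassoc, ← LinearMap.comp_apply (LinearMap.lTensor B _),
          ← LinearMap.comp_apply (LinearMap.lTensor B _), ← LinearMap.lTensor_comp,
          ← LinearMap.lTensor_comp, hσ]
      exact fun f => congrArg (fun Θ => Θ f) hΨ }

end

theorem linearAction_coact_X {n : ℕ} {ρ : (Fin n → K) →ₗ[K] B ⊗[K] (Fin n → K)}
    (hρ : IsCoaction ρ) (i : Fin n) : (linearAction hρ).coact (MvPolynomial.X i) =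
      LinearMap.lTensor B (Fintype.linearCombination K (MvPolynomial.X (R := K)))
        (ρ (Pi.single i 1)) := by
  simp [linearAction]

/-- Hilbert's finiteness theorem: the invariants of a linearly reductive group acting on an affine
variety are finitely generated. The variety is embedded equivariantly into a representation. -/
theorem AlgAction.finiteType_invariants [Algebra.FiniteType K A] (α : AlgAction K B A)
    {φ : B →ₗ[K] K} (hφ1 : φ 1 = 1)
    (hφ : ∀ b, contrLeft B φ (Coalgebra.comul (R := K) b) = φ b • (1 : B)) :
    Algebra.FiniteType K α.invariants := by
  classical
  obtain ⟨s, hs⟩ := (inferInstance : Algebra.FiniteType K A).out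
  choose V hVf hV hmem using fun a : A => α.isCoaction.exists_finiteDimensional a
  obtain ⟨W, hWf, hW, hsW⟩ : ∃ W : Submodule K A, FiniteDimensional K W ∧
      IsSubrep α.coact.toLinearMap W ∧ (s : Set A) ⊆ W := by
    clear hs
    induction s using Finset.induction_on with
    | empty =>
      exact ⟨⊥, inferInstance, fun w hw φ => by
        rw [Submodule.mem_bot] at hw ⊢
        rw [hw, map_zero], by simp⟩
    | insert a s _ ih =>
      obtain ⟨W, hWf, hW, hsW⟩ := ih
      refine ⟨V a ⊔ W, inferInstance, (hV a).sup hW, ?_⟩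
      rw [Finset.coe_insert, Set.insert_subset_iff]
      exact ⟨Submodule.mem_sup_left (hmem a), fun x hx => Submodule.mem_sup_right (hsW hx)⟩
  obtain ⟨n, ι, ρ, hι, hιr, hρ, hιρ⟩ := α.isCoaction.exists_coordinates hW
  let σ := linearAction hρ
  let π : MvPolynomial (Fin n) K →ₐ[K] A := MvPolynomial.aeval fun i => ι (Pi.single i 1)
  have hπl : π.toLinearMap ∘ₗ Fintype.linearCombination K (MvPolynomial.X (R := K)) = ι := by
    refine LinearMap.pi_ext' fun i => LinearMap.ext_ring ?_
    simp [π, Fintype.linearCombination_apply_single]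
  have hπsurj : Function.Surjective π := by
    rw [← AlgHom.range_eq_top, ← top_le_iff, ← hs]
    refine Algebra.adjoin_le fun a ha => ?_
    have : a ∈ LinearMap.range ι := hιr ▸ hsW ha
    obtain ⟨v, rfl⟩ := this
    rw [← hπl]
    exact ⟨_, rfl⟩
  have hequiv : ∀ p, LinearMap.lTensor B π.toLinearMap (σ.coact p) = α.coact (π p) := by
    have : (Algebra.TensorProduct.map (AlgHom.id K B) π).comp σ.coact = α.coact.comp π := by
      ext1 i
      change LinearMap.lTensor B π.toLinearMap (σ.coact (MvPolynomial.X i)) = _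
      rw [linearAction_coact_X, ← LinearMap.comp_apply (LinearMap.lTensor B _),
        ← LinearMap.lTensor_comp, hπl, hιρ]
      simp [π]
    exact fun p => congrArg (fun Θ => Θ p) this
  have hfin := σ.finiteType_invariants_mvPolynomial (fun i => by
    rw [linearAction_coact_X]
    refine mem_range_lTensor_subtype.2 fun ψ => ?_
    rw [contrLeft_lTensor, Fintype.linearCombination_apply]
    exact Submodule.sum_mem _ fun j _ => Submodule.smul_mem _ _
      (MvPolynomial.isHomogeneous_X K j)) hφ1 hφ
  let πG : σ.invariants →ₐ[K] α.invariants :=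
    (π.comp σ.invariants.val).codRestrict α.invariants fun p => by
      rw [α.mem_invariants]
      change α.coact (π p) = 1 ⊗ₜ π p
      rw [← hequiv, σ.mem_invariants.1 p.2]
      simp
  refine Algebra.FiniteType.of_surjective πG fun a => ?_
  obtain ⟨p, hp⟩ := hπsurj a
  refine ⟨⟨σ.reynolds φ p, σ.reynolds_mem hφ p⟩, Subtype.ext ?_⟩
  change π (contrLeft _ φ (σ.coact p)) = a
  have h := contrLeft_lTensor φ π.toLinearMap (σ.coact p)
  rw [hequiv, hp] at h
  exact h.symm.trans (α.reynolds_eq_self hφ1 a.2)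

end Reynolds

/-! ### The coordinate ring of the categorical quotient -/

section QuotientRing

variable {K : Type*} [Field K] {B : Type*} [CommRing B] [HopfAlgebra K B]
  {A : Type*} [CommRing A] [Algebra K A] [Algebra B A] [IsScalarTower K B A]

/-- The inverse of a point of the group. -/
noncomputable def pointInv {Ω : Type*} [Field Ω] [Algebra K Ω] (g : WithConv (B →ₐ[K] Ω)) :
    WithConv (B →ₐ[K] Ω) :=
  WithConv.toConv (g.ofConv.comp (HopfAlgebra.antipodeAlgHom K B))

theorem mul_pointInv {Ω : Type*} [Field Ω] [Algebra K Ω] (g : WithConv (B →ₐ[K] Ω)) :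
    g * pointInv g = 1 := by
  have h := AlgHom.comp_convMul_distrib g.ofConv (WithConv.toConv (AlgHom.id K B))
    (WithConv.toConv (HopfAlgebra.antipodeAlgHom K B))
  have h1 : WithConv.toConv (AlgHom.id K B) * WithConv.toConv (HopfAlgebra.antipodeAlgHom K B) =
      1 := mul_inv_cancel (WithConv.toConv (AlgHom.id K B))
  rw [h1] at h
  apply WithConv.ofConv_injective
  refine h.symm.trans ?_
  ext b
  simp [AlgHom.convOne_def]

theorem pointInv_mul {Ω : Type*} [Field Ω] [Algebra K Ω] (g : WithConv (B →ₐ[K] Ω)) :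
    pointInv g * g = 1 := by
  have h := AlgHom.comp_convMul_distrib g.ofConv
    (WithConv.toConv (HopfAlgebra.antipodeAlgHom K B)) (WithConv.toConv (AlgHom.id K B))
  have h1 : WithConv.toConv (HopfAlgebra.antipodeAlgHom K B) * WithConv.toConv (AlgHom.id K B) =
      1 := inv_mul_cancel (WithConv.toConv (AlgHom.id K B))
  rw [h1] at h
  apply WithConv.ofConv_injective
  refine h.symm.trans ?_
  ext b
  simp [AlgHom.convOne_def]

/-- The momentum mapping is equivariant on points. -/
theorem phiPoint_act {α : AlgAction K B A} (hα : AlgEquivariant α) {Ω : Type*} [Field Ω]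
    [Algebra K Ω] (g : WithConv (B →ₐ[K] Ω)) (p : A →ₐ[K] Ω) :
    phiPoint K B A (α.act g p) = g * phiPoint K B A p * pointInv g := by
  let h : B ⊗[K] B →ₐ[K] Ω := Algebra.TensorProduct.productMap g.ofConv (phiPoint K B A p).ofConv
  have h1 : phiPoint K B A (α.act g p) = WithConv.toConv (h.comp (conjCoact K B)) := by
    apply WithConv.ofConv_injective
    ext b
    change Algebra.TensorProduct.productMap g.ofConv p (α.coact (algebraMap B A b)) =
      h (conjCoact K B b)
    rw [hα b]
    generalize conjCoact K B b = t
    induction t using TensorProduct.induction_on with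
    | zero => simp
    | add s t hs ht => simp only [map_add, hs, ht]
    | tmul b c => simp [h, phiPoint]
  have hl : WithConv.toConv (h.comp Algebra.TensorProduct.includeLeft) = g := by
    apply WithConv.ofConv_injective; ext b; simp [h]
  have hr : WithConv.toConv (h.comp Algebra.TensorProduct.includeRight) = phiPoint K B A p := by
    apply WithConv.ofConv_injective; ext b; simp [h]
  rw [h1, conjCoact, AlgHom.comp_convMul_distrib, AlgHom.comp_convMul_distrib]
  change WithConv.toConv (h.comp Algebra.TensorProduct.includeLeft) *
    WithConv.toConv (h.comp Algebra.TensorProduct.includeRight) *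
    pointInv (WithConv.toConv (h.comp Algebra.TensorProduct.includeLeft)) = _
  rw [hl, hr]

theorem act_mem_level {α : AlgAction K B A} (hα : AlgEquivariant α) {Ω : Type*} [Field Ω]
    [Algebra K Ω] {C : ConjClasses (WithConv (B →ₐ[K] Ω))} (g : WithConv (B →ₐ[K] Ω))
    {p : A →ₐ[K] Ω} (hp : phiPoint K B A p ∈ C.carrier) :
    phiPoint K B A (α.act g p) ∈ C.carrier := by
  rw [phiPoint_act hα, ConjClasses.mem_carrier_iff_mk_eq] at *
  rw [← hp]
  refine ConjClasses.mk_eq_mk_iff_isConj.2 (IsConj.symm ⟨⟨g, pointInv g, mul_pointInv g,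
    pointInv_mul g⟩, ?_⟩)
  change g * _ = g * _ * pointInv g * g
  rw [mul_assoc (g * _), pointInv_mul, mul_one]

/-- The restriction of invariant functions to the level set. -/
def AlgAction.restrictQuotientRing (α : AlgAction K B A)
    (C : ConjClasses (WithConv (B →ₐ[K] K))) : α.invariants →ₐ[K] α.quotientRing C :=
  AlgHom.codRestrict
    (AlgHom.comp
      ({ toFun := fun f p => p.1 f
         map_one' := by ext; simp
         map_mul' := fun _ _ => by ext; simp
         map_zero' := by ext; simp
         map_add' := fun _ _ => by ext; simp
         commutes' := fun _ => by ext; simp } : A →ₐ[K] (AlgLevel A C → K)) α.invariants.val)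
    (α.quotientRing C) fun f => ⟨⟨f, fun _ => rfl⟩, fun _ _ h => α.eq_of_sameOrbit h f.2⟩

theorem AlgAction.ker_restrictQuotientRing (α : AlgAction K B A)
    (C : ConjClasses (WithConv (B →ₐ[K] K))) :
    RingHom.ker (α.restrictQuotientRing C) = α.vanishingIdeal C := by
  ext f
  rw [RingHom.mem_ker]
  exact ⟨fun h p => congrFun (congrArg Subtype.val h) p, fun h => Subtype.ext (funext h)⟩

/-- Each invariant regular function on the level set is the restriction of the average of any of its
extensions. -/
theorem AlgAction.restrictQuotientRing_surjective [IsAlgClosed K] [Algebra.FiniteType K B]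
    [IsReduced B] {α : AlgAction K B A} (hα : AlgEquivariant α)
    {φ : B →ₗ[K] K} (hφ1 : φ 1 = 1)
    (hφ : ∀ b, contrLeft B φ (Coalgebra.comul (R := K) b) = φ b • (1 : B))
    (C : ConjClasses (WithConv (B →ₐ[K] K))) :
    Function.Surjective (α.restrictQuotientRing C) := by
  rintro ⟨u, ⟨f, hf⟩, hu⟩
  refine ⟨⟨α.reynolds φ f, α.reynolds_mem hφ f⟩, Subtype.ext (funext fun p => ?_)⟩
  change p.1 (contrLeft A φ (α.coact f)) = u p
  have h1 := map_contrLeft φ p.1.toLinearMap (α.coact f)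
  -- the function `g ↦ f (g p)` on the group is constant
  have h2 : contrRight p.1.toLinearMap (α.coact f) = algebraMap K B (u p) := by
    rw [← sub_eq_zero, ← isNilpotent_iff_eq_zero]
    refine isNilpotent_of_forall_algHom (k := K) fun g => ?_
    rw [map_sub, g.commutes, sub_eq_zero]
    let q : AlgLevel A C := ⟨α.act (WithConv.toConv g) p.1, act_mem_level hα _ p.2⟩
    have h3 : u p = u q := hu p q ⟨WithConv.toConv g, rfl⟩
    have h4 : q.1 f = g (contrRight p.1.toLinearMap (α.coact f)) := by
      change Algebra.TensorProduct.productMap g p.1 (α.coact f) = _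
      generalize α.coact f = t
      induction t using TensorProduct.induction_on with
      | zero => simp
      | add s t hs ht => simp only [map_add, hs, ht]
      | tmul b a => simp [mul_comm]
    rw [← h4, ← hf q, h3]; rfl
  rw [h2, Algebra.algebraMap_eq_smul_one, map_smul, hφ1, smul_eq_mul, mul_one] at h1
  exact h1

/-- For a linearly reductive group over an algebraically closed field, the invariant regular functions
on the level set are the restrictions of the invariant functions, and they are finitely generated. -/
theorem AlgAction.exists_quotientRing [IsAlgClosed K] [Algebra.FiniteType K B] [IsReduced B]
    [Algebra.FiniteType K A] (hB : IsLinearlyReductive K B) {α : AlgAction K B A}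
    (hα : AlgEquivariant α) (C : ConjClasses (WithConv (B →ₐ[K] K))) :
    Algebra.FiniteType K (α.quotientRing C) ∧
      ∃ e : (α.invariants ⧸ α.vanishingIdeal C) ≃ₐ[K] α.quotientRing C,
        ∀ (f : α.invariants) (p : AlgLevel A C), (e (Ideal.Quotient.mk _ f)).1 p = p.1 (f : A) := by
  obtain ⟨φ, hφ1, hφ⟩ := exists_right_integral hB
  have hsurj := AlgAction.restrictQuotientRing_surjective hα hφ1 hφ C
  have := α.finiteType_invariants hφ1 hφ
  refine ⟨Algebra.FiniteType.of_surjective _ hsurj,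
    (Ideal.quotientEquivAlgOfEq K (α.ker_restrictQuotientRing C).symm).trans
      (Ideal.quotientKerAlgEquivOfSurjective hsurj), fun f p => rfl⟩

end QuotientRing

/-! ### Vector fields as derivations -/

section VectorFields

open scoped Topology
open VectorField

variable {𝕜 : Type*} [RCLike 𝕜]
  {EM : Type*} [NormedAddCommGroup EM] [NormedSpace 𝕜 EM]
  {M : Type*} [TopologicalSpace M] [ChartedSpace EM M]
  {F : Type*} [NormedAddCommGroup F] [NormedSpace 𝕜 F]
  {n : WithTop ℕ∞}

theorem smoothness_add_one {n : WithTop ℕ∞} (hn : n = ∞ ∨ n = ω) : n + 1 ≤ n := by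
  rcases hn with rfl | rfl
  · exact le_rfl
  · exact le_top

/-- The derivative of a `C^n` function along a `C^n` vector field is of class `C^n`; there is no loss
of derivatives, since `n` is `∞` or `ω`. -/
theorem contMDiffOn_mvfderiv_apply [IsManifold 𝓘(𝕜, EM) 1 M] [IsManifold 𝓘(𝕜, EM) n M]
    (hn : n = ∞ ∨ n = ω) {U : Set M} (hU : IsOpen U) {X : ∀ x : M, TangentSpace 𝓘(𝕜, EM) x}
    (hX : IsVectorFieldOn n X U) {u : M → F} (hu : ContMDiffOn 𝓘(𝕜, EM) 𝓘(𝕜, F) n u U) :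
    ContMDiffOn 𝓘(𝕜, EM) 𝓘(𝕜, F) n (fun x => mvfderiv 𝓘(𝕜, EM) u x (X x)) U := by
  have h1 := hu.contMDiffOn_tangentMapWithin (smoothness_add_one hn) hU.uniqueMDiffOn
  have h2 := (contMDiff_snd_tangentBundle_modelSpace F 𝓘(𝕜, F) (n := n)).comp_contMDiffOn
    (h1.comp hX fun x hx => hx)
  refine h2.congr fun x hx => ?_
  change mvfderiv 𝓘(𝕜, EM) u x (X x) = mfderivWithin 𝓘(𝕜, EM) 𝓘(𝕜, F) u U x (X x)
  rw [mfderivWithin_of_isOpen hU hx]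
  rfl

/-- The vector field `X` in the chart at `x₀`. -/
noncomputable def chartField (x₀ : M) (X : ∀ x : M, TangentSpace 𝓘(𝕜, EM) x) : EM → EM :=
  mpullback 𝓘(𝕜, EM) 𝓘(𝕜, EM) (extChartAt 𝓘(𝕜, EM) x₀).symm X

theorem contMDiffAt_extChartAt_symm_of_mem [IsManifold 𝓘(𝕜, EM) n M] (x₀ : M) {z : EM}
    (hz : z ∈ (extChartAt 𝓘(𝕜, EM) x₀).target) :
    ContMDiffAt 𝓘(𝕜, EM) 𝓘(𝕜, EM) n (extChartAt 𝓘(𝕜, EM) x₀).symm z :=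
  (contMDiffOn_extChartAt_symm x₀).contMDiffAt ((isOpen_extChartAt_target x₀).mem_nhds hz)

theorem isInvertible_extChartAt_symm [IsManifold 𝓘(𝕜, EM) 1 M] (x₀ : M) {z : EM}
    (hz : z ∈ (extChartAt 𝓘(𝕜, EM) x₀).target) :
    (mfderiv 𝓘(𝕜, EM) 𝓘(𝕜, EM) (extChartAt 𝓘(𝕜, EM) x₀).symm z).IsInvertible := by
  have := isInvertible_mfderivWithin_extChartAt_symm hz
  simpa [mfderivWithin_univ] using this

variable [IsManifold 𝓘(𝕜, EM) 1 M] [IsManifold 𝓘(𝕜, EM) n M]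

theorem contDiffAt_chartField [CompleteSpace EM] (hn : n = ∞ ∨ n = ω) (x₀ : M) {z : EM}
    (hz : z ∈ (extChartAt 𝓘(𝕜, EM) x₀).target) {U : Set M} (hU : IsOpen U)
    {X : ∀ x : M, TangentSpace 𝓘(𝕜, EM) x} (hX : IsVectorFieldOn n X U)
    (hzU : (extChartAt 𝓘(𝕜, EM) x₀).symm z ∈ U) : ContDiffAt 𝕜 n (chartField x₀ X) z := by
  have h1 : ContMDiffAt 𝓘(𝕜, EM) 𝓘(𝕜, EM).tangent n
      (fun y => (⟨y, X y⟩ : TangentBundle 𝓘(𝕜, EM) M)) ((extChartAt 𝓘(𝕜, EM) x₀).symm z) :=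
    hX.contMDiffAt (hU.mem_nhds hzU)
  exact contMDiffAt_vectorSpace_iff_contDiffAt.1 (h1.mpullback_vectorField_preimage
    (contMDiffAt_extChartAt_symm_of_mem x₀ hz)
    (isInvertible_extChartAt_symm x₀ hz) (smoothness_add_one hn))

/-- The derivative of a function along a vector field can be computed in any chart. -/
theorem fderiv_comp_chart_apply (hn : 1 ≤ n) (x₀ : M) {z : EM}
    (hz : z ∈ (extChartAt 𝓘(𝕜, EM) x₀).target) {u : M → F}
    (hu : MDifferentiableAt 𝓘(𝕜, EM) 𝓘(𝕜, F) u ((extChartAt 𝓘(𝕜, EM) x₀).symm z))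
    (X : ∀ x : M, TangentSpace 𝓘(𝕜, EM) x) :
    fderiv 𝕜 (u ∘ (extChartAt 𝓘(𝕜, EM) x₀).symm) z (chartField x₀ X z) =
      mvfderiv 𝓘(𝕜, EM) u ((extChartAt 𝓘(𝕜, EM) x₀).symm z)
        (X ((extChartAt 𝓘(𝕜, EM) x₀).symm z)) := by
  have h1 : MDifferentiableAt 𝓘(𝕜, EM) 𝓘(𝕜, EM) (extChartAt 𝓘(𝕜, EM) x₀).symm z :=
    (contMDiffAt_extChartAt_symm_of_mem (n := n) x₀ hz).mdifferentiableAt (by positivity)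
  have h2 := mfderiv_comp_apply z hu h1 (chartField (EM := EM) x₀ X z)
  refine (congrArg (fun A : EM →L[𝕜] F => A (chartField x₀ X z)) mfderiv_eq_fderiv).symm.trans
    (h2.trans ?_)
  have hA : ContinuousLinearMap.IsInvertible (show EM →L[𝕜] EM from
    mfderiv 𝓘(𝕜, EM) 𝓘(𝕜, EM) (extChartAt 𝓘(𝕜, EM) x₀).symm z) := isInvertible_extChartAt_symm x₀ hz
  have h3 := hA.self_apply_inverse (X ((extChartAt 𝓘(𝕜, EM) x₀).symm z))
  exact congrArg (mfderiv 𝓘(𝕜, EM) 𝓘(𝕜, F) u ((extChartAt 𝓘(𝕜, EM) x₀).symm z)) h3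

/-- The Lie bracket of vector fields is the commutator of the corresponding derivations, at a point
of the domain of the chart at `x₀`: in the chart, the second derivatives cancel by symmetry. -/
theorem mvfderiv_mlieBracket_chart [CompleteSpace EM] (hn : n = ∞ ∨ n = ω) {U : Set M}
    (hU : IsOpen U) (x₀ : M) {z : EM} (hz : z ∈ (extChartAt 𝓘(𝕜, EM) x₀).target) {f : EM → M}
    (hf : f = ⇑(extChartAt 𝓘(𝕜, EM) x₀).symm) (hx : f z ∈ U)
    {X Y : ∀ x : M, TangentSpace 𝓘(𝕜, EM) x} (hX : IsVectorFieldOn n X U)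
    (hY : IsVectorFieldOn n Y U) {u : M → F} (hu : ContMDiffOn 𝓘(𝕜, EM) 𝓘(𝕜, F) n u U) :
    mvfderiv 𝓘(𝕜, EM) u (f z) (mlieBracket 𝓘(𝕜, EM) X Y (f z)) =
      mvfderiv 𝓘(𝕜, EM) (fun y => mvfderiv 𝓘(𝕜, EM) u y (Y y)) (f z) (X (f z)) -
        mvfderiv 𝓘(𝕜, EM) (fun y => mvfderiv 𝓘(𝕜, EM) u y (X y)) (f z) (Y (f z)) := by
  have h1n : 1 ≤ n := one_le_smoothness hn
  have : IsManifold 𝓘(𝕜, EM) (minSmoothness 𝕜 3) M := .of_le (minSmoothness_le 𝕜 hn)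
  subst hf
  set f : EM → M := ⇑(extChartAt 𝓘(𝕜, EM) x₀).symm with hf
  have hfd : ∀ w ∈ (extChartAt 𝓘(𝕜, EM) x₀).target, ContMDiffAt 𝓘(𝕜, EM) 𝓘(𝕜, EM) n f w :=
    fun w hw => contMDiffAt_extChartAt_symm_of_mem x₀ hw
  have hud : ∀ w ∈ U, ContMDiffAt 𝓘(𝕜, EM) 𝓘(𝕜, F) n u w := fun w hw =>
    hu.contMDiffAt (hU.mem_nhds hw)
  have hbr : mpullback 𝓘(𝕜, EM) 𝓘(𝕜, EM) f (mlieBracket 𝓘(𝕜, EM) X Y) z =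
      lieBracket 𝕜 (chartField x₀ X) (chartField x₀ Y) z := by
    have hXd : MDifferentiableAt 𝓘(𝕜, EM) 𝓘(𝕜, EM).tangent
        (fun y => (⟨y, X y⟩ : TangentBundle 𝓘(𝕜, EM) M)) (f z) :=
      (hX.contMDiffAt (hU.mem_nhds hx)).mdifferentiableAt (by positivity)
    have hYd : MDifferentiableAt 𝓘(𝕜, EM) 𝓘(𝕜, EM).tangent
        (fun y => (⟨y, Y y⟩ : TangentBundle 𝓘(𝕜, EM) M)) (f z) :=
      (hY.contMDiffAt (hU.mem_nhds hx)).mdifferentiableAt (by positivity)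
    rw [mpullback_mlieBracket hXd hYd (hfd z hz) ((minSmoothness_monotone (by norm_num)).trans
      (minSmoothness_le 𝕜 hn)), ← mlieBracketWithin_univ, mlieBracketWithin_eq_lieBracketWithin]
    change lieBracketWithin 𝕜 (chartField x₀ X) (chartField x₀ Y) Set.univ z = _
    rw [lieBracketWithin_univ]
  -- the functions and their derivatives in the chart
  let w : EM → F := u ∘ f
  have hev : ∀ᶠ y in 𝓝 z, y ∈ (extChartAt 𝓘(𝕜, EM) x₀).target ∧ f y ∈ U :=
    Filter.Eventually.and (show ∀ᶠ y in 𝓝 z, y ∈ (extChartAt 𝓘(𝕜, EM) x₀).target from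
        (isOpen_extChartAt_target x₀).mem_nhds hz)
      ((hfd z hz).continuousAt.preimage_mem_nhds (hU.mem_nhds hx))
  have hder : ∀ (Z : ∀ x : M, TangentSpace 𝓘(𝕜, EM) x),
      ((fun y => mvfderiv 𝓘(𝕜, EM) u y (Z y)) ∘ f) =ᶠ[𝓝 z]
        fun y => fderiv 𝕜 w y (chartField x₀ Z y) := by
    intro Z
    filter_upwards [hev] with y hy
    exact (fderiv_comp_chart_apply h1n x₀ hy.1
      ((hud _ hy.2).mdifferentiableAt (by positivity)) Z).symm
  have hw : ContDiffAt 𝕜 n w z :=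
    (ContMDiffAt.comp z (hud _ hx) (hfd z hz)).contDiffAt
  have hdw : DifferentiableAt 𝕜 (fderiv 𝕜 w) z :=
    (hw.fderiv_right (m := n) (smoothness_add_one hn)).differentiableAt (by positivity)
  have h2nd : ∀ (Y Z : ∀ x : M, TangentSpace 𝓘(𝕜, EM) x), IsVectorFieldOn n Y U →
      mvfderiv 𝓘(𝕜, EM) (fun y => mvfderiv 𝓘(𝕜, EM) u y (Y y)) (f z) (Z (f z)) =
      fderiv 𝕜 (fderiv 𝕜 w) z (chartField x₀ Z z) (chartField x₀ Y z) +
        fderiv 𝕜 w z (fderiv 𝕜 (chartField x₀ Y) z (chartField x₀ Z z)) := by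
    intro Y Z hY
    have hYd : DifferentiableAt 𝕜 (chartField x₀ Y) z :=
      (contDiffAt_chartField hn x₀ hz hU hY hx).differentiableAt (by positivity)
    rw [← fderiv_comp_chart_apply h1n x₀ hz (((contMDiffOn_mvfderiv_apply hn hU hY hu).contMDiffAt
      (hU.mem_nhds hx)).mdifferentiableAt (by positivity)) Z]
    rw [(hder Y).fderiv_eq, fderiv_clm_apply hdw hYd]
    simp [add_comm]
  rw [h2nd Y X hY, h2nd X Y hX,
    ← fderiv_comp_chart_apply h1n x₀ hz ((hud _ hx).mdifferentiableAt (by positivity))]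
  change fderiv 𝕜 w z (mpullback 𝓘(𝕜, EM) 𝓘(𝕜, EM) f (mlieBracket 𝓘(𝕜, EM) X Y) z) = _
  have hsymm := hw.isSymmSndFDerivAt ((minSmoothness_monotone (by norm_num)).trans
      (minSmoothness_le 𝕜 hn))
  rw [hbr, lieBracket, map_sub, hsymm.eq (chartField x₀ X z) (chartField x₀ Y z)]
  abel

/-- The Lie bracket of vector fields is the commutator of the corresponding derivations. -/
theorem mvfderiv_mlieBracket [CompleteSpace EM] (hn : n = ∞ ∨ n = ω) {U : Set M} (hU : IsOpen U)
    {x : M} (hx : x ∈ U) {X Y : ∀ x : M, TangentSpace 𝓘(𝕜, EM) x} (hX : IsVectorFieldOn n X U)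
    (hY : IsVectorFieldOn n Y U) {u : M → F} (hu : ContMDiffOn 𝓘(𝕜, EM) 𝓘(𝕜, F) n u U) :
    mvfderiv 𝓘(𝕜, EM) u x (mlieBracket 𝓘(𝕜, EM) X Y x) =
      mvfderiv 𝓘(𝕜, EM) (fun y => mvfderiv 𝓘(𝕜, EM) u y (Y y)) x (X x) -
        mvfderiv 𝓘(𝕜, EM) (fun y => mvfderiv 𝓘(𝕜, EM) u y (X y)) x (Y x) := by
  have hxx := extChartAt_to_inv (I := 𝓘(𝕜, EM)) x
  have h := mvfderiv_mlieBracket_chart hn hU x (mem_extChartAt_target x) rfl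
    (by rwa [hxx]) hX hY hu
  rwa [hxx] at h

end VectorFields

/-! ### The Poisson bracket on a manifold -/

section ManifoldBracket

open scoped Topology
open VectorField

variable {𝕜 : Type*} [RCLike 𝕜]
  {EM : Type*} [NormedAddCommGroup EM] [NormedSpace 𝕜 EM]
  {M : Type*} [TopologicalSpace M] [ChartedSpace EM M]
  {n : WithTop ℕ∞}

theorem mvfderiv_congr {u v : M → 𝕜} {x : M} (h : u =ᶠ[𝓝 x] v) :
    mvfderiv 𝓘(𝕜, EM) u x = mvfderiv 𝓘(𝕜, EM) v x := by
  have := h.mfderiv_eq (I := 𝓘(𝕜, EM)) (I' := 𝓘(𝕜))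
  exact this

variable (𝕜 EM M) in
/-- The algebra of the functions that are of class `C^n` on `U`, defined on all of `M`. -/
def functionsOn (n : WithTop ℕ∞) (U : Set M) : Subalgebra 𝕜 (M → 𝕜) where
  carrier := {u | ContMDiffOn 𝓘(𝕜, EM) 𝓘(𝕜) n u U}
  mul_mem' hu hv := ContMDiffOn.mul hu hv
  add_mem' hu hv := ContMDiffOn.add hu hv
  algebraMap_mem' _ := contMDiffOn_const

theorem functionsOn_mdifferentiableAt (hn : 1 ≤ n) {U : Set M} (hU : IsOpen U)
    (u : functionsOn 𝕜 EM M n U) {x : M} (hx : x ∈ U) :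
    MDifferentiableAt 𝓘(𝕜, EM) 𝓘(𝕜) u.1 x :=
  (ContMDiffOn.contMDiffAt u.2 (hU.mem_nhds hx)).mdifferentiableAt (by positivity)

open Classical in
/-- The derivation of `functionsOn` given by a vector field; outside `U`, where the elements of
`functionsOn` need not be differentiable, the derivative is replaced by zero. -/
noncomputable def fieldDerivation [IsManifold 𝓘(𝕜, EM) 1 M] [IsManifold 𝓘(𝕜, EM) n M]
    (hn : n = ∞ ∨ n = ω) {U : Set M} (hU : IsOpen U) {X : ∀ x : M, TangentSpace 𝓘(𝕜, EM) x}
    (hX : IsVectorFieldOn n X U) :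
    Derivation 𝕜 (functionsOn 𝕜 EM M n U) (functionsOn 𝕜 EM M n U) :=
  Derivation.mk'
    { toFun := fun u => ⟨fun x => if x ∈ U then mvfderiv 𝓘(𝕜, EM) u.1 x (X x) else 0,
        (contMDiffOn_mvfderiv_apply hn hU hX u.2).congr fun x hx => if_pos hx⟩
      map_add' := fun u v => Subtype.ext (funext fun x => by
        by_cases hx : x ∈ U
        · simp [hx, mvfderiv_add (functionsOn_mdifferentiableAt (one_le_smoothness hn) hU u hx)
            (functionsOn_mdifferentiableAt (one_le_smoothness hn) hU v hx)]
        · simp [hx])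
      map_smul' := fun a u => Subtype.ext (funext fun x => by
        by_cases hx : x ∈ U
        · have h1 := mvfderiv_mul (I := 𝓘(𝕜, EM)) (f := fun _ : M => a) (g := u.1) (x := x)
            (mdifferentiableAt_const)
            (functionsOn_mdifferentiableAt (one_le_smoothness hn) hU u hx)
          have h2 : ((a • u : functionsOn 𝕜 EM M n U) : M → 𝕜) = (fun _ => a) * u.1 := rfl
          have h3 : mvfderiv 𝓘(𝕜, EM) (fun _ : M => a) x = 0 := mvfderiv_const a
          simp [hx, h2, h1, h3]
        · simp [hx]) }
    fun u v => Subtype.ext (funext fun x => by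
      by_cases hx : x ∈ U
      · simp [hx, mvfderiv_mul (functionsOn_mdifferentiableAt (one_le_smoothness hn) hU u hx)
          (functionsOn_mdifferentiableAt (one_le_smoothness hn) hU v hx)]
      · simp [hx])

section

variable [IsManifold 𝓘(𝕜, EM) 1 M] [IsManifold 𝓘(𝕜, EM) n M]

theorem fieldDerivation_apply (hn : n = ∞ ∨ n = ω) {U : Set M} (hU : IsOpen U)
    {X : ∀ x : M, TangentSpace 𝓘(𝕜, EM) x} (hX : IsVectorFieldOn n X U)
    (u : functionsOn 𝕜 EM M n U) {x : M} (hx : x ∈ U) :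
    (fieldDerivation hn hU hX u).1 x = mvfderiv 𝓘(𝕜, EM) u.1 x (X x) :=
  if_pos hx

theorem fieldDerivation_eventuallyEq (hn : n = ∞ ∨ n = ω) {U : Set M} (hU : IsOpen U)
    {X : ∀ x : M, TangentSpace 𝓘(𝕜, EM) x} (hX : IsVectorFieldOn n X U)
    (u : functionsOn 𝕜 EM M n U) {x : M} (hx : x ∈ U) :
    (fieldDerivation hn hU hX u).1 =ᶠ[𝓝 x] fun y => mvfderiv 𝓘(𝕜, EM) u.1 y (X y) := by
  filter_upwards [hU.mem_nhds hx] with y hy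
  exact fieldDerivation_apply hn hU hX u hy

theorem fieldDerivation_commutator [CompleteSpace EM] (hn : n = ∞ ∨ n = ω) {U : Set M}
    (hU : IsOpen U) {X Y : ∀ x : M, TangentSpace 𝓘(𝕜, EM) x} (hX : IsVectorFieldOn n X U)
    (hY : IsVectorFieldOn n Y U) (u : functionsOn 𝕜 EM M n U) {x : M} (hx : x ∈ U) :
    (⁅fieldDerivation hn hU hX, fieldDerivation hn hU hY⁆ u).1 x =
      mvfderiv 𝓘(𝕜, EM) u.1 x (mlieBracket 𝓘(𝕜, EM) X Y x) := by
  rw [mvfderiv_mlieBracket hn hU hx hX hY u.2, Derivation.commutator_apply]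
  change (fieldDerivation hn hU hX _).1 x - (fieldDerivation hn hU hY _).1 x = _
  rw [fieldDerivation_apply hn hU hX _ hx, fieldDerivation_apply hn hU hY _ hx,
    mvfderiv_congr (fieldDerivation_eventuallyEq hn hU hX u hx),
    mvfderiv_congr (fieldDerivation_eventuallyEq hn hU hY u hx)]

end

/-- The differential of a function at a point, as a linear form. -/
noncomputable def differential (u : M → 𝕜) (x : M) : TangentSpace 𝓘(𝕜, EM) x →ₗ[𝕜] 𝕜 :=
  (mvfderiv 𝓘(𝕜, EM) u x).toLinearMap

theorem pairing_eq (P : TensorField₂ 𝕜 EM M) (f h : M → 𝕜) (x : M) :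
    pairing P f h x = contract₂ (differential f x) (differential h x) (P x) := rfl

theorem pairing_congr_left (P : TensorField₂ 𝕜 EM M) {f f' : M → 𝕜} (h : M → 𝕜) {x : M}
    (hf : f =ᶠ[𝓝 x] f') : pairing P f h x = pairing P f' h x := by
  rw [pairing, pairing, mvfderiv_congr hf]

theorem pairing_eq_sum {P : TensorField₂ 𝕜 EM M} {m : ℕ}
    {X Y : Fin m → ∀ y : M, TangentSpace 𝓘(𝕜, EM) y} {x : M}
    (hP : P x = ∑ i, wedge₂ (X i x) (Y i x)) (f h : M → 𝕜) :
    pairing P f h x = ∑ i, (mvfderiv 𝓘(𝕜, EM) f x (X i x) * mvfderiv 𝓘(𝕜, EM) h x (Y i x) -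
      mvfderiv 𝓘(𝕜, EM) f x (Y i x) * mvfderiv 𝓘(𝕜, EM) h x (X i x)) := by
  rw [pairing_eq, hP, map_sum]
  exact Finset.sum_congr rfl fun i _ => contract₂_wedge₂ _ _ _ _

variable [IsManifold 𝓘(𝕜, EM) 1 M]

theorem IsBivectorField.pairing_self {P : TensorField₂ 𝕜 EM M} (hP : IsBivectorField n P)
    (f : M → 𝕜) (x : M) : pairing P f f x = 0 := by
  obtain ⟨U, -, hx, m, X, Y, -, -, hXY⟩ := hP x
  rw [pairing_eq_sum (hXY x hx)]
  exact Finset.sum_eq_zero fun i _ => by ring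

theorem IsBivectorField.pairing_swap {P : TensorField₂ 𝕜 EM M} (hP : IsBivectorField n P)
    (f h : M → 𝕜) (x : M) : pairing P f h x = -pairing P h f x := by
  obtain ⟨U, -, hx, m, X, Y, -, -, hXY⟩ := hP x
  rw [pairing_eq_sum (hXY x hx), pairing_eq_sum (hXY x hx), ← Finset.sum_neg_distrib]
  exact Finset.sum_congr rfl fun i _ => by ring

variable [IsManifold 𝓘(𝕜, EM) n M]

theorem IsBivectorField.contMDiff_pairing {P : TensorField₂ 𝕜 EM M} (hn : n = ∞ ∨ n = ω)
    (hP : IsBivectorField n P) {f h : M → 𝕜} (hf : ContMDiff 𝓘(𝕜, EM) 𝓘(𝕜) n f)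
    (hh : ContMDiff 𝓘(𝕜, EM) 𝓘(𝕜) n h) : ContMDiff 𝓘(𝕜, EM) 𝓘(𝕜) n (pairing P f h) := by
  intro x
  obtain ⟨U, hU, hx, m, X, Y, hX, hY, hXY⟩ := hP x
  refine ContMDiffOn.contMDiffAt (ContMDiffOn.congr ?_ fun y hy => pairing_eq_sum (hXY y hy) f h)
    (hU.mem_nhds hx)
  refine contMDiffOn_finsetSum fun i _ => ContMDiffOn.sub (ContMDiffOn.mul ?_ ?_)
    (ContMDiffOn.mul ?_ ?_)
  · exact contMDiffOn_mvfderiv_apply hn hU (hX i) hf.contMDiffOn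
  · exact contMDiffOn_mvfderiv_apply hn hU (hY i) hh.contMDiffOn
  · exact contMDiffOn_mvfderiv_apply hn hU (hY i) hf.contMDiffOn
  · exact contMDiffOn_mvfderiv_apply hn hU (hX i) hh.contMDiffOn

/-- On an open set, the bracket of `P` is given by any presentation of `P` as a sum of wedge
products. -/
theorem wedgeBracket_fieldDerivation {P : TensorField₂ 𝕜 EM M} (hn : n = ∞ ∨ n = ω)
    {U : Set M} (hU : IsOpen U) {m : ℕ} {X Y : Fin m → ∀ y : M, TangentSpace 𝓘(𝕜, EM) y}
    (hX : ∀ i, IsVectorFieldOn n (X i) U) (hY : ∀ i, IsVectorFieldOn n (Y i) U)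
    (u v : functionsOn 𝕜 EM M n U) {x : M} (hx : x ∈ U)
    (hXY : P x = ∑ i, wedge₂ (X i x) (Y i x)) :
    (wedgeBracket (fun i => fieldDerivation hn hU (hX i)) (fun i => fieldDerivation hn hU (hY i))
      u v).1 x = pairing P u.1 v.1 x := by
  rw [pairing_eq_sum hXY, wedgeBracket, AddSubmonoidClass.coe_finsetSum, Finset.sum_apply]
  refine Finset.sum_congr rfl fun i _ => ?_
  rw [← fieldDerivation_apply hn hU (hX i) u hx, ← fieldDerivation_apply hn hU (hY i) u hx,
    ← fieldDerivation_apply hn hU (hX i) v hx, ← fieldDerivation_apply hn hU (hY i) v hx]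
  rfl

/-- The contraction of a Schouten square depends only on the values of the linear forms on the vectors
involved. Here `r v w` expresses that `v` (a vector field) takes the value `w` (a tangent vector),
and `ev` is the evaluation of functions. -/
theorem map_contract₃_schoutenSquare {R S V W ι : Type*} [Fintype ι] [CommRing R] [CommRing S]
    [AddCommGroup V] [Module R V] [AddCommGroup W] [Module S W] (ev : R →+* S) {a b c : V →ₗ[R] R}
    {a' b' c' : W →ₗ[S] S} {r : V → W → Prop}
    (hr : ∀ v w, r v w → ev (a v) = a' w ∧ ev (b v) = b' w ∧ ev (c v) = c' w)
    {X Y : ι → V} {X' Y' : ι → W} {B₁ B₂ B₃ B₄ : ι → ι → V} {B₁' B₂' B₃' B₄' : ι → ι → W}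
    (hX : ∀ i, r (X i) (X' i)) (hY : ∀ i, r (Y i) (Y' i)) (h₁ : ∀ i j, r (B₁ i j) (B₁' i j))
    (h₂ : ∀ i j, r (B₂ i j) (B₂' i j)) (h₃ : ∀ i j, r (B₃ i j) (B₃' i j))
    (h₄ : ∀ i j, r (B₄ i j) (B₄' i j)) :
    ev (contract₃ a b c (∑ i, ∑ j, schoutenTerm (X i) (Y i) (X j) (Y j) (B₁ i j) (B₂ i j)
        (B₃ i j) (B₄ i j))) =
      contract₃ a' b' c' (∑ i, ∑ j, schoutenTerm (X' i) (Y' i) (X' j) (Y' j) (B₁' i j) (B₂' i j)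
        (B₃' i j) (B₄' i j)) := by
  simp only [schoutenTerm, map_sum, map_add, map_sub, contract₃_wedge₃, map_mul, hr _ _ (hX _),
    hr _ _ (hY _), hr _ _ (h₁ _ _), hr _ _ (h₂ _ _), hr _ _ (h₃ _ _), hr _ _ (h₄ _ _)]

set_option maxHeartbeats 2000000 in
/-- The Schouten square of `P` expresses the Jacobiator of the bracket `pairing P`. -/
theorem IsSchoutenSquare.contract₃_eq [CompleteSpace EM] {P : TensorField₂ 𝕜 EM M}
    {T : TensorField₃ 𝕜 EM M} (hn : n = ∞ ∨ n = ω) (hP : IsSchoutenSquare n P T)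
    {f g h : M → 𝕜} (hf : ContMDiff 𝓘(𝕜, EM) 𝓘(𝕜) n f) (hg : ContMDiff 𝓘(𝕜, EM) 𝓘(𝕜) n g)
    (hh : ContMDiff 𝓘(𝕜, EM) 𝓘(𝕜) n h) (x : M) :
    contract₃ (differential f x) (differential g x) (differential h x) (T x) =
      -2 * (pairing P (pairing P f g) h x + pairing P (pairing P g h) f x +
        pairing P (pairing P h f) g x) := by
  obtain ⟨U, hU, hx, m, X, Y, hX, hY, hXY⟩ := hP x
  obtain ⟨ev, hev₀⟩ : ∃ ev : functionsOn 𝕜 EM M n U →+* 𝕜, ∀ u, ev u = u.1 x :=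
    ⟨(Pi.evalRingHom (fun _ : M => 𝕜) x).comp (functionsOn 𝕜 EM M n U).val.toRingHom,
      fun _ => rfl⟩
  have hev : ∀ {Z : ∀ y : M, TangentSpace 𝓘(𝕜, EM) y} (hZ : IsVectorFieldOn n Z U)
      (u : functionsOn 𝕜 EM M n U),
      ev (fieldDerivation hn hU hZ u) = differential u.1 x (Z x) :=
    fun hZ u => (hev₀ _).trans (fieldDerivation_apply hn hU hZ u hx)
  have hevc : ∀ {Z W : ∀ y : M, TangentSpace 𝓘(𝕜, EM) y} (hZ : IsVectorFieldOn n Z U)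
      (hW : IsVectorFieldOn n W U) (u : functionsOn 𝕜 EM M n U),
      ev (⁅fieldDerivation hn hU hZ, fieldDerivation hn hU hW⁆ u) =
        differential u.1 x (mlieBracket 𝓘(𝕜, EM) Z W x) :=
    fun hZ hW u => (hev₀ _).trans (fieldDerivation_commutator hn hU hZ hW u hx)
  have hw : ∀ (u v k : functionsOn 𝕜 EM M n U),
      ev (wedgeBracket (fun i => fieldDerivation hn hU (hX i))
          (fun i => fieldDerivation hn hU (hY i))
        (wedgeBracket (fun i => fieldDerivation hn hU (hX i))
          (fun i => fieldDerivation hn hU (hY i)) u v) k) =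
        pairing P (pairing P u.1 v.1) k.1 x := by
    intro u v k
    refine (hev₀ _).trans ((wedgeBracket_fieldDerivation hn hU hX hY _ _ hx (hXY x hx).1).trans ?_)
    refine pairing_congr_left P k.1 ?_
    filter_upwards [hU.mem_nhds hx] with y hy
    exact wedgeBracket_fieldDerivation hn hU hX hY _ _ hy (hXY y hy).1
  lift f to functionsOn 𝕜 EM M n U using hf.contMDiffOn
  lift g to functionsOn 𝕜 EM M n U using hg.contMDiffOn
  lift h to functionsOn 𝕜 EM M n U using hh.contMDiffOn
  have key := congrArg ev (contract₃_schoutenSquare (fun i => fieldDerivation hn hU (hX i))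
    (fun i => fieldDerivation hn hU (hY i)) f g h)
  rw [map_mul, map_add, map_add, hw, hw, hw, map_neg, map_ofNat] at key
  rw [← key, (hXY x hx).2]
  exact (map_contract₃_schoutenSquare ev (r := fun D v => ∀ u : functionsOn 𝕜 EM M n U,
      ev (D u) = differential u.1 x v) (fun D v hD => ⟨hD f, hD g, hD h⟩)
    (fun i => hev (hX i)) (fun i => hev (hY i)) (fun i j => hevc (hX i) (hX j))
    (fun i j => hevc (hX i) (hY j)) (fun i j => hevc (hY i) (hX j))
    (fun i j => hevc (hY i) (hY j))).symm

end ManifoldBracket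

/-! ### The Poisson bracket on the invariant functions of a manifold -/

section InvariantBracket

variable {𝕜 : Type*} [RCLike 𝕜]
  {EM : Type*} [NormedAddCommGroup EM] [NormedSpace 𝕜 EM]
  {G : Type*} [Group G]
  {M : Type*} [TopologicalSpace M] [ChartedSpace EM M] [MulAction G M]
  {n : WithTop ℕ∞}

/-- The differential of an invariant function is invariant. -/
theorem differential_comp_smul {f : M → 𝕜} (hf : ∀ (g : G) (x : M), f (g • x) = f x)
    (hfd : MDifferentiable 𝓘(𝕜, EM) 𝓘(𝕜) f) {g : G}
    (hg : MDifferentiable 𝓘(𝕜, EM) 𝓘(𝕜, EM) (fun y : M => g • y)) (x : M) :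
    differential f (g • x) ∘ₗ (mfderiv 𝓘(𝕜, EM) 𝓘(𝕜, EM) (fun y : M => g • y) x).toLinearMap =
      differential f x := by
  have h1 := mvfderiv_comp (I := 𝓘(𝕜, EM)) (I' := 𝓘(𝕜, EM)) (g := f) (f := fun y : M => g • y) x
    (hfd _) (hg x)
  have h2 : (f ∘ fun y : M => g • y) = f := funext fun y => hf g y
  rw [h2] at h1
  rw [differential, differential, h1]
  rfl

theorem invariants_mdifferentiable (hn : 1 ≤ n) (f : invariants 𝕜 EM G M n) :
    MDifferentiable 𝓘(𝕜, EM) 𝓘(𝕜) f.1 :=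
  f.1.contMDiff.mdifferentiable (by positivity)

theorem pairing_mul_right (P : TensorField₂ 𝕜 EM M) (f : M → 𝕜) {h k : M → 𝕜} {x : M}
    (hh : MDifferentiableAt 𝓘(𝕜, EM) 𝓘(𝕜) h x) (hk : MDifferentiableAt 𝓘(𝕜, EM) 𝓘(𝕜) k x) :
    pairing P f (h * k) x = pairing P f h x * k x + h x * pairing P f k x := by
  have h1 : differential (h * k) x = h x • differential k x + k x • differential h x :=
    congrArg ContinuousLinearMap.toLinearMap (mvfderiv_mul hh hk)
  rw [pairing_eq, pairing_eq, pairing_eq, h1]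
  generalize P x = t
  induction t using TensorProduct.induction_on with
  | zero => simp
  | add s t hs ht => simp only [map_add, hs, ht]; ring
  | tmul v w => simp; ring

theorem pairing_add_right (P : TensorField₂ 𝕜 EM M) (f : M → 𝕜) {h k : M → 𝕜} {x : M}
    (hh : MDifferentiableAt 𝓘(𝕜, EM) 𝓘(𝕜) h x) (hk : MDifferentiableAt 𝓘(𝕜, EM) 𝓘(𝕜) k x) :
    pairing P f (h + k) x = pairing P f h x + pairing P f k x := by
  have h1 : differential (h + k) x = differential h x + differential k x :=
    congrArg ContinuousLinearMap.toLinearMap (mvfderiv_add hh hk)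
  rw [pairing_eq, pairing_eq, pairing_eq, h1]
  generalize P x = t
  induction t using TensorProduct.induction_on with
  | zero => simp
  | add s t hs ht => simp only [map_add, hs, ht]; ring
  | tmul v w => simp; ring

theorem pairing_const_right (P : TensorField₂ 𝕜 EM M) (f : M → 𝕜) (a : 𝕜) (x : M) :
    pairing P f (fun _ => a) x = 0 := by
  have h1 : differential (fun _ => a) x = (0 : TangentSpace 𝓘(𝕜, EM) x →ₗ[𝕜] 𝕜) :=
    congrArg ContinuousLinearMap.toLinearMap (mvfderiv_const a)
  rw [pairing_eq, h1]
  simp [contract₂]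

variable {EG : Type*} [NormedAddCommGroup EG] [NormedSpace 𝕜 EG] [TopologicalSpace G]
  [ChartedSpace EG G]

section

variable [ContMDiffSMul 𝓘(𝕜, EG) 𝓘(𝕜, EM) n G M]

theorem mdifferentiable_smul_const (hn : 1 ≤ n) (x : M) :
    MDifferentiable 𝓘(𝕜, EG) 𝓘(𝕜, EM) (fun g : G => g • x) :=
  (ContMDiff.smul (I := 𝓘(𝕜, EG)) (I' := 𝓘(𝕜, EM)) (n := n) contMDiff_id
    (contMDiff_const (c := x))).mdifferentiable (by positivity)

/-- The differential of an invariant function annihilates the fundamental vector fields. -/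
theorem differential_fund (hn : 1 ≤ n) {f : M → 𝕜} (hf : ∀ (g : G) (x : M), f (g • x) = f x)
    {x : M} (hfd : MDifferentiableAt 𝓘(𝕜, EM) 𝓘(𝕜) f x) (ξ : GroupLieAlgebra 𝓘(𝕜, EG) G) :
    differential f x (fund 𝕜 EG EM G x ξ) = 0 := by
  have h1 := mvfderiv_comp_apply_of_eq (I := 𝓘(𝕜, EM)) (I' := 𝓘(𝕜, EG)) (g := f)
    (f := fun g : G => g • x) 1 hfd (mdifferentiable_smul_const hn x 1) (one_smul G x) ξ
  have h2 : (f ∘ fun g : G => g • x) = fun _ => f x := funext fun g => hf g x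
  rw [h2, mvfderiv_const] at h1
  change mvfderiv 𝓘(𝕜, EM) f x
    (-(mfderiv 𝓘(𝕜, EG) 𝓘(𝕜, EM) (fun g : G => g • x) 1 ξ : EM)) = 0
  refine (map_neg (mvfderiv 𝓘(𝕜, EM) f x) _).trans ?_
  rw [neg_eq_zero]
  exact h1.symm

theorem contract₃_fundTrivector (hn : 1 ≤ n) {f : M → 𝕜}
    (hf : ∀ (g : G) (x : M), f (g • x) = f x) {x : M}
    (hfd : MDifferentiableAt 𝓘(𝕜, EM) 𝓘(𝕜) f x) (b c : TangentSpace 𝓘(𝕜, EM) x →ₗ[𝕜] 𝕜)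
    (φ : GroupLieAlgebra 𝓘(𝕜, EG) G ⊗[𝕜]
      (GroupLieAlgebra 𝓘(𝕜, EG) G ⊗[𝕜] GroupLieAlgebra 𝓘(𝕜, EG) G)) :
    contract₃ (differential f x) b c (fundTrivector 𝕜 EG EM M φ x) = 0 := by
  rw [fundTrivector]
  induction φ using TensorProduct.induction_on with
  | zero => simp
  | add φ ψ hφ hψ => simp only [map_add, hφ, hψ, add_zero]
  | tmul X t => simp [contract₃, differential_fund hn hf hfd X]

end

variable [FiniteDimensional 𝕜 EG] [LieGroup 𝓘(𝕜, EG) n G] [IsManifold 𝓘(𝕜, EM) n M] {c : 𝕜}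
  {H : GroupLieAlgebra 𝓘(𝕜, EG) G ⊗[𝕜] GroupLieAlgebra 𝓘(𝕜, EG) G}
  {P : TensorField₂ 𝕜 EM M} {Φ : M → G}

variable [ContMDiffSMul 𝓘(𝕜, EG) 𝓘(𝕜, EM) n G M]

theorem IsHamiltonian.pairing_smul {hn : n = ∞ ∨ n = ω} (hP : IsHamiltonian n hn c H P Φ)
    (f h : invariants 𝕜 EM G M n) (g : G) (x : M) :
    pairing P f.1 h.1 (g • x) = pairing P f.1 h.1 x := by
  have h1 := one_le_smoothness hn
  have hg : MDifferentiable 𝓘(𝕜, EM) 𝓘(𝕜, EM) (fun y : M => g • y) :=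
    (ContMDiffSMul.contMDiff_const_smul (I := 𝓘(𝕜, EG)) (I' := 𝓘(𝕜, EM)) (n := n)
      g).mdifferentiable (by positivity)
  rw [pairing_eq, ← hP.invariant g x, contract₂_map,
    differential_comp_smul f.2 (invariants_mdifferentiable h1 f) hg,
    differential_comp_smul h.2 (invariants_mdifferentiable h1 h) hg]
  rfl

theorem IsHamiltonian.jacobi [FiniteDimensional 𝕜 EM] {hn : n = ∞ ∨ n = ω}
    (hP : IsHamiltonian n hn c H P Φ) (f g h : invariants 𝕜 EM G M n) (x : M) :
    pairing P (pairing P f.1 g.1) h.1 x + pairing P (pairing P g.1 h.1) f.1 x +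
      pairing P (pairing P h.1 f.1) g.1 x = 0 := by
  have h1 := one_le_smoothness hn
  have : IsManifold 𝓘(𝕜, EM) 1 M := .of_le h1
  have : CompleteSpace EM := FiniteDimensional.complete 𝕜 EM
  have key := hP.schouten.contract₃_eq hn f.1.contMDiff g.1.contMDiff h.1.contMDiff x
  rw [map_smul, contract₃_fundTrivector h1 f.2 (invariants_mdifferentiable h1 f x), smul_zero]
    at key
  simpa using key.symm

/-- The bracket of two invariant functions, as an invariant function. -/
noncomputable def IsHamiltonian.invariantPairing {hn : n = ∞ ∨ n = ω}
    (hP : IsHamiltonian n hn c H P Φ) (f h : invariants 𝕜 EM G M n) : invariants 𝕜 EM G M n :=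
  ⟨⟨pairing P f.1 h.1,
    haveI : IsManifold 𝓘(𝕜, EM) 1 M := .of_le (one_le_smoothness hn)
    hP.bivector.contMDiff_pairing hn f.1.contMDiff h.1.contMDiff⟩,
    fun g x => hP.pairing_smul f h g x⟩

/-- The Poisson bracket on the invariant functions. -/
noncomputable def IsHamiltonian.bracket [FiniteDimensional 𝕜 EM] {hn : n = ∞ ∨ n = ω}
    (hP : IsHamiltonian n hn c H P Φ) : PoissonBracket 𝕜 (invariants 𝕜 EM G M n) :=
  haveI : IsManifold 𝓘(𝕜, EM) 1 M := .of_le (one_le_smoothness hn)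
  have hd := fun f : invariants 𝕜 EM G M n => invariants_mdifferentiable (one_le_smoothness hn) f
  have hext : ∀ {f h : invariants 𝕜 EM G M n}, (∀ x, f.1 x = h.1 x) → f = h :=
    fun h => Subtype.ext (ContMDiffMap.ext h)
  have hswap : ∀ f h, hP.invariantPairing f h = -hP.invariantPairing h f := fun f h =>
    hext fun x => hP.bivector.pairing_swap f.1 h.1 x
  have hadd : ∀ f h k, hP.invariantPairing f (h + k) =
      hP.invariantPairing f h + hP.invariantPairing f k := fun f h k =>
    hext fun x => pairing_add_right P f.1 (hd h x) (hd k x)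
  have hmul : ∀ f h k, hP.invariantPairing f (h * k) =
      hP.invariantPairing f h * k + h * hP.invariantPairing f k := fun f h k =>
    hext fun x => pairing_mul_right P f.1 (hd h x) (hd k x)
  have hsmul : ∀ (a : 𝕜) f h, hP.invariantPairing f (a • h) = a • hP.invariantPairing f h :=
    fun a f h => by
      have h0 : hP.invariantPairing f (algebraMap 𝕜 _ a) = 0 :=
        hext fun x => pairing_const_right P f.1 a x
      rw [Algebra.smul_def, hmul, h0, zero_mul, zero_add, ← Algebra.smul_def]
  { br := LinearMap.mk₂ 𝕜 hP.invariantPairing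
      (fun f f' h => by rw [hswap, hadd, neg_add, ← hswap, ← hswap])
      (fun a f h => by rw [hswap, hsmul, hswap h f, smul_neg, neg_neg])
      hadd hsmul
    br_self := fun f => hext fun x => hP.bivector.pairing_self f.1 x
    br_mul := hmul
    jacobi := fun f g h => hext fun x => hP.jacobi f g h x }

end InvariantBracket

/-! ### Derivatives along fields tangent to the fibres -/

section Flow

open scoped Topology

/-- If the vector field `W` is tangent to the fibres of `ψ`, then the derivative along `W` of a
function which vanishes on the fibre through `z₀` is zero at `z₀`: the integral curve of `W`
through `z₀` stays in the fibre. The differential of `ψ` may have any rank. -/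
theorem fderiv_apply_eq_zero_of_fibre {𝕜 : Type*} [RCLike 𝕜] {E E' F : Type*}
    [NormedAddCommGroup E] [NormedSpace 𝕜 E] [CompleteSpace E] [NormedAddCommGroup E']
    [NormedSpace 𝕜 E'] [NormedAddCommGroup F] [NormedSpace 𝕜 F] {W : E → E} {z₀ : E}
    (hW : ContDiffAt 𝕜 1 W z₀) {S : Set E} (hS : S ∈ 𝓝 z₀) {ψ : E → E'}
    (hψ : ∀ z ∈ S, DifferentiableAt 𝕜 ψ z) (hψW : ∀ z ∈ S, fderiv 𝕜 ψ z (W z) = 0) {u : E → F}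
    (hu : DifferentiableAt 𝕜 u z₀) (h0 : ∀ z ∈ S, ψ z = ψ z₀ → u z = 0) :
    fderiv 𝕜 u z₀ (W z₀) = 0 := by
  -- also for complex `𝕜`, the integral curve is taken over the real line
  let : NormedSpace ℝ E := NormedSpace.restrictScalars ℝ 𝕜 E
  let : NormedSpace ℝ E' := NormedSpace.restrictScalars ℝ 𝕜 E'
  let : NormedSpace ℝ F := NormedSpace.restrictScalars ℝ 𝕜 F
  have : IsScalarTower ℝ 𝕜 E := RestrictScalars.isScalarTower ℝ 𝕜 _
  have : IsScalarTower ℝ 𝕜 E' := RestrictScalars.isScalarTower ℝ 𝕜 _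
  have : IsScalarTower ℝ 𝕜 F := RestrictScalars.isScalarTower ℝ 𝕜 _
  obtain ⟨γ, hγ0, ε, hε, hγ⟩ := (hW.restrict_scalars ℝ
    ).exists_forall_mem_closedBall_exists_eq_forall_mem_Ioo_hasDerivAt₀ 0
  have hγc : ContinuousAt γ 0 := (hγ 0 (by simp [hε])).continuousAt
  obtain ⟨δ, hδ, hδS⟩ := Metric.mem_nhds_iff.1 (hγc.preimage_mem_nhds (hγ0.symm ▸ hS))
  set ρ := min δ ε
  have hρ : 0 < ρ := lt_min hδ hε
  have hmem : ∀ t ∈ Set.Ioo (-ρ) ρ, γ t ∈ S ∧ HasDerivAt γ (W (γ t)) t := by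
    intro t ht
    have h1 : |t| < ρ := abs_lt.2 ht
    refine ⟨hδS ?_, hγ t ?_⟩
    · rw [Metric.mem_ball, Real.dist_eq, sub_zero]
      exact h1.trans_le (min_le_left _ _)
    · have h2 := abs_lt.1 (h1.trans_le (min_le_right _ _))
      simpa using h2
  have hconst : ∀ t ∈ Set.Ioo (-ρ) ρ, ψ (γ t) = ψ z₀ := by
    intro t ht
    have h1 : ∀ s ∈ Set.Ioo (-ρ) ρ, HasDerivAt (ψ ∘ γ) 0 s := fun s hs => by
      have h := ((hψ _ (hmem s hs).1).hasFDerivAt.restrictScalars ℝ).comp_hasDerivAt s (hmem s hs).2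
      rwa [ContinuousLinearMap.coe_restrictScalars', hψW _ (hmem s hs).1] at h
    have h2 := isOpen_Ioo.is_const_of_deriv_eq_zero isPreconnected_Ioo
      (fun s hs => (h1 s hs).differentiableAt.differentiableWithinAt) (fun s hs => (h1 s hs).deriv)
      ht (show (0 : ℝ) ∈ Set.Ioo (-ρ) ρ from ⟨neg_lt_zero.2 hρ, hρ⟩)
    simpa [hγ0] using h2
  have h00 : (0 : ℝ) ∈ Set.Ioo (-ρ) ρ := ⟨neg_lt_zero.2 hρ, hρ⟩
  have hd := ((show DifferentiableAt 𝕜 u (γ 0) by rwa [hγ0]).hasFDerivAt.restrictScalars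
    ℝ).comp_hasDerivAt 0 (hmem 0 h00).2
  have hz : (u ∘ γ) =ᶠ[𝓝 0] fun _ => 0 := by
    filter_upwards [isOpen_Ioo.mem_nhds h00] with t ht
    exact h0 _ (hmem t ht).1 (hconst t ht)
  have := hd.unique ((hasDerivAt_const (0 : ℝ) (0 : F)).congr_of_eventuallyEq hz)
  rwa [ContinuousLinearMap.coe_restrictScalars', hγ0] at this

variable {𝕜 : Type*} [RCLike 𝕜]
  {EN : Type*} [NormedAddCommGroup EN] [NormedSpace 𝕜 EN]
  {EM : Type*} [NormedAddCommGroup EM] [NormedSpace 𝕜 EM] [CompleteSpace EM]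
  {N : Type*} [TopologicalSpace N] [ChartedSpace EN N]
  {M : Type*} [TopologicalSpace M] [ChartedSpace EM M]
  {n : WithTop ℕ∞} [IsManifold 𝓘(𝕜, EM) 1 M] [IsManifold 𝓘(𝕜, EM) n M] [IsManifold 𝓘(𝕜, EN) n N]

/-- If a vector field is tangent to the fibres of `Φ`, then the derivative along it of a function
which vanishes on a fibre vanishes on this fibre. -/
theorem mvfderiv_apply_eq_zero_of_fibre (hn : n = ∞ ∨ n = ω) {U : Set M} (hU : IsOpen U)
    {V : ∀ x : M, TangentSpace 𝓘(𝕜, EM) x} (hV : IsVectorFieldOn n V U) {Φ : M → N}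
    (hΦ : ContMDiff 𝓘(𝕜, EM) 𝓘(𝕜, EN) n Φ)
    (hΦV : ∀ y ∈ U, mfderiv 𝓘(𝕜, EM) 𝓘(𝕜, EN) Φ y (V y) = 0) {p : M} (hp : p ∈ U) {u : M → 𝕜}
    (hu : MDifferentiableAt 𝓘(𝕜, EM) 𝓘(𝕜) u p) (h0 : ∀ y, Φ y = Φ p → u y = 0) :
    mvfderiv 𝓘(𝕜, EM) u p (V p) = 0 := by
  have h1n := one_le_smoothness hn
  have hpp := extChartAt_to_inv (I := 𝓘(𝕜, EM)) p
  have hz₀ := mem_extChartAt_target (I := 𝓘(𝕜, EM)) p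
  set z₀ := extChartAt 𝓘(𝕜, EM) p p
  set f : EM → M := ⇑(extChartAt 𝓘(𝕜, EM) p).symm with hf
  have hfd : ∀ z ∈ (extChartAt 𝓘(𝕜, EM) p).target, ContMDiffAt 𝓘(𝕜, EM) 𝓘(𝕜, EM) n f z :=
    fun z hz => contMDiffAt_extChartAt_symm_of_mem p hz
  -- the function `Φ`, in the chart at `Φ p`
  let v : M → EN := extChartAt 𝓘(𝕜, EN) (Φ p) ∘ Φ
  let O : Set M := U ∩ Φ ⁻¹' (extChartAt 𝓘(𝕜, EN) (Φ p)).source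
  have hO : IsOpen O := hU.inter ((isOpen_extChartAt_source (Φ p)).preimage hΦ.continuous)
  have hpO : p ∈ O := ⟨hp, mem_extChartAt_source (Φ p)⟩
  have hchart : ∀ y ∈ O, MDifferentiableAt 𝓘(𝕜, EN) 𝓘(𝕜, EN) (extChartAt 𝓘(𝕜, EN) (Φ p)) (Φ y) :=
    fun y hy => (contMDiffAt_extChartAt' (n := n)
      (by rw [← extChartAt_source 𝓘(𝕜, EN)]; exact hy.2)).mdifferentiableAt (by positivity)
  have hΦd : MDifferentiable 𝓘(𝕜, EM) 𝓘(𝕜, EN) Φ := hΦ.mdifferentiable (by positivity)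
  have hv : ∀ y ∈ O, MDifferentiableAt 𝓘(𝕜, EM) 𝓘(𝕜, EN) v y := fun y hy =>
    (hchart y hy).comp y (hΦd y)
  have hvV : ∀ y ∈ O, mvfderiv 𝓘(𝕜, EM) v y (V y) = 0 := fun y hy => by
    have h := mfderiv_comp_apply y (hchart y hy) (hΦd y) (V y)
    rw [hΦV y hy.1, map_zero] at h
    exact h
  have hS : (extChartAt 𝓘(𝕜, EM) p).target ∩ f ⁻¹' O ∈ 𝓝 z₀ :=
    Filter.inter_mem ((isOpen_extChartAt_target p).mem_nhds hz₀)
      ((hfd z₀ hz₀).continuousAt.preimage_mem_nhds (hO.mem_nhds (by rwa [hpp])))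
  have key := fderiv_apply_eq_zero_of_fibre (W := chartField p V) (z₀ := z₀)
    ((contDiffAt_chartField hn p hz₀ hU hV (by rwa [← hf, hpp])).of_le h1n) hS (ψ := v ∘ f)
    (fun z hz => ((hv _ hz.2).comp z ((hfd z hz.1).mdifferentiableAt
      (by positivity))).differentiableAt)
    (fun z hz => (fderiv_comp_chart_apply h1n p hz.1 (hv _ hz.2) V).trans (hvV _ hz.2))
    (u := u ∘ f)
    (MDifferentiableAt.comp z₀ (by rwa [hpp]) ((hfd z₀ hz₀).mdifferentiableAt
      (by positivity))).differentiableAt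
    (fun z hz h => h0 _ ((extChartAt 𝓘(𝕜, EN) (Φ p)).injOn hz.2.2 hpO.2
      (by simpa [v, hpp] using h)))
  have h2 := fderiv_comp_chart_apply h1n p hz₀ (u := u) (by rwa [← hf, hpp]) V
  rw [← hf, key, hpp] at h2
  exact h2.symm

end Flow

/-! ### The Poisson ideal of a conjugacy class, on a manifold -/

section PoissonIdeal

variable {𝕜 : Type*} [RCLike 𝕜]
  {EG : Type*} [NormedAddCommGroup EG] [NormedSpace 𝕜 EG] [FiniteDimensional 𝕜 EG]
  {EM : Type*} [NormedAddCommGroup EM] [NormedSpace 𝕜 EM]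
  {G : Type*} [TopologicalSpace G] [ChartedSpace EG G] [Group G]
  {M : Type*} [TopologicalSpace M] [ChartedSpace EM M] [MulAction G M]
  {n : WithTop ℕ∞} [LieGroup 𝓘(𝕜, EG) n G] [IsManifold 𝓘(𝕜, EM) n M] {c : 𝕜}
  {H : GroupLieAlgebra 𝓘(𝕜, EG) G ⊗[𝕜] GroupLieAlgebra 𝓘(𝕜, EG) G}
  {P : TensorField₂ 𝕜 EM M} {Φ : M → G}

variable [ContMDiffSMul 𝓘(𝕜, EG) 𝓘(𝕜, EM) n G M]

/-- The Hamiltonian vector field of an invariant function is tangent to the fibres of the momentum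
mapping, whence the functions that vanish on a union of fibres form a Poisson ideal. -/
theorem IsHamiltonian.pairing_eq_zero [FiniteDimensional 𝕜 EM] {hn : n = ∞ ∨ n = ω}
    (hP : IsHamiltonian n hn c H P Φ) (f : invariants 𝕜 EM G M n) {u : M → 𝕜} {p : M}
    (hu : MDifferentiableAt 𝓘(𝕜, EM) 𝓘(𝕜) u p) (h0 : ∀ y, Φ y = Φ p → u y = 0) :
    pairing P f.1 u p = 0 := by
  have h1n := one_le_smoothness hn
  have : IsManifold 𝓘(𝕜, EM) 1 M := .of_le h1n
  have : CompleteSpace EM := FiniteDimensional.complete 𝕜 EM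
  have : IsManifold 𝓘(𝕜, EM) (n + 1) M := .of_le (smoothness_add_one hn)
  obtain ⟨U, hU, hp, m, X, Y, hX, hY, hXY⟩ := hP.bivector p
  -- the Hamiltonian vector field of `f` near `p`
  let V : ∀ y : M, TangentSpace 𝓘(𝕜, EM) y := fun y => ∑ i,
    (mvfderiv 𝓘(𝕜, EM) f.1 y (X i y) • Y i y - mvfderiv 𝓘(𝕜, EM) f.1 y (Y i y) • X i y)
  have hV : IsVectorFieldOn n V U := by
    refine ContMDiffOn.sum_section fun i _ => ContMDiffOn.sub_section
      (ContMDiffOn.smul_section ?_ (hY i)) (ContMDiffOn.smul_section ?_ (hX i))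
    · exact contMDiffOn_mvfderiv_apply hn hU (hX i) f.1.contMDiff.contMDiffOn
    · exact contMDiffOn_mvfderiv_apply hn hU (hY i) f.1.contMDiff.contMDiffOn
  have hΦV : ∀ y ∈ U, mfderiv 𝓘(𝕜, EM) 𝓘(𝕜, EG) Φ y (V y) = 0 := by
    intro y hy
    have h1 := rid_map_map_eq_zero (differential f.1 y)
      (S := (2⁻¹ : 𝕜) • (leftTr 𝕜 EG (Φ y) + rightTr 𝕜 EG (Φ y))) (T := fund 𝕜 EG EM G y)
      (fun ξ => differential_fund h1n f.2 (invariants_mdifferentiable h1n f y) ξ) H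
    -- contracted with `df`, the momentum property says that `dΦ` annihilates `V`
    rw [← hP.momentum y, hXY y hy, map_sum, map_sum, map_sum] at h1
    simp only [rid_map_map_wedge₂] at h1
    rw [Finset.sum_neg_distrib, neg_eq_zero, ← map_sum] at h1
    exact h1
  have key := mvfderiv_apply_eq_zero_of_fibre hn hU hV hP.contMDiff hΦV hp hu h0
  rw [pairing_eq_sum (hXY p hp), ← key, map_sum]
  refine Finset.sum_congr rfl fun i _ => ?_
  rw [map_sub, map_smul, map_smul, smul_eq_mul, smul_eq_mul]

theorem IsHamiltonian.bracket_mem_vanishingIdeal [FiniteDimensional 𝕜 EM] {hn : n = ∞ ∨ n = ω}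
    (hP : IsHamiltonian n hn c H P Φ) (C : ConjClasses G) (f : invariants 𝕜 EM G M n)
    {F : invariants 𝕜 EM G M n} (hF : F ∈ vanishingIdeal 𝕜 EM n Φ C) :
    hP.bracket.br f F ∈ vanishingIdeal 𝕜 EM n Φ C := fun p hp =>
  hP.pairing_eq_zero f (invariants_mdifferentiable (one_le_smoothness hn) F p)
    fun y hy => hF y (hy ▸ hp)

end PoissonIdeal

/-! ### Quotients of the level sets -/

section Quotients

open scoped Topology

variable {G : Type*} [Group G] {M : Type*} {Φ : M → G} {C : ConjClasses G}

section

variable [MulAction G M]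

theorem SameOrbit.refl (p : level Φ C) : SameOrbit Φ C p p := ⟨1, one_smul G p.1⟩

theorem SameOrbit.symm {p q : level Φ C} : SameOrbit Φ C p q → SameOrbit Φ C q p := by
  rintro ⟨g, hg⟩
  exact ⟨g⁻¹, by rw [← hg, inv_smul_smul]⟩

end

variable [TopologicalSpace M] {𝕜 : Type*} [RCLike 𝕜]
  {EM : Type*} [NormedAddCommGroup EM] [NormedSpace 𝕜 EM] [ChartedSpace EM M] {n : WithTop ℕ∞}

theorem IsAdmissibleOn.continuousAt {φ : level Φ C → 𝕜} {W : Set (level Φ C)}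
    (hφ : IsAdmissibleOn 𝕜 EM n φ W) {p : level Φ C} (hp : p ∈ W) : ContinuousAt φ p := by
  obtain ⟨V, F, hV, hpV, hF, hφF⟩ := hφ p hp
  have h1 : ContinuousAt (fun q : level Φ C => F q.1) p :=
    (hF.continuousOn.continuousAt (hV.mem_nhds hpV)).comp continuousAt_subtype_val
  refine h1.congr ?_
  filter_upwards [(hV.preimage continuous_subtype_val).mem_nhds hpV] with q hq
  exact (hφF q hq).symm

variable [MulAction G M]

theorem SameOrbit.orbitClosuresMeet {p q : level Φ C} (h : SameOrbit Φ C p q) :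
    OrbitClosuresMeet Φ C p q :=
  ⟨q, subset_closure h, subset_closure (SameOrbit.refl q)⟩

variable (𝕜 EM n) in
/-- The quotient of a level set by a relation which holds between the points of an orbit, and which
is respected by the invariant admissible functions on saturated open sets, is a quotient. -/
theorem isQuotient_quotMk {r : level Φ C → level Φ C → Prop}
    (hr : ∀ p q, SameOrbit Φ C p q → r p q)
    (hφr : ∀ U : Set (Quot r), IsOpen U → ∀ φ : level Φ C → 𝕜,
      IsAdmissibleOn 𝕜 EM n φ (Quot.mk r ⁻¹' U) →
      (∀ p q, Quot.mk r p ∈ U → SameOrbit Φ C p q → φ p = φ q) →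
      ∀ p q, Quot.mk r p ∈ U → r p q → φ p = φ q) :
    IsQuotient 𝕜 EM n (Quot.mk r : level Φ C → Quot r) where
  continuous := continuous_quot_mk
  surjective := Quot.mk_surjective
  invariant p q h := Quot.sound (hr p q h)
  descent U hU φ hφ hinv := by
    have hgen : ∀ p q, Relation.EqvGen r p q → Quot.mk r p ∈ U → φ p = φ q := by
      intro p q h
      induction h with
      | rel p q h => exact fun hp => hφr U hU φ hφ hinv p q hp h
      | refl p => exact fun _ => rfl
      | symm p q h ih => exact fun hq => (ih ((Quot.eqvGen_sound h) ▸ hq)).symm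
      | trans p q s h h' ih ih' => exact fun hp => (ih hp).trans (ih' ((Quot.eqvGen_sound h) ▸ hp))
    have hout : ∀ p, Quot.mk r p ∈ U → φ (Quot.mk r p).out = φ p := fun p hp =>
      hgen _ _ (Quot.eqvGen_exact (Quot.out_eq _)) (by rwa [Quot.out_eq])
    refine ⟨fun x => φ x.out, ?_, hout⟩
    refine (isQuotientMap_quot_mk.continuousOn_isOpen_iff hU).2 ?_
    exact ContinuousOn.congr (fun p hp => (hφ.continuousAt hp).continuousWithinAt) hout

variable (𝕜 EM n Φ C) in
theorem isQuotient_orbitSpace :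
    IsQuotient 𝕜 EM n (Quot.mk (SameOrbit Φ C) : level Φ C → OrbitSpace Φ C) :=
  isQuotient_quotMk 𝕜 EM n (fun _ _ h => h) fun _ _ _ _ h => h

variable (𝕜 EM n Φ C) in
theorem isQuotient_closureQuotient :
    IsQuotient 𝕜 EM n (Quot.mk (OrbitClosuresMeet Φ C) : level Φ C → ClosureQuotient Φ C) := by
  refine isQuotient_quotMk 𝕜 EM n (fun _ _ h => h.orbitClosuresMeet) ?_
  intro U hU φ hφ hinv p q hp ⟨r, hpr, hqr⟩
  -- a point of the closure of an orbit is identified with the points of this orbit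
  have key : ∀ s : level Φ C, Quot.mk (OrbitClosuresMeet Φ C) s ∈ U →
      r ∈ closure {t | SameOrbit Φ C s t} → φ r = φ s := by
    intro s hs hrs
    have hsr : OrbitClosuresMeet Φ C s r := ⟨r, hrs, subset_closure (SameOrbit.refl r)⟩
    have hr : Quot.mk (OrbitClosuresMeet Φ C) r ∈ U := Quot.sound hsr ▸ hs
    have h1 := (hφ.continuousAt hr).continuousWithinAt.mem_closure_image hrs
    have h2 : φ '' {t | SameOrbit Φ C s t} ⊆ {φ s} := by
      rintro _ ⟨t, ht, rfl⟩
      exact (hinv s t hs ht).symm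
    simpa using closure_mono h2 h1
  have hpq : OrbitClosuresMeet Φ C p q := ⟨r, hpr, hqr⟩
  exact (key p hp hpr).symm.trans (key q (Quot.sound hpq ▸ hp) hqr)

/-- Invariant functions descend to algebras of functions on the quotients of the level sets. -/
theorem IsQuotient.exists_algHom {Q : Type*} [TopologicalSpace Q] {π : level Φ C → Q}
    (hπ : IsQuotient 𝕜 EM n π) :
    ∃ j : (invariants 𝕜 EM G M n ⧸ vanishingIdeal 𝕜 EM n Φ C) →ₐ[𝕜] C(Q, 𝕜),
      Function.Injective j ∧
      ∀ (f : invariants 𝕜 EM G M n) (p : level Φ C),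
        j (Ideal.Quotient.mk _ f) (π p) = f.1 p.1 := by
  have hex : ∀ f : invariants 𝕜 EM G M n, ∃ h : C(Q, 𝕜), ∀ p, h (π p) = f.1 p.1 := by
    intro f
    obtain ⟨h, hc, hh⟩ := hπ.descent Set.univ isOpen_univ (fun p => f.1 p.1)
      (fun p _ => ⟨Set.univ, f.1, isOpen_univ, trivial, f.1.contMDiff.contMDiffOn, fun _ _ => rfl⟩)
      (fun p q _ ⟨g, hg⟩ => by rw [← hg]; exact (f.2 g p.1).symm)
    exact ⟨⟨h, continuousOn_univ.1 hc⟩, fun p => hh p trivial⟩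
  choose s hs using hex
  have hext : ∀ {h h' : C(Q, 𝕜)}, (∀ p, h (π p) = h' (π p)) → h = h' := fun H =>
    ContinuousMap.ext fun x => by
      obtain ⟨p, rfl⟩ := hπ.surjective x
      exact H p
  let J : invariants 𝕜 EM G M n →ₐ[𝕜] C(Q, 𝕜) :=
    { toFun := s
      map_one' := hext fun p => hs _ p
      map_mul' := fun f h => hext fun p => by
        rw [hs, ContinuousMap.mul_apply, hs, hs]; rfl
      map_zero' := hext fun p => hs _ p
      map_add' := fun f h => hext fun p => by
        rw [hs, ContinuousMap.add_apply, hs, hs]; rfl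
      commutes' := fun a => hext fun p => hs _ p }
  have hJ : ∀ f p, J f (π p) = f.1 p.1 := hs
  refine ⟨Ideal.Quotient.liftₐ _ J fun f hf => hext fun p => (hJ f p).trans (hf p.1 p.2), ?_,
    fun f p => hJ f p⟩
  rw [injective_iff_map_eq_zero]
  intro a ha
  obtain ⟨f, rfl⟩ := Ideal.Quotient.mk_surjective a
  refine Ideal.Quotient.eq_zero_iff_mem.2 fun x hx => ?_
  have h0 : J f = 0 := ha
  rw [← hJ f ⟨x, hx⟩, h0]
  rfl

end Quotients

end QuasiPoisson

theorem theorem5 :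
    -- the smooth, real analytic and complex analytic cases
    (∀ (𝕜 : Type*) [RCLike 𝕜] (n : WithTop ℕ∞) (hn : n = ∞ ∨ n = ω)
      (EG : Type*) [NormedAddCommGroup EG] [NormedSpace 𝕜 EG] [FiniteDimensional 𝕜 EG]
      (G : Type*) [TopologicalSpace G] [ChartedSpace EG G] [Group G] [LieGroup 𝓘(𝕜, EG) n G]
      (EM : Type*) [NormedAddCommGroup EM] [NormedSpace 𝕜 EM] [FiniteDimensional 𝕜 EM]
      (M : Type*) [TopologicalSpace M] [ChartedSpace EM M] [IsManifold 𝓘(𝕜, EM) n M]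
      [MulAction G M] [ContMDiffSMul 𝓘(𝕜, EG) 𝓘(𝕜, EM) n G M]
      (c : 𝕜) (H : GroupLieAlgebra 𝓘(𝕜, EG) G ⊗[𝕜] GroupLieAlgebra 𝓘(𝕜, EG) G)
      (P : TensorField₂ 𝕜 EM M) (Φ : M → G),
      IsHamiltonian n hn c H P Φ →
      -- the Poisson bracket on the invariant admissible functions
      ∃ β : PoissonBracket 𝕜 (invariants 𝕜 EM G M n),
        (∀ (f h : invariants 𝕜 EM G M n) (x : M), (β.br f h).1 x = pairing P f.1 h.1 x) ∧
        ∀ C : ConjClasses G, C.carrier ⊆ Set.range Φ →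
          -- the Poisson ideal
          (∀ (f : invariants 𝕜 EM G M n), ∀ F ∈ vanishingIdeal 𝕜 EM n Φ C,
            β.br f F ∈ vanishingIdeal 𝕜 EM n Φ C) ∧
          -- the Poisson bracket on the quotient algebra
          ∃ βC : PoissonBracket 𝕜 (invariants 𝕜 EM G M n ⧸ vanishingIdeal 𝕜 EM n Φ C),
            (∀ f h : invariants 𝕜 EM G M n,
              βC.br (Ideal.Quotient.mk _ f) (Ideal.Quotient.mk _ h) =
                Ideal.Quotient.mk _ (β.br f h)) ∧
            -- the orbit space and the closed orbit quotient are quotients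
            IsQuotient 𝕜 EM n (Quot.mk (SameOrbit Φ C) : level Φ C → OrbitSpace Φ C) ∧
            IsQuotient 𝕜 EM n (Quot.mk (OrbitClosuresMeet Φ C) : level Φ C → ClosureQuotient Φ C) ∧
            -- the Poisson algebra of continuous, admissible functions on any quotient
            ∀ (Q : Type*) [TopologicalSpace Q] (π : level Φ C → Q), IsQuotient 𝕜 EM n π →
              ∃ j : (invariants 𝕜 EM G M n ⧸ vanishingIdeal 𝕜 EM n Φ C) →ₐ[𝕜] C(Q, 𝕜),
                Function.Injective j ∧
                (∀ (f : invariants 𝕜 EM G M n) (p : level Φ C),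
                  j (Ideal.Quotient.mk _ f) (π p) = f.1 p.1) ∧
                (∀ a, IsAdmissibleOn 𝕜 EM n (fun p : level Φ C => j a (π p)) Set.univ) ∧
                ∃ βQ : PoissonBracket 𝕜 j.range, ∀ a b,
                  βQ.br (j.rangeRestrict a) (j.rangeRestrict b) = j.rangeRestrict (βC.br a b)) ∧
    -- the algebraic case
    (∀ (K : Type*) [Field K] [CharZero K]
      (B : Type*) [CommRing B] [HopfAlgebra K B] [Algebra.FiniteType K B] [IsReduced B]
      (A : Type*) [CommRing A] [Algebra K A] [Algebra.Smooth K A]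
      [Algebra B A] [IsScalarTower K B A] (α : AlgAction K B A)
      (c : K) (H : lieAlg K B ⊗[K] lieAlg K B) (P : Derivation K A A ⊗[A] Derivation K A A),
      IsAlgHamiltonian α c H P →
      -- the Poisson bracket on the invariant functions
      ∃ β : PoissonBracket K α.invariants,
        (∀ f h : α.invariants, (β.br f h : A) = algPairing P f h) ∧
        -- geometric points, or real points
        (∀ (Ω : Type*) [Field Ω] [Algebra K Ω], (IsAlgClosed Ω ∨ Nonempty (Ω ≃+* ℝ)) →
          ∀ C : ConjClasses (WithConv (B →ₐ[K] Ω)),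
            C.carrier ⊆ Set.range (phiPoint K B A : (A →ₐ[K] Ω) → WithConv (B →ₐ[K] Ω)) →
            -- the Poisson ideal
            (∀ f : α.invariants, ∀ F ∈ α.vanishingIdeal C, β.br f F ∈ α.vanishingIdeal C) ∧
            -- the Poisson bracket on the quotient algebra
            ∃ βC : PoissonBracket K (α.invariants ⧸ α.vanishingIdeal C),
              (∀ f h : α.invariants,
                βC.br (Ideal.Quotient.mk _ f) (Ideal.Quotient.mk _ h) =
                  Ideal.Quotient.mk _ (β.br f h)) ∧
              -- the Poisson algebra of continuous functions on the orbit space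
              ∀ [TopologicalSpace Ω] [IsTopologicalRing Ω],
                ∃ j : (α.invariants ⧸ α.vanishingIdeal C) →ₐ[K] C(α.OrbitSpace C, Ω),
                  Function.Injective j ∧
                  (∀ (f : α.invariants) (p : AlgLevel A C),
                    j (Ideal.Quotient.mk _ f) (Quot.mk _ p) = p.1 (f : A)) ∧
                  ∃ βQ : PoissonBracket K j.range, ∀ a b,
                    βQ.br (j.rangeRestrict a) (j.rangeRestrict b) =
                      j.rangeRestrict (βC.br a b)) ∧
        -- the affine Poisson variety `Φ⁻¹(C)//G`
        (IsAlgClosed K → IsLinearlyReductive K B →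
          ∀ C : ConjClasses (WithConv (B →ₐ[K] K)),
            C.carrier ⊆ Set.range (phiPoint K B A : (A →ₐ[K] K) → WithConv (B →ₐ[K] K)) →
            Algebra.FiniteType K (α.quotientRing C) ∧
            ∃ e : (α.invariants ⧸ α.vanishingIdeal C) ≃ₐ[K] α.quotientRing C,
              (∀ (f : α.invariants) (p : AlgLevel A C),
                (e (Ideal.Quotient.mk _ f)).1 p = p.1 (f : A)) ∧
              ∃ βX : PoissonBracket K (α.quotientRing C), ∀ f h : α.invariants,
                βX.br (e (Ideal.Quotient.mk _ f)) (e (Ideal.Quotient.mk _ h)) =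
                  e (Ideal.Quotient.mk _ (β.br f h)))) := by
  refine ⟨?_, ?_⟩
  · intro 𝕜 _ n hn EG _ _ _ G _ _ _ _ EM _ _ _ M _ _ _ _ _ c H P Φ hP
    refine ⟨hP.bracket, fun f h x => rfl, fun C _ => ?_⟩
    have hI : ∀ (f : invariants 𝕜 EM G M n), ∀ F ∈ vanishingIdeal 𝕜 EM n Φ C,
        hP.bracket.br f F ∈ vanishingIdeal 𝕜 EM n Φ C :=
      fun f F hF => hP.bracket_mem_vanishingIdeal C f hF
    obtain ⟨βC, hβC⟩ := hP.bracket.exists_quotient _ hI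
    refine ⟨hI, βC, hβC, isQuotient_orbitSpace Φ C 𝕜 EM n, isQuotient_closureQuotient Φ C 𝕜 EM n,
      fun Q _ π hπ => ?_⟩
    obtain ⟨j, hj, hjπ⟩ := hπ.exists_algHom
    refine ⟨j, hj, hjπ, fun a p _ => ?_, βC.exists_range hj⟩
    obtain ⟨f, rfl⟩ := Ideal.Quotient.mk_surjective a
    exact ⟨Set.univ, f.1, isOpen_univ, trivial, f.1.contMDiff.contMDiffOn, fun q _ => hjπ f q⟩
  · intro K _ _ B _ _ _ _ A _ _ _ _ _ α c H P hP
    refine ⟨hP.bracket, fun f h => rfl, fun Ω _ _ hΩ C _ => ?_, fun hK hB C _ => ?_⟩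
    · have hI : ∀ f : α.invariants, ∀ F ∈ α.vanishingIdeal C,
          hP.bracket.br f F ∈ α.vanishingIdeal C :=
        fun f F hF => hP.vanishingIdeal_poisson hΩ C f hF
      obtain ⟨βC, hβC⟩ := hP.bracket.exists_quotient _ hI
      refine ⟨hI, βC, hβC, fun {_ _} => ?_⟩
      obtain ⟨j, hj, hjp⟩ := α.exists_orbitSpace C
      exact ⟨j, hj, hjp, βC.exists_range hj⟩
    · have hI : ∀ f : α.invariants, ∀ F ∈ α.vanishingIdeal C,
          hP.bracket.br f F ∈ α.vanishingIdeal C :=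
        fun f F hF => hP.vanishingIdeal_poisson (Or.inl hK) C f hF
      obtain ⟨βC, hβC⟩ := hP.bracket.exists_quotient _ hI
      obtain ⟨hfin, e, he⟩ := AlgAction.exists_quotientRing hB hP.equivariant C
      refine ⟨hfin, e, he, βC.map e, fun f h => ?_⟩
      rw [βC.map_br, hβC]
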